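/- Let $A$ be a simplicial monoid, i.e. a simplicial object in the category of monoids. Let $\mathbf{Bimod}_A$ be the category of $A$-bimodules, i.e. simplicial sets with a left and a right action of $A$ that commute (equivalently, simplicial sets with an action of $A\times A^{\mathrm{op}}$), with equivariant maps. Let $M\otimes_A N$ be the coequalizer of $M\times A\times N\rightrightarrows M\times N$ with the induced bimodule structure; with the bimodule $A$ as unit this makes $\mathbf{Bimod}_A$ a monoidal category. Then $(\mathbf{Bimod}_A,\otimes_A,A)$ is a monoidal model category. Explicitly: (1) $\mathbf{Bimod}_A$ has all small limits and colimits and carries a model structure with functorial factorizations, in which a map is a fibration (resp. a weak equivalence) if and only if its underlying map of simplicial sets is a Kan fibration (resp. a weak homotopy equivalence). (2) (Pushout product axiom.) If $A_1\to A_2$ and $B_1\to B_2$ are cofibrations in $\mathbf{Bimod}_A$, then the induced map $$(A_1\otimes_A B_2)\coprod_{A_1\otimes_A B_1}(A_2\otimes_A B_1)\longrightarrow A_2\otimes_A B_2$$ is a cofibration, and it is a trivial cofibration if one of the two given maps is trivial. (3) (Unit axiom.) For every weak equivalence $Q\to A$ in $\mathbf{Bimod}_A$ with $Q$ cofibrant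 and every cofibrant $X$, the composites $Q\otimes_A X\to A\otimes_A X\to X$ and $X\otimes_A Q\to X\otimes_A A\to X$ are weak equivalences. -/

import Mathlib

open CategoryTheory Limits MonoidalCategory HomotopicalAlgebra Simplicial Opposite

universe u v w

/-! ### The Kan–Quillen fibrations and weak equivalences of simplicial sets -/

namespace SSet

/-- Kan fibrations: the maps with the right lifting property against all horn inclusions
`Λ[n + 1, i] ⟶ Δ[n + 1]`. -/
def kanFibrations : MorphismProperty SSet.{u} := modelCategoryQuillen.J.rlp

/-- The set `[X, K]` of simplicial homotopy classes of maps `X ⟶ K`: the quotient of the set of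
maps by the equivalence relation generated by homotopies `X ⊗ Δ[1] ⟶ K`. -/
def HomotopyClasses (X K : SSet.{u}) : Type u :=
  Quot (fun f g : X ⟶ K => Nonempty (Homotopy f g))

/-- Precomposition of a homotopy with a map. -/
noncomputable def homotopyPrecomp {X Y K : SSet.{u}} (f : X ⟶ Y) {g h : Y ⟶ K}
    (H : Homotopy g h) : Homotopy (f ≫ g) (f ≫ h) where
  h := f ▷ Δ[1] ≫ H.h
  h₀ := (ι₀_comp_assoc f H.h).symm.trans (congrArg (fun k => f ≫ k) H.h₀)
  h₁ := (ι₁_comp_assoc f H.h).symm.trans (congrArg (fun k => f ≫ k) H.h₁)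
  rel := by
    ext n x
    exact (x.1.2 : False).elim

/-- The map `f^* : [Y, K] → [X, K]` induced by `f : X ⟶ Y`. -/
def HomotopyClasses.precomp {X Y : SSet.{u}} (f : X ⟶ Y) (K : SSet.{u}) :
    HomotopyClasses Y K → HomotopyClasses X K :=
  Quot.map (fun g => f ≫ g) (fun _ _ ⟨H⟩ => ⟨homotopyPrecomp f H⟩)

/-- Weak (homotopy) equivalences of simplicial sets: the maps `f : X ⟶ Y` such that
`f^* : [Y, K] → [X, K]` is bijective for every Kan complex `K`. -/
def weakHomotopyEquivalences : MorphismProperty SSet.{u} := fun _ _ f =>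
  ∀ (K : SSet.{u}) [KanComplex K], Function.Bijective (HomotopyClasses.precomp f K)

end SSet

/-! ### Simplicial monoids and their bimodules -/

/-- A simplicial monoid (simplicial object in the category of monoids), regarded as a monoid
object in the cartesian monoidal category of simplicial sets. -/
noncomputable def simplicialMonoidToMon (A : SimplicialObject MonCat.{u}) : Mon SSet.{u} where
  X := ((SimplicialObject.whiskering _ _).obj (forget MonCat.{u})).obj A
  mon :=
    { one :=
        { app := fun n => TypeCat.ofHom (fun _ => (1 : A.obj n))
          naturality := fun m n f => by
            ext x
            exact (map_one (A.map f).hom).symm }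
      mul :=
        { app := fun n => TypeCat.ofHom
            (fun x : A.obj n × A.obj n => (x.1 * x.2 : A.obj n))
          naturality := fun m n f => by
            ext (x : A.obj m × A.obj m)
            exact (map_mul (A.map f).hom x.1 x.2).symm }
      one_mul := by
        ext n x
        exact one_mul (M := A.obj n) x.2
      mul_one := by
        ext n x
        exact mul_one (M := A.obj n) x.1
      mul_assoc := by
        ext n x
        exact mul_assoc (G := A.obj n) x.1.1 x.1.2 x.2 }

/-- The category of `A`-bimodules: simplicial sets with commuting left and right actions of the
simplicial monoid `A`, and equivariant maps. -/
abbrev SimplicialBimod (A : SimplicialObject MonCat.{u}) : Type (u + 1) :=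
  Bimod (simplicialMonoidToMon A) (simplicialMonoidToMon A)

/-- The forgetful functor from `A`-bimodules to simplicial sets. -/
noncomputable abbrev SimplicialBimod.forget (A : SimplicialObject MonCat.{u}) :
    SimplicialBimod A ⥤ SSet.{u} :=
  Bimod.forget (simplicialMonoidToMon A)

/-- Endomorphisms of a monoid object in the bicategory of monoid objects and bimodules; this only
supplies the coherence laws for the monoidal structure below. -/
@[reducible]
noncomputable def bimodEndMonoidal (M : Mon SSet.{u}) : MonoidalCategory (Bimod M M) :=
  letI : Bicategory (Mon SSet.{u}) := Bimod.monBicategory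
  inferInstanceAs (MonoidalCategory (EndMonoidal M))

/-- The monoidal structure on bimodules over a monoid object `A` in simplicial sets: the tensor
product `M ⊗_A N` is the coequalizer of `M × A × N ⇉ M × N` with the induced actions, and the
unit is `A` with its left and right multiplications. -/
noncomputable instance bimodMonoidalCategory (A : Mon SSet.{u}) :
    MonoidalCategory (Bimod A A) where
  tensorObj M N := Bimod.tensorBimod M N
  whiskerLeft M _ _ f := Bimod.whiskerLeft M f
  whiskerRight f N := Bimod.whiskerRight f N
  tensorUnit := Bimod.regular A
  associator M N P := Bimod.associatorBimod M N P
  leftUnitor M := Bimod.leftUnitorBimod M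
  rightUnitor M := Bimod.rightUnitorBimod M
  id_tensorHom_id := (bimodEndMonoidal A).id_tensorHom_id
  tensorHom_comp_tensorHom := (bimodEndMonoidal A).tensorHom_comp_tensorHom
  whiskerLeft_id := (bimodEndMonoidal A).whiskerLeft_id
  id_whiskerRight := (bimodEndMonoidal A).id_whiskerRight
  associator_naturality := (bimodEndMonoidal A).associator_naturality
  leftUnitor_naturality := (bimodEndMonoidal A).leftUnitor_naturality
  rightUnitor_naturality := (bimodEndMonoidal A).rightUnitor_naturality
  pentagon := (bimodEndMonoidal A).pentagon
  triangle := (bimodEndMonoidal A).triangle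

/-! ### Monoidal model categories -/

/-- A monoidal model category: a model category with a monoidal structure which satisfies the
pushout product axiom and the unit axiom. -/
class IsMonoidalModelCategory (C : Type w) [Category.{v} C] [MonoidalCategory C]
    [ModelCategory C] : Prop where
  /-- The pushout product `A₁ ⊗ B₂ ⨿_{A₁ ⊗ B₁} A₂ ⊗ B₁ ⟶ A₂ ⊗ B₂` of two cofibrations is
  a cofibration. -/
  cofibration_pushoutProduct {A₁ A₂ B₁ B₂ : C} (f : A₁ ⟶ A₂) (g : B₁ ⟶ B₂)
    [Cofibration f] [Cofibration g] :
    Cofibration ((Arrow.pushoutProduct.obj (Arrow.mk f)).obj (Arrow.mk g)).hom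
  /-- If the first cofibration is trivial, so is the pushout product. -/
  weakEquivalence_pushoutProduct_left {A₁ A₂ B₁ B₂ : C} (f : A₁ ⟶ A₂) (g : B₁ ⟶ B₂)
    [Cofibration f] [Cofibration g] [WeakEquivalence f] :
    WeakEquivalence ((Arrow.pushoutProduct.obj (Arrow.mk f)).obj (Arrow.mk g)).hom
  /-- If the second cofibration is trivial, so is the pushout product. -/
  weakEquivalence_pushoutProduct_right {A₁ A₂ B₁ B₂ : C} (f : A₁ ⟶ A₂) (g : B₁ ⟶ B₂)
    [Cofibration f] [Cofibration g] [WeakEquivalence g] :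
    WeakEquivalence ((Arrow.pushoutProduct.obj (Arrow.mk f)).obj (Arrow.mk g)).hom
  /-- The unit axiom: for every cofibrant replacement `q : Q ⟶ 𝟙_ C` of the unit and every
  cofibrant `X`, the composite `Q ⊗ X ⟶ 𝟙_ C ⊗ X ⟶ X` is a weak equivalence. -/
  unit_left {Q : C} (q : Q ⟶ 𝟙_ C) [IsCofibrant Q] [WeakEquivalence q]
    (X : C) [IsCofibrant X] : WeakEquivalence (q ▷ X ≫ (λ_ X).hom)
  /-- The unit axiom from the right. -/
  unit_right {Q : C} (q : Q ⟶ 𝟙_ C) [IsCofibrant Q] [WeakEquivalence q]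
    (X : C) [IsCofibrant X] : WeakEquivalence (X ◁ q ≫ (ρ_ X).hom)

/-!
The bimodules over a simplicial monoid `R` inherit their model structure from simplicial sets along
the forgetful functor. What makes the transfer work, and makes the tensor product compatible with it,
is that this functor has adjoints on both sides and that free bimodules have the simple form
`R ⊗ (K ⊗ R)`.

*Simplicial sets.* The homotopy-theoretic input is that the Kan fibrations which are weak homotopy
equivalences are exactly the maps with the right lifting property against all monomorphisms
(`SSet.trivialKanFibrations_iff`). Over a Kan complex this is a direct manipulation of homotopies
(`SSet.kanFibrations.trivialKanFibrations_of_kanComplex`). An arbitrary base embeds in a Kan complex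
by an anodyne extension, so that it is enough to extend a Kan fibration along this extension
(`SSet.kanFibrations.exists_extension`): anodyne extensions are stable under base change along Kan
fibrations (`SSet.anodyneExtensions.of_isPullback`), so the extension is again a weak homotopy
equivalence, and trivial fibrations are stable under base change. Extending Kan fibrations along
anodyne maps means that the simplicial set classifying the Kan fibrations with fibres in a fixed
infinite set is a Kan complex (`SSet.kanComplex_fibrationUniverse`), that is, that Kan fibrations
extend from horns to simplices (`SSet.kanFibrations.exists_extension_horn`). This in turn holds
because a horn is a deformation retract of the simplex in such a way that the homotopy preserves the
horn: pulling back along the retraction gives a fibration over the simplex whose restriction to the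
horn is equivalent to the given one, and the equivalence is removed by passing to a path space and to
a deformation retract of it. Cardinalities are controlled by a Löwenheim–Skolem argument
(`SSet.kanFibrations.exists_small`).

*Bimodules.* Bimodules over `R` are the functors to sets on a category whose objects are the
simplicial degrees and whose maps are simplicial operators together with a simplex of `R` on each
side (`SSet.Operators`). Hence limits and colimits exist and are computed on underlying simplicial
sets, the forgetful functor is both a left and a right adjoint, and every colimit-preserving functor
on bimodules, in particular the tensor product with a bimodule, is a left adjoint. The model
structure is given by the small object argument for the free maps on boundary and horn inclusions.
Since the forgetful functor is a left adjoint, the underlying map of a map generated by free maps on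
horn inclusions is anodyne (`SSet.anodyneExtensions_hom_of_bimodJ_rlp_llp`), and this is what
the two factorization systems need to fit together.

*Tensor products.* By adjunction the pushout product axiom has only to be checked on free maps
(`SSet.hasLiftingProperty_pushoutObjObj`). The tensor product of the free bimodules on `K` and `L`
is the free bimodule on `K ⊗ (R ⊗ L)`, so that the pushout product of two free maps is free on
a pushout product of simplicial sets (`SSet.freeBimodPushoutObjObj`). The unit axiom holds because
the tensor product with a cofibrant bimodule preserves all weak equivalences: it preserves the maps
whose underlying maps are anodyne (`SSet.anodyneExtensions_whiskerRight_hom`), and a weak equivalence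
`q : Q ⟶ N` is compared with such maps by a factorization of `(q, 𝟙) : Q ⨿ N ⟶ N`
(`SSet.weakHomotopyEquivalences_map_of_anodyneExtensions`).
-/

namespace SSet

open CartesianMonoidalCategory

/-! ### Lifting properties and homotopy extension -/

/-- Trivial Kan fibrations: the maps with the right lifting property against all monomorphisms. -/
def trivialKanFibrations : MorphismProperty SSet.{u} := (MorphismProperty.monomorphisms _).rlp

lemma trivialKanFibrations_eq_rlp_I :
    trivialKanFibrations.{u} = modelCategoryQuillen.I.rlp := rlp_monomorphisms

lemma trivialKanFibrations_le_kanFibrations :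
    trivialKanFibrations.{u} ≤ kanFibrations :=
  MorphismProperty.antitone_rlp modelCategoryQuillen.J_le_monomorphisms

lemma trivialKanFibrations.exists_lift {A B X Y : SSet.{u}} {j : A ⟶ B} [Mono j] {p : X ⟶ Y}
    (hp : trivialKanFibrations p) (a : A ⟶ X) (b : B ⟶ Y) (h : a ≫ p = j ≫ b) :
    ∃ l : B ⟶ X, j ≫ l = a ∧ l ≫ p = b := by
  have := hp j (inferInstanceAs (Mono j))
  have sq : CommSq a j p b := ⟨h⟩
  exact ⟨sq.lift, sq.fac_left, sq.fac_right⟩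

lemma anodyneExtensions.exists_lift {A B X Y : SSet.{u}} {j : A ⟶ B} {p : X ⟶ Y}
    (hj : anodyneExtensions j) (hp : kanFibrations p) (a : A ⟶ X) (b : B ⟶ Y)
    (h : a ≫ p = j ≫ b) :
    ∃ l : B ⟶ X, j ≫ l = a ∧ l ≫ p = b := by
  have := hj p hp
  have sq : CommSq a j p b := ⟨h⟩
  exact ⟨sq.lift, sq.fac_left, sq.fac_right⟩

open modelCategoryQuillen in
lemma kanComplex_iff (K : SSet.{u}) : KanComplex K ↔ kanFibrations (terminal.from K) :=
  (isFibrant_iff K).trans (modelCategoryQuillen.fibration_iff _)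

lemma anodyneExtensions.exists_extension {A B : SSet.{u}} {j : A ⟶ B}
    (hj : anodyneExtensions j) (K : SSet.{u}) [KanComplex K] (a : A ⟶ K) :
    ∃ l : B ⟶ K, j ≫ l = a := by
  obtain ⟨l, hl, -⟩ := hj.exists_lift ((kanComplex_iff K).1 inferInstance) a (terminal.from B)
    (Subsingleton.elim _ _)
  exact ⟨l, hl⟩

lemma whiskerLeft_δ_one (A : SSet.{u}) :
    A ◁ stdSimplex.δ (1 : Fin 2) = fst A Δ[0] ≫ ι₀ := by
  rw [stdSimplex.δ_one_eq_const]
  rfl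

lemma whiskerLeft_δ_zero (A : SSet.{u}) :
    A ◁ stdSimplex.δ (0 : Fin 2) = fst A Δ[0] ≫ ι₁ := by
  rw [stdSimplex.δ_zero_eq_const]
  rfl

open modelCategoryQuillen in
lemma anodyneExtensions_δ (i : Fin 2) :
    anodyneExtensions.{u} (stdSimplex.δ i : Δ[0] ⟶ Δ[1]) := by
  intro X Y p hp
  refine ⟨fun {a b} sq => ?_⟩
  obtain ⟨φ, h1, h2⟩ : ∃ φ : Δ[1] ⟶ X, stdSimplex.δ i ≫ φ = a ∧ φ ≫ p = b := by
    have hp' : modelCategoryQuillen.J.rlp p := hp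
    have : Fibration p := (modelCategoryQuillen.fibration_iff p).2 hp'
    have hc := (horn.isCompatible_zero_iff_true (X := X) (i := i.rev) (fun _ _ => a)).2 trivial
    obtain ⟨φ, h1, h2⟩ := hc.exists_lift p b (by
      intro j hj
      obtain rfl : j = i := by clear hc sq; revert hj; revert i j; decide
      exact sq.w)
    refine ⟨φ, h1 i (by clear h1 hc sq; revert i; decide), h2⟩
  exact ⟨⟨{ l := φ, fac_left := h1, fac_right := h2 }⟩⟩

/-- Homotopy lifting, relative to a monomorphism, from the end `0` of the interval. -/
lemma kanFibrations.exists_homotopy_lift {A B X Y : SSet.{u}} {p : X ⟶ Y} (hp : kanFibrations p)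
    (i : A ⟶ B) [Mono i] (g : B ⟶ X) (H : A ⊗ Δ[1] ⟶ X) (G : B ⊗ Δ[1] ⟶ Y)
    (h₁ : ι₀ ≫ H = i ≫ g) (h₂ : H ≫ p = i ▷ Δ[1] ≫ G) (h₃ : g ≫ p = ι₀ ≫ G) :
    ∃ L : B ⊗ Δ[1] ⟶ X, ι₀ ≫ L = g ∧ i ▷ Δ[1] ≫ L = H ∧ L ≫ p = G := by
  let sq := Functor.PushoutObjObj.ofHasPushout (curriedTensor SSet.{u}) i
    (stdSimplex.δ (1 : Fin 2))
  have hsq := anodyneExtensions_pushoutObjObjι sq (anodyneExtensions_δ 1)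
  have e₁ : sq.inl ≫ sq.ι = B ◁ stdSimplex.δ (1 : Fin 2) := sq.inl_ι
  have e₂ : sq.inr ≫ sq.ι = i ▷ Δ[1] := sq.inr_ι
  have w : i ▷ Δ[0] ≫ fst B Δ[0] ≫ g = A ◁ stdSimplex.δ (1 : Fin 2) ≫ H := by
    rw [whiskerLeft_δ_one, Category.assoc, h₁]; rfl
  obtain ⟨L, hL₁, hL₂⟩ := hsq.exists_lift hp (sq.isPushout.desc (fst B Δ[0] ≫ g) H w) G (by
    apply sq.isPushout.hom_ext
    · rw [sq.isPushout.inl_desc_assoc, reassoc_of% e₁, whiskerLeft_δ_one, Category.assoc,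
        Category.assoc, h₃]
    · rw [sq.isPushout.inr_desc_assoc, reassoc_of% e₂, h₂])
  refine ⟨L, ?_, ?_, hL₂⟩
  · have := sq.inl ≫= hL₁
    rw [sq.isPushout.inl_desc, reassoc_of% e₁, whiskerLeft_δ_one, Category.assoc] at this
    exact lift (𝟙 B) (stdSimplex.isTerminalObj₀.from B) ≫= this
  · have := sq.inr ≫= hL₁
    rwa [sq.isPushout.inr_desc, reassoc_of% e₂] at this

/-- Homotopy lifting, relative to a monomorphism, from the end `1` of the interval. -/
lemma kanFibrations.exists_homotopy_lift' {A B X Y : SSet.{u}} {p : X ⟶ Y} (hp : kanFibrations p)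
    (i : A ⟶ B) [Mono i] (g : B ⟶ X) (H : A ⊗ Δ[1] ⟶ X) (G : B ⊗ Δ[1] ⟶ Y)
    (h₁ : ι₁ ≫ H = i ≫ g) (h₂ : H ≫ p = i ▷ Δ[1] ≫ G) (h₃ : g ≫ p = ι₁ ≫ G) :
    ∃ L : B ⊗ Δ[1] ⟶ X, ι₁ ≫ L = g ∧ i ▷ Δ[1] ≫ L = H ∧ L ≫ p = G := by
  let sq := Functor.PushoutObjObj.ofHasPushout (curriedTensor SSet.{u}) i
    (stdSimplex.δ (0 : Fin 2))
  have hsq := anodyneExtensions_pushoutObjObjι sq (anodyneExtensions_δ 0)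
  have e₁ : sq.inl ≫ sq.ι = B ◁ stdSimplex.δ (0 : Fin 2) := sq.inl_ι
  have e₂ : sq.inr ≫ sq.ι = i ▷ Δ[1] := sq.inr_ι
  have w : i ▷ Δ[0] ≫ fst B Δ[0] ≫ g = A ◁ stdSimplex.δ (0 : Fin 2) ≫ H := by
    rw [whiskerLeft_δ_zero, Category.assoc, h₁]; rfl
  obtain ⟨L, hL₁, hL₂⟩ := hsq.exists_lift hp (sq.isPushout.desc (fst B Δ[0] ≫ g) H w) G (by
    apply sq.isPushout.hom_ext
    · rw [sq.isPushout.inl_desc_assoc, reassoc_of% e₁, whiskerLeft_δ_zero, Category.assoc,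
        Category.assoc, h₃]
    · rw [sq.isPushout.inr_desc_assoc, reassoc_of% e₂, h₂])
  refine ⟨L, ?_, ?_, hL₂⟩
  · have := sq.inl ≫= hL₁
    rw [sq.isPushout.inl_desc, reassoc_of% e₁, whiskerLeft_δ_zero, Category.assoc] at this
    exact lift (𝟙 B) (stdSimplex.isTerminalObj₀.from B) ≫= this
  · have := sq.inr ≫= hL₁
    rwa [sq.isPushout.inr_desc, reassoc_of% e₂] at this

lemma mem_boundary_one_iff {n : ℕ} (t : (Δ[1] : SSet.{u}) _⦋n⦌) :
    t ∈ (∂Δ[1] : (Δ[1] : SSet.{u}).Subcomplex).obj (op ⦋n⦌) ↔ (∀ k, t k = 0) ∨ (∀ k, t k = 1) := by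
  have h : t ∈ (∂Δ[1] : (Δ[1] : SSet.{u}).Subcomplex).obj (op ⦋n⦌) ↔
      ¬ Function.Surjective t := Iff.rfl
  rw [h]
  constructor
  · intro h
    simp only [Function.Surjective, not_forall] at h
    obtain ⟨b, hb⟩ := h
    obtain rfl | rfl : b = 0 ∨ b = 1 := by lia
    · right
      intro k
      by_contra h
      exact hb ⟨k, by lia⟩
    · left
      intro k
      by_contra h
      exact hb ⟨k, by lia⟩
  · rintro (h | h) hs
    · obtain ⟨k, hk⟩ := hs 1
      simp [h] at hk
    · obtain ⟨k, hk⟩ := hs 0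
      simp [h] at hk

/-- The map `B ⊗ ∂Δ[1] ⟶ X` given by two maps `B ⟶ X`. -/
noncomputable def boundaryDesc {B X : SSet.{u}} (g₀ g₁ : B ⟶ X) :
    B ⊗ (∂Δ[1] : SSet.{u}) ⟶ X where
  app n := TypeCat.ofHom fun x =>
    if stdSimplex.asOrderHom x.2.1 0 = 0 then g₀.app n x.1 else g₁.app n x.1
  naturality m n f := by
    ext ⟨b, t, ht⟩
    induction m using Opposite.rec with | _ m
    induction n using Opposite.rec with | _ n
    induction m using SimplexCategory.rec with | _ m
    induction n using SimplexCategory.rec with | _ n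
    have h : stdSimplex.asOrderHom (Δ[1].map f t) 0 = stdSimplex.asOrderHom t 0 := by
      change stdSimplex.asOrderHom t (f.unop.toOrderHom 0) = _
      rw [mem_boundary_one_iff] at ht
      obtain h | h := ht
      · exact (h _).trans (h _).symm
      · exact (h _).trans (h _).symm
    have e₀ : g₀.app _ (B.map f b) = X.map f (g₀.app _ b) := NatTrans.naturality_apply g₀ f b
    have e₁ : g₁.app _ (B.map f b) = X.map f (g₁.app _ b) := NatTrans.naturality_apply g₁ f b
    change (if stdSimplex.asOrderHom (Δ[1].map f t) 0 = 0 then g₀.app _ (B.map f b) else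
      g₁.app _ (B.map f b)) = X.map f (if stdSimplex.asOrderHom t 0 = 0 then g₀.app _ b else
      g₁.app _ b)
    rw [h, e₀, e₁]
    split_ifs <;> rfl

/-- The inclusion of `A` in `A ⊗ ∂Δ[1]` at the vertex `0` or `1`. -/
noncomputable def boundaryι (A : SSet.{u}) (k : Fin 2) : A ⟶ A ⊗ (∂Δ[1] : SSet.{u}) :=
  lift (𝟙 A) (const ⟨stdSimplex.obj₀Equiv.{u}.symm k, by
    intro hs
    obtain ⟨a, ha⟩ := hs 0
    obtain ⟨b, hb⟩ := hs 1
    have : a = b := Subsingleton.elim (α := Fin 1) a b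
    subst this
    rw [ha] at hb
    exact absurd hb (by decide)⟩)

lemma boundaryι_zero_ι (A : SSet.{u}) : boundaryι A 0 ≫ A ◁ ∂Δ[1].ι = ι₀ := rfl

lemma boundaryι_one_ι (A : SSet.{u}) : boundaryι A 1 ≫ A ◁ ∂Δ[1].ι = ι₁ := rfl

lemma boundaryι_whiskerRight {A B : SSet.{u}} (f : A ⟶ B) (k : Fin 2) :
    boundaryι A k ≫ f ▷ _ = f ≫ boundaryι B k := rfl

lemma boundary_hom_ext {A X : SSet.{u}} {f g : A ⊗ (∂Δ[1] : SSet.{u}) ⟶ X}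
    (h₀ : boundaryι A 0 ≫ f = boundaryι A 0 ≫ g) (h₁ : boundaryι A 1 ≫ f = boundaryι A 1 ≫ g) :
    f = g := by
  ext n ⟨a, t, ht⟩
  induction n using Opposite.rec with | _ n
  induction n using SimplexCategory.rec with | _ n
  have key : ∀ k : Fin 2, (∀ j, t j = k) →
      (boundaryι A k).app (op ⦋n⦌) a = ⟨a, t, ht⟩ := by
    intro k hk
    refine Prod.ext rfl (Subtype.ext ?_)
    exact stdSimplex.ext _ _ fun i => (hk i).symm
  rw [mem_boundary_one_iff] at ht
  obtain h | h := ht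
  · rw [← key 0 h]
    exact ConcreteCategory.congr_hom (NatTrans.congr_app h₀ _) a
  · rw [← key 1 h]
    exact ConcreteCategory.congr_hom (NatTrans.congr_app h₁ _) a

@[simp]
lemma boundaryι_zero_boundaryDesc {B X : SSet.{u}} (g₀ g₁ : B ⟶ X) :
    boundaryι B 0 ≫ boundaryDesc g₀ g₁ = g₀ := by
  ext n b
  change (if (0 : Fin 2) = 0 then g₀.app n b else g₁.app n b) = g₀.app n b
  simp

@[simp]
lemma boundaryι_one_boundaryDesc {B X : SSet.{u}} (g₀ g₁ : B ⟶ X) :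
    boundaryι B 1 ≫ boundaryDesc g₀ g₁ = g₁ := by
  ext n b
  change (if (1 : Fin 2) = 0 then g₀.app n b else g₁.app n b) = g₁.app n b
  simp

/-- The lifting property against the Leibniz product of `i` with `∂Δ[1] ⟶ Δ[1]`, spelled out as an
extension property for homotopies with prescribed ends. -/
lemma exists_homotopy_extension_of_hasLiftingProperty {A B X Y : SSet.{u}} {p : X ⟶ Y} {i : A ⟶ B}
    (hp : HasLiftingProperty
      (Functor.PushoutObjObj.ofHasPushout (curriedTensor SSet.{u}) i ∂Δ[1].ι).ι p)
    (g₀ g₁ : B ⟶ X) (H : A ⊗ Δ[1] ⟶ X) (G : B ⊗ Δ[1] ⟶ Y)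
    (h₀ : ι₀ ≫ H = i ≫ g₀) (h₁ : ι₁ ≫ H = i ≫ g₁) (h₂ : H ≫ p = i ▷ Δ[1] ≫ G)
    (h₃ : g₀ ≫ p = ι₀ ≫ G) (h₄ : g₁ ≫ p = ι₁ ≫ G) :
    ∃ L : B ⊗ Δ[1] ⟶ X, ι₀ ≫ L = g₀ ∧ ι₁ ≫ L = g₁ ∧ i ▷ Δ[1] ≫ L = H ∧ L ≫ p = G := by
  let sq := Functor.PushoutObjObj.ofHasPushout (curriedTensor SSet.{u}) i ∂Δ[1].ι
  have e₁ : sq.inl ≫ sq.ι = B ◁ ∂Δ[1].ι := sq.inl_ι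
  have e₂ : sq.inr ≫ sq.ι = i ▷ Δ[1] := sq.inr_ι
  have w : i ▷ _ ≫ boundaryDesc g₀ g₁ = A ◁ ∂Δ[1].ι ≫ H := by
    apply boundary_hom_ext
    · rw [reassoc_of% boundaryι_whiskerRight, boundaryι_zero_boundaryDesc,
        reassoc_of% boundaryι_zero_ι, h₀]
    · rw [reassoc_of% boundaryι_whiskerRight, boundaryι_one_boundaryDesc,
        reassoc_of% boundaryι_one_ι, h₁]
  have comm : CommSq (sq.isPushout.desc (boundaryDesc g₀ g₁) H w) sq.ι p G := ⟨by
    apply sq.isPushout.hom_ext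
    · rw [sq.isPushout.inl_desc_assoc, reassoc_of% e₁]
      apply boundary_hom_ext
      · rw [reassoc_of% boundaryι_zero_boundaryDesc, reassoc_of% boundaryι_zero_ι, h₃]
      · rw [reassoc_of% boundaryι_one_boundaryDesc, reassoc_of% boundaryι_one_ι, h₄]
    · rw [sq.isPushout.inr_desc_assoc, reassoc_of% e₂, h₂]⟩
  have hL₁ := comm.fac_left
  have hl := sq.inl ≫= hL₁
  rw [sq.isPushout.inl_desc, reassoc_of% e₁] at hl
  refine ⟨comm.lift, ?_, ?_, ?_, comm.fac_right⟩
  · have := boundaryι B 0 ≫= hl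
    rwa [reassoc_of% boundaryι_zero_ι, boundaryι_zero_boundaryDesc] at this
  · have := boundaryι B 1 ≫= hl
    rwa [reassoc_of% boundaryι_one_ι, boundaryι_one_boundaryDesc] at this
  · have := sq.inr ≫= hL₁
    rwa [sq.isPushout.inr_desc, reassoc_of% e₂] at this

/-- Homotopies with prescribed ends, relative to an anodyne extension. -/
lemma kanFibrations.exists_homotopy_extension {A B X Y : SSet.{u}} {p : X ⟶ Y}
    (hp : kanFibrations p) {i : A ⟶ B} (hi : anodyneExtensions i)
    (g₀ g₁ : B ⟶ X) (H : A ⊗ Δ[1] ⟶ X) (G : B ⊗ Δ[1] ⟶ Y)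
    (h₀ : ι₀ ≫ H = i ≫ g₀) (h₁ : ι₁ ≫ H = i ≫ g₁) (h₂ : H ≫ p = i ▷ Δ[1] ≫ G)
    (h₃ : g₀ ≫ p = ι₀ ≫ G) (h₄ : g₁ ≫ p = ι₁ ≫ G) :
    ∃ L : B ⊗ Δ[1] ⟶ X, ι₀ ≫ L = g₀ ∧ ι₁ ≫ L = g₁ ∧ i ▷ Δ[1] ≫ L = H ∧ L ≫ p = G :=
  exists_homotopy_extension_of_hasLiftingProperty
    (anodyneExtensions_pushoutObjObjι' _ hi _ hp) g₀ g₁ H G h₀ h₁ h₂ h₃ h₄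

lemma mono_pushoutObjObj_ι {A B A' B' : SSet.{u}} (i : A ⟶ B) (j : A' ⟶ B') [Mono i] [Mono j]
    (sq : (curriedTensor SSet.{u}).PushoutObjObj i j) : Mono sq.ι := by
  have e (X Y : SSet.{u}) (f : X ⟶ Y) [Mono f] :
      Nonempty (Arrow.mk f ≅ Arrow.mk (Subcomplex.range f).ι) :=
    ⟨Arrow.isoMk (asIso (Subcomplex.toRange f)) (Iso.refl _)⟩
  obtain ⟨ei⟩ := e _ _ i
  obtain ⟨ej⟩ := e _ _ j
  let sq' := Functor.PushoutObjObj.ofHasPushout (curriedTensor SSet.{u})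
    (Subcomplex.range i).ι j
  let e₁ := Functor.PushoutObjObj.ι_iso_of_iso_left (f₁ := Arrow.mk i) (f₂ := Arrow.mk j)
    (f₁' := Arrow.mk (Subcomplex.range i).ι) sq sq' ei
  let e₂ := Functor.PushoutObjObj.ι_iso_of_iso_right
    (f₁ := Arrow.mk (Subcomplex.range i).ι) (f₂ := Arrow.mk j)
    (f₂' := Arrow.mk (Subcomplex.range j).ι) sq'
    (Subcomplex.unionProd.pushoutObjObj (Subcomplex.range i) (Subcomplex.range j)) ej
  exact ((MorphismProperty.monomorphisms SSet.{u}).arrow_mk_iso_iff (e₁ ≪≫ e₂)).2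
    (inferInstanceAs (Mono (Subcomplex.unionProd _ _).ι))

/-- Homotopies with prescribed ends, relative to a monomorphism. -/
lemma trivialKanFibrations.exists_homotopy_extension {A B X Y : SSet.{u}} {p : X ⟶ Y}
    (hp : trivialKanFibrations p) (i : A ⟶ B) [Mono i]
    (g₀ g₁ : B ⟶ X) (H : A ⊗ Δ[1] ⟶ X) (G : B ⊗ Δ[1] ⟶ Y)
    (h₀ : ι₀ ≫ H = i ≫ g₀) (h₁ : ι₁ ≫ H = i ≫ g₁) (h₂ : H ≫ p = i ▷ Δ[1] ≫ G)
    (h₃ : g₀ ≫ p = ι₀ ≫ G) (h₄ : g₁ ≫ p = ι₁ ≫ G) :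
    ∃ L : B ⊗ Δ[1] ⟶ X, ι₀ ≫ L = g₀ ∧ ι₁ ≫ L = g₁ ∧ i ▷ Δ[1] ≫ L = H ∧ L ≫ p = G :=
  exists_homotopy_extension_of_hasLiftingProperty
    (hp _ (mono_pushoutObjObj_ι i ∂Δ[1].ι _)) g₀ g₁ H G h₀ h₁ h₂ h₃ h₄

/-! ### Homotopies and weak homotopy equivalences -/

lemma anodyneExtensions_ι₀ (B : SSet.{u}) : anodyneExtensions (ι₀ : B ⟶ B ⊗ Δ[1]) := by
  have : IsIso (fst B (Δ[0] : SSet.{u})) :=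
    ⟨lift (𝟙 B) (stdSimplex.isTerminalObj₀.from B),
      CartesianMonoidalCategory.hom_ext _ _ (by simp) (stdSimplex.isTerminalObj₀.hom_ext _ _),
      by simp⟩
  rw [← anodyneExtensions.cancel_left_of_respectsIso (fst B (Δ[0] : SSet.{u})),
    ← whiskerLeft_δ_one]
  exact (anodyneExtensions_δ 1).whiskerLeft B

lemma anodyneExtensions_ι₁ (B : SSet.{u}) : anodyneExtensions (ι₁ : B ⟶ B ⊗ Δ[1]) := by
  have : IsIso (fst B (Δ[0] : SSet.{u})) :=
    ⟨lift (𝟙 B) (stdSimplex.isTerminalObj₀.from B),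
      CartesianMonoidalCategory.hom_ext _ _ (by simp) (stdSimplex.isTerminalObj₀.hom_ext _ _),
      by simp⟩
  rw [← anodyneExtensions.cancel_left_of_respectsIso (fst B (Δ[0] : SSet.{u})),
    ← whiskerLeft_δ_zero]
  exact (anodyneExtensions_δ 0).whiskerLeft B

/-- Two maps are homotopic if they are the ends of a homotopy `X ⊗ Δ[1] ⟶ Y`. -/
def Homotopic {X Y : SSet.{u}} (f g : X ⟶ Y) : Prop :=
  ∃ H : X ⊗ Δ[1] ⟶ Y, ι₀ ≫ H = f ∧ ι₁ ≫ H = g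

lemma nonempty_homotopy_iff {X Y : SSet.{u}} (f g : X ⟶ Y) :
    Nonempty (Homotopy f g) ↔ Homotopic f g := by
  constructor
  · rintro ⟨H⟩
    exact ⟨H.h, H.h₀, H.h₁⟩
  · rintro ⟨H, h₀, h₁⟩
    exact ⟨{ h := H, h₀ := h₀, h₁ := h₁, rel := by ext n x; exact (x.1.2 : False).elim }⟩

lemma Homotopic.refl {X Y : SSet.{u}} (f : X ⟶ Y) : Homotopic f f :=
  ⟨fst _ _ ≫ f, rfl, rfl⟩

lemma Homotopic.precomp {X Y Z : SSet.{u}} {g h : Y ⟶ Z} (H : Homotopic g h) (f : X ⟶ Y) :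
    Homotopic (f ≫ g) (f ≫ h) := by
  obtain ⟨H, h₀, h₁⟩ := H
  exact ⟨f ▷ _ ≫ H, by rw [ι₀_comp_assoc, h₀], by rw [ι₁_comp_assoc, h₁]⟩

lemma Homotopic.postcomp {X Y Z : SSet.{u}} {g h : X ⟶ Y} (H : Homotopic g h) (f : Y ⟶ Z) :
    Homotopic (g ≫ f) (h ≫ f) := by
  obtain ⟨H, h₀, h₁⟩ := H
  exact ⟨H ≫ f, by rw [reassoc_of% h₀], by rw [reassoc_of% h₁]⟩

/-- Two homotopies with the same start, whose projections to the base of a Kan fibration are two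
faces of a map from `X ⊗ Δ[2]`, are two faces of a lift of that map. -/
lemma kanFibrations.exists_lift_horn₂₀ {X E B : SSet.{u}} {q : E ⟶ B} (hq : kanFibrations q)
    (H₁ H₂ : X ⊗ Δ[1] ⟶ E) (h : ι₀ ≫ H₁ = ι₀ ≫ H₂) (G : X ⊗ Δ[2] ⟶ B)
    (h₁ : H₁ ≫ q = X ◁ stdSimplex.δ 2 ≫ G) (h₂ : H₂ ≫ q = X ◁ stdSimplex.δ 1 ≫ G) :
    ∃ L : X ⊗ Δ[2] ⟶ E, X ◁ stdSimplex.δ 2 ≫ L = H₁ ∧ X ◁ stdSimplex.δ 1 ≫ L = H₂ ∧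
      L ≫ q = G := by
  have w : stdSimplex.δ (1 : Fin 2) ≫ MonoidalClosed.curry H₁ =
      stdSimplex.δ (1 : Fin 2) ≫ MonoidalClosed.curry H₂ := by
    rw [← MonoidalClosed.curry_natural_left, ← MonoidalClosed.curry_natural_left,
      whiskerLeft_δ_one, Category.assoc, Category.assoc, h]
  have i₁ : horn₂₀.ι₀₁.{u} ≫ Λ[2, 0].ι = stdSimplex.δ 2 := horn.ι_ι _ _ _
  have i₂ : horn₂₀.ι₀₂.{u} ≫ Λ[2, 0].ι = stdSimplex.δ 1 := horn.ι_ι _ _ _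
  let φ := horn₂₀.isPushout.{u}.desc _ _ w
  have φ₁ : horn₂₀.ι₀₁.{u} ≫ φ = MonoidalClosed.curry H₁ := IsPushout.inl_desc _ _ _ _
  have φ₂ : horn₂₀.ι₀₂.{u} ≫ φ = MonoidalClosed.curry H₂ := IsPushout.inr_desc _ _ _ _
  have e₁ : X ◁ horn₂₀.ι₀₁.{u} ≫ MonoidalClosed.uncurry φ = H₁ := by
    rw [← MonoidalClosed.uncurry_natural_left, φ₁, MonoidalClosed.uncurry_curry]
  have e₂ : X ◁ horn₂₀.ι₀₂.{u} ≫ MonoidalClosed.uncurry φ = H₂ := by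
    rw [← MonoidalClosed.uncurry_natural_left, φ₂, MonoidalClosed.uncurry_curry]
  have comm : MonoidalClosed.uncurry φ ≫ q = X ◁ Λ[2, 0].ι ≫ G := by
    apply MonoidalClosed.curry_injective
    apply horn₂₀.isPushout.{u}.hom_ext
    · rw [← MonoidalClosed.curry_natural_left, ← MonoidalClosed.curry_natural_left,
        reassoc_of% e₁, ← MonoidalCategory.whiskerLeft_comp_assoc, i₁, h₁]
    · rw [← MonoidalClosed.curry_natural_left, ← MonoidalClosed.curry_natural_left,
        reassoc_of% e₂, ← MonoidalCategory.whiskerLeft_comp_assoc, i₂, h₂]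
  obtain ⟨L, hL, hL'⟩ := ((anodyneExtensions.horn_ι (0 : Fin 3)).whiskerLeft X).exists_lift hq _ _
    comm
  refine ⟨L, ?_, ?_, hL'⟩
  · rw [← i₁, MonoidalCategory.whiskerLeft_comp, Category.assoc, hL, e₁]
  · rw [← i₂, MonoidalCategory.whiskerLeft_comp, Category.assoc, hL, e₂]

lemma ι₀_whiskerLeft_δ_zero (X : SSet.{u}) :
    (ι₀ : X ⟶ _) ≫ X ◁ stdSimplex.δ (0 : Fin 3) = ι₁ ≫ X ◁ stdSimplex.δ (2 : Fin 3) := by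
  have : (const (stdSimplex.obj₀Equiv.{u}.symm 0) : X ⟶ Δ[1]) ≫ stdSimplex.δ (0 : Fin 3) =
      const (stdSimplex.obj₀Equiv.{u}.symm 1) ≫ stdSimplex.δ (2 : Fin 3) := by
    rw [const_comp, const_comp]
    refine congrArg const (stdSimplex.ext _ _ fun i => ?_)
    obtain rfl := Subsingleton.elim (α := Fin 1) i 0
    rfl
  refine CartesianMonoidalCategory.hom_ext _ _ (by simp) ?_
  rw [Category.assoc, Category.assoc, whiskerLeft_snd, whiskerLeft_snd]
  exact this

lemma ι₁_whiskerLeft_δ_zero (X : SSet.{u}) :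
    (ι₁ : X ⟶ _) ≫ X ◁ stdSimplex.δ (0 : Fin 3) = ι₁ ≫ X ◁ stdSimplex.δ (1 : Fin 3) := by
  have : (const (stdSimplex.obj₀Equiv.{u}.symm 1) : X ⟶ Δ[1]) ≫ stdSimplex.δ (0 : Fin 3) =
      const (stdSimplex.obj₀Equiv.{u}.symm 1) ≫ stdSimplex.δ (1 : Fin 3) := by
    rw [const_comp, const_comp]
    refine congrArg const (stdSimplex.ext _ _ fun i => ?_)
    obtain rfl := Subsingleton.elim (α := Fin 1) i 0
    rfl
  refine CartesianMonoidalCategory.hom_ext _ _ (by simp) ?_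
  rw [Category.assoc, Category.assoc, whiskerLeft_snd, whiskerLeft_snd]
  exact this

lemma Homotopic.euclidean {X K : SSet.{u}} [KanComplex K] {f g h : X ⟶ K}
    (H₁ : Homotopic f g) (H₂ : Homotopic f h) : Homotopic g h := by
  obtain ⟨H₁, rfl, rfl⟩ := H₁
  obtain ⟨H₂, e, rfl⟩ := H₂
  obtain ⟨L, h₁, h₂, -⟩ := ((kanComplex_iff K).1 inferInstance).exists_lift_horn₂₀ H₁ H₂ e.symm
    (terminal.from _) (Subsingleton.elim _ _) (Subsingleton.elim _ _)
  refine ⟨X ◁ stdSimplex.δ 0 ≫ L, ?_, ?_⟩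
  · rw [reassoc_of% ι₀_whiskerLeft_δ_zero, h₁]
  · rw [reassoc_of% ι₁_whiskerLeft_δ_zero, h₂]

lemma homotopic_equivalence (X K : SSet.{u}) [KanComplex K] :
    Equivalence (Homotopic : (X ⟶ K) → (X ⟶ K) → Prop) where
  refl := Homotopic.refl
  symm H := H.euclidean (.refl _)
  trans H H' := (H.euclidean (.refl _)).euclidean H'

/-- The class of a map in `[X, K]`. -/
abbrev HomotopyClasses.mk {X K : SSet.{u}} (f : X ⟶ K) : HomotopyClasses X K := Quot.mk _ f

lemma HomotopyClasses.mk_eq_mk_iff {X K : SSet.{u}} [KanComplex K] (f g : X ⟶ K) :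
    HomotopyClasses.mk f = HomotopyClasses.mk g ↔ Homotopic f g := by
  have : (fun f g : X ⟶ K => Nonempty (Homotopy f g)) = Homotopic := by
    ext f g
    exact nonempty_homotopy_iff f g
  constructor
  · intro h
    have h' := Quot.eqvGen_exact h
    rwa [this, (homotopic_equivalence X K).eqvGen_iff] at h'
  · intro h
    exact Quot.sound ((nonempty_homotopy_iff f g).2 h)

/-- Weak homotopy equivalences in terms of homotopies, which form an equivalence relation on maps to
a Kan complex. -/
lemma weakHomotopyEquivalences_iff {X Y : SSet.{u}} (f : X ⟶ Y) :
    weakHomotopyEquivalences f ↔ ∀ (K : SSet.{u}) [KanComplex K],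
      (∀ g h : Y ⟶ K, Homotopic (f ≫ g) (f ≫ h) → Homotopic g h) ∧
      ∀ g : X ⟶ K, ∃ h : Y ⟶ K, Homotopic (f ≫ h) g := by
  refine forall₂_congr fun K _ => and_congr ?_ ?_
  · constructor
    · intro H g h hgh
      rw [← HomotopyClasses.mk_eq_mk_iff] at hgh ⊢
      exact H hgh
    · rintro H ⟨g⟩ ⟨h⟩ hgh
      exact (HomotopyClasses.mk_eq_mk_iff _ _).2 (H _ _ ((HomotopyClasses.mk_eq_mk_iff _ _).1 hgh))
  · constructor
    · intro H g
      obtain ⟨⟨h⟩, hh⟩ := H (HomotopyClasses.mk g)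
      exact ⟨h, (HomotopyClasses.mk_eq_mk_iff _ _).1 hh⟩
    · rintro H ⟨g⟩
      obtain ⟨h, hh⟩ := H g
      exact ⟨HomotopyClasses.mk h, (HomotopyClasses.mk_eq_mk_iff _ _).2 hh⟩

lemma HomotopyClasses.precomp_comp {X Y Z : SSet.{u}} (f : X ⟶ Y) (g : Y ⟶ Z) (K : SSet.{u}) :
    HomotopyClasses.precomp (f ≫ g) K =
      HomotopyClasses.precomp f K ∘ HomotopyClasses.precomp g K := by
  ext ⟨h⟩
  exact congrArg HomotopyClasses.mk (Category.assoc f g h)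

instance : weakHomotopyEquivalences.{u}.HasTwoOutOfThreeProperty where
  comp_mem f g hf hg K _ := by
    rw [HomotopyClasses.precomp_comp]
    exact (hf K).comp (hg K)
  of_postcomp f g hg hfg K _ := by
    have := hfg K
    rw [HomotopyClasses.precomp_comp] at this
    exact (Function.Bijective.of_comp_iff _ (hg K)).1 this
  of_precomp f g hf hfg K _ := by
    have := hfg K
    rw [HomotopyClasses.precomp_comp] at this
    exact (Function.Bijective.of_comp_iff' (hf K) _).1 this

lemma anodyneExtensions_le_weakHomotopyEquivalences :
    anodyneExtensions.{u} ≤ weakHomotopyEquivalences := by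
  intro X Y f hf
  rw [weakHomotopyEquivalences_iff]
  intro K _
  refine ⟨fun g h ⟨H, h₀, h₁⟩ => ?_, fun g => ?_⟩
  · obtain ⟨L, h₀, h₁, -⟩ := ((kanComplex_iff K).1 inferInstance).exists_homotopy_extension hf g h H
      (terminal.from _) h₀ h₁ (Subsingleton.elim _ _) (Subsingleton.elim _ _)
      (Subsingleton.elim _ _)
    exact ⟨L, h₀, h₁⟩
  · obtain ⟨l, rfl⟩ := hf.exists_extension K g
    exact ⟨l, .refl _⟩

/-- A section of a trivial fibration, and a fibrewise homotopy between the resulting idempotent and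
the identity. -/
lemma trivialKanFibrations.exists_section {X Y : SSet.{u}} {p : X ⟶ Y}
    (hp : trivialKanFibrations p) :
    ∃ (s : Y ⟶ X) (H : X ⊗ Δ[1] ⟶ X), s ≫ p = 𝟙 Y ∧ ι₀ ≫ H = 𝟙 X ∧ ι₁ ≫ H = p ≫ s ∧
      H ≫ p = fst _ _ ≫ p ∧ s ▷ Δ[1] ≫ H = fst _ _ ≫ s := by
  obtain ⟨s, -, hs⟩ := hp.exists_lift (j := initial.to Y) (initial.to X) (𝟙 Y)
    (Subsingleton.elim _ _)
  have : Mono s := mono_of_mono_fac hs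
  obtain ⟨H, h₀, h₁, h₂, h₃⟩ := hp.exists_homotopy_extension s (𝟙 X) (p ≫ s)
    (fst _ _ ≫ s) (fst _ _ ≫ p) (by simp) (by simp [reassoc_of% hs]) (by simp) (by simp)
    (by simp [hs])
  exact ⟨s, H, hs, h₀, h₁, h₃, h₂⟩

lemma trivialKanFibrations_le_weakHomotopyEquivalences :
    trivialKanFibrations.{u} ≤ weakHomotopyEquivalences := by
  intro X Y p hp
  obtain ⟨s, H, hs, h₀, h₁, -, -⟩ := hp.exists_section
  have : Homotopic (𝟙 X) (p ≫ s) := ⟨H, h₀, h₁⟩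
  have h2 : weakHomotopyEquivalences (p ≫ s) := by
    rw [weakHomotopyEquivalences_iff]
    intro K _
    have key (a : X ⟶ K) : Homotopic a ((p ≫ s) ≫ a) := by
      have := this.postcomp a
      rwa [Category.id_comp] at this
    exact ⟨fun a b H => (homotopic_equivalence _ K).trans (key a)
      ((homotopic_equivalence _ K).trans H ((homotopic_equivalence _ K).symm (key b))),
      fun a => ⟨a, (homotopic_equivalence _ K).symm (key a)⟩⟩
  intro K _
  have h3 : HomotopyClasses.precomp s K ∘ HomotopyClasses.precomp p K = id := by
    rw [← HomotopyClasses.precomp_comp, hs]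
    ext ⟨a⟩
    exact congrArg HomotopyClasses.mk (Category.id_comp a)
  have h4 := h2 K
  rw [HomotopyClasses.precomp_comp] at h4
  exact ⟨Function.LeftInverse.injective (congrFun h3), h4.2.of_comp⟩

/-! ### Weak homotopy equivalences that are Kan fibrations of Kan complexes -/

/-- A Kan fibration which is a fibrewise deformation retraction is a trivial fibration. -/
lemma kanFibrations.trivialKanFibrations_of_deformation {X Y : SSet.{u}} {q : X ⟶ Y}
    (hq : kanFibrations q) (s : Y ⟶ X) (hs : s ≫ q = 𝟙 Y) (H : X ⊗ Δ[1] ⟶ X)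
    (h₀ : ι₀ ≫ H = q ≫ s) (h₁ : ι₁ ≫ H = 𝟙 X) (h : H ≫ q = fst _ _ ≫ q) :
    trivialKanFibrations q := by
  intro A B i (_ : Mono i)
  refine ⟨fun {a b} sq => ?_⟩
  have w := sq.w
  obtain ⟨L, l₀, l₁, l₂⟩ := hq.exists_homotopy_lift i (b ≫ s) (a ▷ Δ[1] ≫ H) (fst _ _ ≫ b)
    (by rw [ι₀_comp_assoc, h₀, reassoc_of% w]) (by simp [h, w]) (by simp [hs])
  exact ⟨⟨{ l := ι₁ ≫ L
            fac_left := by rw [← ι₁_comp_assoc, l₁, ι₁_comp_assoc, h₁, Category.comp_id]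
            fac_right := by simp [l₂] }⟩⟩

lemma ι₁_whiskerLeft_δ (X : SSet.{u}) :
    X ◁ (stdSimplex.δ (0 : Fin 3) ≫ stdSimplex.σ (1 : Fin 2)) = fst X Δ[1] ≫ ι₁ := by
  have : stdSimplex.δ (0 : Fin 3) ≫ stdSimplex.σ (1 : Fin 2) = stdSimplex.σ 0 ≫ stdSimplex.δ 0 :=
    stdSimplex.δ_comp_σ_of_le (i := (0 : Fin 2)) (j := (0 : Fin 1)) (by simp)
  rw [this, MonoidalCategory.whiskerLeft_comp, whiskerLeft_δ_zero]
  rfl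

/-- A weak homotopy equivalence which is a Kan fibration over a Kan complex is a trivial
fibration. -/
lemma kanFibrations.trivialKanFibrations_of_kanComplex {X Y : SSet.{u}} {q : X ⟶ Y}
    (hq : kanFibrations q) (hw : weakHomotopyEquivalences q) [KanComplex Y] :
    trivialKanFibrations q := by
  have : KanComplex X := by
    rw [kanComplex_iff]
    have := modelCategoryQuillen.J.rlp.comp_mem q (terminal.from Y) hq
      ((kanComplex_iff Y).1 inferInstance)
    rwa [terminal.comp_from] at this
  rw [weakHomotopyEquivalences_iff] at hw
  obtain ⟨s, hs⟩ := (hw X).2 (𝟙 X)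
  obtain ⟨G, g₀, g₁⟩ : Homotopic (s ≫ q) (𝟙 Y) := by
    apply (hw Y).1
    have := hs.postcomp q
    rw [Category.assoc, Category.id_comp] at this
    rwa [Category.comp_id]
  obtain ⟨S, S₀, S₁⟩ := (anodyneExtensions_ι₀ Y).exists_lift hq s G g₀.symm
  obtain ⟨s', hs'⟩ : ∃ s', s' = ι₁ ≫ S := ⟨_, rfl⟩
  have e : s' ≫ q = 𝟙 Y := by rw [hs', Category.assoc, S₁, g₁]
  have hss' : Homotopic s s' := ⟨S, S₀, hs'.symm⟩
  obtain ⟨H, h₀, h₁⟩ : Homotopic (q ≫ s') (𝟙 X) := (hss'.precomp q).euclidean hs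
  have w₂ : stdSimplex.δ (2 : Fin 3) ≫ stdSimplex.σ (1 : Fin 2) = 𝟙 (Δ[1] : SSet.{u}) :=
    stdSimplex.δ_comp_σ_succ (i := (1 : Fin 2))
  have w₁ : stdSimplex.δ (1 : Fin 3) ≫ stdSimplex.σ (1 : Fin 2) = 𝟙 (Δ[1] : SSet.{u}) :=
    stdSimplex.δ_comp_σ_self (i := (1 : Fin 2))
  -- The loop `H ≫ q` is cancelled by its image under the section.
  obtain ⟨L, l₂, l₁, l⟩ := hq.exists_lift_horn₂₀ (H ≫ q ≫ s') H
    (by rw [reassoc_of% h₀, reassoc_of% e, h₀]) (X ◁ stdSimplex.σ (1 : Fin 2) ≫ H ≫ q)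
    (by rw [← MonoidalCategory.whiskerLeft_comp_assoc, w₂]; simp [e])
    (by rw [← MonoidalCategory.whiskerLeft_comp_assoc, w₁]; simp)
  refine hq.trivialKanFibrations_of_deformation s' e (X ◁ stdSimplex.δ 0 ≫ L) ?_ ?_ ?_
  · rw [reassoc_of% ι₀_whiskerLeft_δ_zero, l₂, reassoc_of% h₁]
  · rw [reassoc_of% ι₁_whiskerLeft_δ_zero, l₁, h₁]
  · rw [Category.assoc, l, ← MonoidalCategory.whiskerLeft_comp_assoc, ι₁_whiskerLeft_δ,
      Category.assoc, reassoc_of% h₁]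

/-! ### Fibre products and dependent products -/

lemma map_map_apply (X : SSet.{u}) {n m k : SimplexCategoryᵒᵖ} (f : n ⟶ m) (g : m ⟶ k)
    (x : X.obj n) : X.map g (X.map f x) = X.map (f ≫ g) x := by
  rw [Functor.map_comp]; rfl

lemma map_id_apply (X : SSet.{u}) {n : SimplexCategoryᵒᵖ} (x : X.obj n) : X.map (𝟙 n) x = x := by
  rw [CategoryTheory.Functor.map_id]; rfl

lemma app_map {X Y : SSet.{u}} (f : X ⟶ Y) {n m : SimplexCategoryᵒᵖ} (g : n ⟶ m) (x : X.obj n) :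
    f.app m (X.map g x) = Y.map g (f.app n x) :=
  NatTrans.naturality_apply f g x

lemma congr_app {X Y : SSet.{u}} {f g : X ⟶ Y} (h : f = g) {n : SimplexCategoryᵒᵖ} (x : X.obj n) :
    f.app n x = g.app n x := by
  rw [h]

/-- The fibre product of two simplicial sets over a third one, as a subcomplex of the product. -/
def fiberProduct {L A B : SSet.{u}} (l : L ⟶ B) (q : A ⟶ B) : (L ⊗ A).Subcomplex where
  obj n := {x | l.app n x.1 = q.app n x.2}
  map {n m} f x hx := by
    change l.app m (L.map f x.1) = q.app m (A.map f x.2)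
    rw [app_map, app_map, show l.app n x.1 = q.app n x.2 from hx]

namespace fiberProduct

variable {L A B : SSet.{u}} (l : L ⟶ B) (q : A ⟶ B)

/-- The first projection of a fibre product. -/
noncomputable def fst : (fiberProduct l q : SSet) ⟶ L :=
  (fiberProduct l q).ι ≫ CartesianMonoidalCategory.fst _ _

/-- The second projection of a fibre product. -/
noncomputable def snd : (fiberProduct l q : SSet) ⟶ A :=
  (fiberProduct l q).ι ≫ CartesianMonoidalCategory.snd _ _

lemma condition : fst l q ≫ l = snd l q ≫ q := by
  ext n ⟨x, hx⟩
  exact hx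

/-- The map to a fibre product given by two maps. -/
noncomputable def lift {l : L ⟶ B} {q : A ⟶ B} {T : SSet.{u}} (a : T ⟶ L) (b : T ⟶ A)
    (h : a ≫ l = b ≫ q) :
    T ⟶ (fiberProduct l q : SSet) :=
  Subcomplex.lift (CartesianMonoidalCategory.lift a b) (by
    rintro n _ ⟨x, rfl⟩
    exact congr_app h x)

@[simp]
lemma lift_fst {l : L ⟶ B} {q : A ⟶ B} {T : SSet.{u}} (a : T ⟶ L) (b : T ⟶ A)
    (h : a ≫ l = b ≫ q) : lift a b h ≫ fst l q = a := rfl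

@[simp]
lemma lift_snd {l : L ⟶ B} {q : A ⟶ B} {T : SSet.{u}} (a : T ⟶ L) (b : T ⟶ A)
    (h : a ≫ l = b ≫ q) : lift a b h ≫ snd l q = b := rfl

@[simp]
lemma lift_fst_assoc {l : L ⟶ B} {q : A ⟶ B} {T Z : SSet.{u}} (a : T ⟶ L) (b : T ⟶ A)
    (h : a ≫ l = b ≫ q) (k : L ⟶ Z) : lift a b h ≫ fst l q ≫ k = a ≫ k := rfl

@[simp]
lemma lift_snd_assoc {l : L ⟶ B} {q : A ⟶ B} {T Z : SSet.{u}} (a : T ⟶ L) (b : T ⟶ A)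
    (h : a ≫ l = b ≫ q) (k : A ⟶ Z) : lift a b h ≫ snd l q ≫ k = b ≫ k := rfl

variable {l q} in
lemma hom_ext {T : SSet.{u}} {a b : T ⟶ (fiberProduct l q : SSet)}
    (h₁ : a ≫ fst l q = b ≫ fst l q) (h₂ : a ≫ snd l q = b ≫ snd l q) : a = b := by
  rw [← cancel_mono (fiberProduct l q).ι]
  exact CartesianMonoidalCategory.hom_ext _ _ h₁ h₂

lemma isPullback : IsPullback (fst l q) (snd l q) l q where
  w := condition l q
  isLimit' := ⟨PullbackCone.IsLimit.mk _ (fun s => lift s.fst s.snd s.condition)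
    (fun _ => rfl) (fun _ => rfl) (fun _ _ h₁ h₂ => hom_ext h₁ h₂)⟩

/-- The map between fibre products induced by a map to the first factor. -/
noncomputable def map {K : SSet.{u}} (j : K ⟶ L) :
    (fiberProduct (j ≫ l) q : SSet) ⟶ (fiberProduct l q : SSet) :=
  lift (fst _ _ ≫ j) (snd _ _) (by rw [Category.assoc, condition])

lemma isPullback_map {K : SSet.{u}} (j : K ⟶ L) :
    IsPullback (map l q j) (fst (j ≫ l) q) (fst l q) j :=
  IsPullback.of_right (by simpa [map] using (isPullback (j ≫ l) q).flip) rfl (isPullback l q).flip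

end fiberProduct

/-- A simplex of the dependent product of `p : Z ⟶ A` along `q : A ⟶ B`: a simplex of `B` and
a section of `p` over its preimage in `A`. -/
structure DependentProduct {Z A B : SSet.{u}} (p : Z ⟶ A) (q : A ⟶ B) (n : SimplexCategoryᵒᵖ) :
    Type u where
  /-- The underlying simplex of `B`. -/
  base : B.obj n
  /-- The section over the preimage of the simplex. -/
  sec {m : SimplexCategoryᵒᵖ} (θ : n ⟶ m) (a : A.obj m) (h : q.app m a = B.map θ base) : Z.obj m
  app_sec {m : SimplexCategoryᵒᵖ} (θ : n ⟶ m) (a : A.obj m) (h : q.app m a = B.map θ base) :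
    p.app m (sec θ a h) = a
  map_sec {m m' : SimplexCategoryᵒᵖ} (θ : n ⟶ m) (φ : m ⟶ m') (a : A.obj m)
    (h : q.app m a = B.map θ base) :
    Z.map φ (sec θ a h) = sec (θ ≫ φ) (A.map φ a) (by rw [app_map, h, map_map_apply])

namespace DependentProduct

variable {Z A B : SSet.{u}} {p : Z ⟶ A} {q : A ⟶ B}

lemma sec_congr {n : SimplexCategoryᵒᵖ} (x y : DependentProduct p q n) (hxy : x = y)
    {m : SimplexCategoryᵒᵖ} (θ θ' : n ⟶ m) (hθ : θ = θ') (a a' : A.obj m) (ha : a = a')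
    (h : q.app m a = B.map θ x.base) (h' : q.app m a' = B.map θ' y.base) :
    x.sec θ a h = y.sec θ' a' h' := by
  subst hxy hθ ha
  rfl

lemma ext' {n : SimplexCategoryᵒᵖ} {x y : DependentProduct p q n} (h : x.base = y.base)
    (h' : ∀ {m : SimplexCategoryᵒᵖ} (θ : n ⟶ m) (a : A.obj m) (h₁ : q.app m a = B.map θ x.base)
      (h₂ : q.app m a = B.map θ y.base), x.sec θ a h₁ = y.sec θ a h₂) : x = y := by
  obtain ⟨b, s, _, _⟩ := x
  obtain ⟨b', s', _, _⟩ := y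
  obtain rfl : b = b' := h
  have : @s = @s' := by
    funext m θ a h
    exact h' θ a h h
  subst this
  rfl

/-- The action of a simplicial operator on the simplices of a dependent product. -/
def map {n m : SimplexCategoryᵒᵖ} (f : n ⟶ m) (x : DependentProduct p q n) :
    DependentProduct p q m where
  base := B.map f x.base
  sec θ a h := x.sec (f ≫ θ) a (by rw [h, map_map_apply])
  app_sec θ a h := x.app_sec _ _ _
  map_sec θ φ a h := by
    rw [x.map_sec]
    exact sec_congr _ _ rfl _ _ (Category.assoc _ _ _) _ _ rfl _ _

end DependentProduct

variable {Z A B : SSet.{u}} (p : Z ⟶ A) (q : A ⟶ B)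

/-- The dependent product of `p : Z ⟶ A` along `q : A ⟶ B`. -/
def dependentProduct : SSet.{u} where
  obj n := DependentProduct p q n
  map f := TypeCat.ofHom (DependentProduct.map f)
  map_id n := by
    ext x
    refine DependentProduct.ext' (map_id_apply _ _) fun θ a h₁ h₂ => ?_
    exact DependentProduct.sec_congr _ _ rfl _ _ (Category.id_comp _) _ _ rfl _ _
  map_comp f g := by
    ext x
    refine DependentProduct.ext' (map_map_apply _ _ _ _).symm fun θ a h₁ h₂ => ?_
    exact DependentProduct.sec_congr _ _ rfl _ _ (Category.assoc _ _ _) _ _ rfl _ _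

namespace dependentProduct

/-- The projection of a dependent product to its base. -/
def π : dependentProduct p q ⟶ B where
  app _ := TypeCat.ofHom fun x => DependentProduct.base x
  naturality _ _ _ := rfl

variable {p q}

/-- The map to a dependent product given by a map from a fibre product. -/
def curry {L : SSet.{u}} {l : L ⟶ B} (φ : (fiberProduct l q : SSet) ⟶ Z)
    (hφ : φ ≫ p = fiberProduct.snd l q) : L ⟶ dependentProduct p q where
  app n := TypeCat.ofHom fun x =>
    { base := l.app n x
      sec {m} θ a h := φ.app m ⟨(L.map θ x, a), (app_map _ _ _).trans h.symm⟩
      app_sec {m} θ a h := congr_app hφ _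
      map_sec {m m'} θ ψ a h := (app_map φ ψ _).symm.trans
        (congrArg _ (Subtype.ext (Prod.ext (map_map_apply _ _ _ _) rfl))) }
  naturality n m f := by
    ext x
    refine DependentProduct.ext' (app_map _ _ _) fun θ a h₁ h₂ => ?_
    refine congrArg (φ.app _) (Subtype.ext (Prod.ext ?_ rfl))
    exact map_map_apply _ _ _ _

lemma curry_π {L : SSet.{u}} {l : L ⟶ B} (φ : (fiberProduct l q : SSet) ⟶ Z)
    (hφ : φ ≫ p = fiberProduct.snd l q) : curry φ hφ ≫ π p q = l := rfl

/-- The map from a fibre product given by a map to a dependent product. -/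
def uncurry {L : SSet.{u}} (l : L ⟶ B) (ψ : L ⟶ dependentProduct p q) (hψ : ψ ≫ π p q = l) :
    (fiberProduct l q : SSet) ⟶ Z where
  app n := TypeCat.ofHom fun x => DependentProduct.sec (ψ.app n x.1.1) (𝟙 n) x.1.2 (by
    rw [map_id_apply, ← show l.app n x.1.1 = q.app n x.1.2 from x.2]
    exact congr_app hψ.symm _)
  naturality n m f := by
    ext ⟨⟨x, a⟩, hx⟩
    have e : ψ.app m (L.map f x) = DependentProduct.map f (ψ.app n x) := app_map ψ f x
    refine Eq.trans ?_ (DependentProduct.map_sec _ _ _ _ _).symm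
    refine (DependentProduct.sec_congr _ _ e _ _ rfl _ _ rfl _ (by
      have := congr_app hψ x
      rw [map_id_apply]
      change q.app m (A.map f a) = B.map f (DependentProduct.base (ψ.app n x))
      rw [app_map, ← show l.app n x = q.app n a from hx, ← this]
      rfl)).trans ?_
    exact DependentProduct.sec_congr _ _ rfl _ _
      ((Category.comp_id _).trans (Category.id_comp _).symm) _ _ rfl _ _

lemma uncurry_comp {L : SSet.{u}} (l : L ⟶ B) (ψ : L ⟶ dependentProduct p q)
    (hψ : ψ ≫ π p q = l) : uncurry l ψ hψ ≫ p = fiberProduct.snd l q := by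
  ext n ⟨⟨x, a⟩, hx⟩
  exact DependentProduct.app_sec _ _ _ _

lemma curry_uncurry {L : SSet.{u}} (l : L ⟶ B) (ψ : L ⟶ dependentProduct p q)
    (hψ : ψ ≫ π p q = l) : curry (uncurry l ψ hψ) (uncurry_comp l ψ hψ) = ψ := by
  ext n x
  refine DependentProduct.ext' (congr_app hψ.symm x) fun {m} θ a h₁ h₂ => ?_
  have e : ψ.app m (L.map θ x) = DependentProduct.map θ (ψ.app n x) := app_map ψ θ x
  refine (DependentProduct.sec_congr _ _ e _ _ rfl _ _ rfl _ (by
    rw [map_id_apply]; exact h₂)).trans ?_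
  exact DependentProduct.sec_congr _ _ rfl _ _ (Category.comp_id _) _ _ rfl _ _

lemma uncurry_curry {L : SSet.{u}} {l : L ⟶ B} (φ : (fiberProduct l q : SSet) ⟶ Z)
    (hφ : φ ≫ p = fiberProduct.snd l q) : uncurry l (curry φ hφ) (curry_π φ hφ) = φ := by
  ext n ⟨⟨x, a⟩, hx⟩
  exact congrArg (φ.app n) (Subtype.ext (Prod.ext (map_id_apply _ _) rfl))

lemma curry_natural {K L : SSet.{u}} {l : L ⟶ B} (j : K ⟶ L) (φ : (fiberProduct l q : SSet) ⟶ Z)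
    (hφ : φ ≫ p = fiberProduct.snd l q) :
    j ≫ curry φ hφ = curry (fiberProduct.map l q j ≫ φ) (by rw [Category.assoc, hφ]; rfl) := by
  ext n x
  refine DependentProduct.ext' rfl fun {m} θ a h₁ h₂ => ?_
  refine congrArg (φ.app m) (Subtype.ext (Prod.ext ?_ rfl))
  exact (app_map _ _ _).symm

lemma uncurry_natural {K L : SSet.{u}} {l : L ⟶ B} (j : K ⟶ L) (ψ : L ⟶ dependentProduct p q)
    (hψ : ψ ≫ π p q = l) (k : K ⟶ dependentProduct p q) (hk : j ≫ ψ = k) :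
    fiberProduct.map l q j ≫ uncurry l ψ hψ = uncurry (j ≫ l) k (by rw [← hk, ← hψ]; rfl) := by
  subst hk
  rfl

/-- A lifting problem for a dependent product is one for `p`, against the base change of `j`. -/
lemma hasLiftingProperty {K L : SSet.{u}} (j : K ⟶ L)
    (h : ∀ l : L ⟶ B, HasLiftingProperty (fiberProduct.map l q j) p) :
    HasLiftingProperty j (π p q) where
  sq_hasLift {k l} sq := by
    have := h l
    have comm : CommSq (uncurry (j ≫ l) k sq.w) (fiberProduct.map l q j) p
      (fiberProduct.snd l q) := ⟨uncurry_comp _ _ _⟩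
    refine ⟨⟨{ l := curry comm.lift comm.fac_right, fac_left := ?_, fac_right := rfl }⟩⟩
    rw [curry_natural]
    simp only [CommSq.fac_left]
    exact curry_uncurry _ _ _

/-- The fibre of a dependent product along a monomorphism. -/
lemma exists_isPullback [Mono q] : ∃ t : Z ⟶ dependentProduct p q, IsPullback t p (π p q) q := by
  have key (n) (a a' : A.obj n) (h : q.app n a = q.app n a') : a = a' :=
    (NatTrans.mono_iff_mono_app q).1 inferInstance n |> (mono_iff_injective _).1 |> fun H => H h
  have hfst : fiberProduct.fst (p ≫ q) q ≫ p = fiberProduct.snd (p ≫ q) q := by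
    ext n ⟨⟨x, a⟩, hx⟩
    exact key _ _ _ hx
  let t : Z ⟶ dependentProduct p q := curry (fiberProduct.fst (p ≫ q) q) hfst
  let r {T : SSet.{u}} (x : T ⟶ dependentProduct p q) (y : T ⟶ A) (h : x ≫ π p q = y ≫ q) :
      T ⟶ Z := fiberProduct.lift (𝟙 _) y (by rw [Category.id_comp, h]) ≫ uncurry (x ≫ π p q) x rfl
  have r_p {T : SSet.{u}} (x : T ⟶ dependentProduct p q) (y : T ⟶ A) (h : x ≫ π p q = y ≫ q) :
      r x y h ≫ p = y := by
    rw [Category.assoc, uncurry_comp]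
    rfl
  have r_t {T : SSet.{u}} (x : T ⟶ dependentProduct p q) (y : T ⟶ A) (h : x ≫ π p q = y ≫ q) :
      r x y h ≫ t = x := by
    ext n w
    refine DependentProduct.ext' ?_ fun {m} θ a h₁ h₂ => ?_
    · refine Eq.trans (congrArg (q.app n) (congr_app (r_p x y h) w)) (congr_app h w).symm
    · refine (DependentProduct.map_sec (x.app n w) (𝟙 n) θ (y.app n w) _).trans
        (DependentProduct.sec_congr _ _ rfl _ _ (Category.id_comp _) _ _ (key _ _ _ ?_) _ _)
      rw [app_map, h₂]
      exact congrArg _ (congr_app h w).symm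
  refine ⟨t, ⟨⟨curry_π _ _⟩, ⟨PullbackCone.IsLimit.mk _ (fun s => r s.fst s.snd s.condition)
    (fun s => r_t _ _ s.condition) (fun s => r_p _ _ s.condition) (fun s m h₁ h₂ => ?_)⟩⟩⟩
  have e (x y y' h h') (hxx' : m ≫ t = x) (hy : y = y') : r (m ≫ t) y' h' = r x y h := by
    subst hxx' hy; rfl
  refine Eq.trans ?_ (e _ _ _ s.condition (by rw [Category.assoc]; exact congrArg _ (curry_π _ _))
    h₁ h₂.symm)
  ext n w
  exact (map_id_apply Z _).symm

end dependentProduct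

/-! ### Pulling back anodyne extensions along Kan fibrations -/

/-- The inclusion of `X` in `X ⊗ Δ[1]` at the vertex `e` of `Δ[1]`. -/
noncomputable def endι (e : Fin 2) (X : SSet.{u}) : X ⟶ X ⊗ Δ[1] :=
  lift (𝟙 X) (const (stdSimplex.obj₀Equiv.{u}.symm e))

lemma endι_naturality (e : Fin 2) {X Y : SSet.{u}} (f : X ⟶ Y) :
    endι e X ≫ f ▷ Δ[1] = f ≫ endι e Y := rfl

lemma endι_naturality_assoc (e : Fin 2) {X Y Z : SSet.{u}} (f : X ⟶ Y) (g : Y ⊗ Δ[1] ⟶ Z) :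
    endι e X ≫ f ▷ Δ[1] ≫ g = f ≫ endι e Y ≫ g := rfl

lemma anodyneExtensions_endι (e : Fin 2) (X : SSet.{u}) : anodyneExtensions (endι e X) := by
  match e with
  | 0 => exact anodyneExtensions_ι₀ X
  | 1 => exact anodyneExtensions_ι₁ X

/-- Homotopy lifting, relative to a monomorphism, from an end of the interval. -/
lemma kanFibrations.exists_homotopy_lift_end (e : Fin 2) {A B X Y : SSet.{u}} {p : X ⟶ Y}
    (hp : kanFibrations p)
    (i : A ⟶ B) [Mono i] (g : B ⟶ X) (H : A ⊗ Δ[1] ⟶ X) (G : B ⊗ Δ[1] ⟶ Y)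
    (h₁ : endι e _ ≫ H = i ≫ g) (h₂ : H ≫ p = i ▷ Δ[1] ≫ G) (h₃ : g ≫ p = endι e _ ≫ G) :
    ∃ L : B ⊗ Δ[1] ⟶ X, endι e _ ≫ L = g ∧ i ▷ Δ[1] ≫ L = H ∧ L ≫ p = G := by
  match e with
  | 0 => exact hp.exists_homotopy_lift i g H G h₁ h₂ h₃
  | 1 => exact hp.exists_homotopy_lift' i g H G h₁ h₂ h₃

/-- The map `Δ[n] ⊗ Δ[1] ⟶ Δ[n]` given by a monotone map on vertices. -/
def stdSimplexHomotopy {n : ℕ} (μ : Fin (n + 1) × Fin 2 →o Fin (n + 1)) :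
    (Δ[n] ⊗ Δ[1] : SSet.{u}) ⟶ Δ[n] where
  app _ := TypeCat.ofHom fun x => stdSimplex.objMk (n := ⦋n⦌)
    (μ.comp ((stdSimplex.asOrderHom x.1).prod (stdSimplex.asOrderHom x.2)))
  naturality _ _ _ := rfl

/-- A horn is invariant under a homotopy of the simplex which contracts the simplex into
the horn. -/
lemma horn_exists_contraction (n : ℕ) (k : Fin (n + 2)) :
    ∃ (e : Fin 2) (h : Δ[n + 1] ⊗ Δ[1] ⟶ Δ[n + 1]) (h' : Λ[n + 1, k].toSSet ⊗ Δ[1] ⟶ Λ[n + 1, k])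
      (r : Δ[n + 1] ⟶ Λ[n + 1, k]), endι e.rev _ ≫ h = 𝟙 (Δ[n + 1] : SSet.{u}) ∧
      endι e _ ≫ h = r ≫ Λ[n + 1, k].ι ∧ Λ[n + 1, k].ι ▷ Δ[1] ≫ h = h' ≫ Λ[n + 1, k].ι := by
  -- It suffices to give the homotopy on vertices.
  suffices H : ∃ (e : Fin 2) (μ : Fin (n + 2) × Fin 2 →o Fin (n + 2)) (l : Fin (n + 2)),
      l ≠ k ∧ ∀ x, μ (x, e.rev) = x ∧ μ (x, e) ≠ l ∧ (μ (x, e) = x ∨ μ (x, e) = k) by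
    obtain ⟨e, μ, l, hl, hμ⟩ := H
    have h₁ : endι e.rev _ ≫ stdSimplexHomotopy μ = 𝟙 (Δ[n + 1] : SSet.{u}) := by
      ext m x
      apply stdSimplex.objEquiv.injective
      apply SimplexCategory.Hom.ext
      ext i : 2
      exact (hμ _).1
    have h₂ : ∃ (r : (Δ[n + 1] : SSet.{u}) ⟶ Λ[n + 1, k]),
        r ≫ Λ[n + 1, k].ι = endι e _ ≫ stdSimplexHomotopy μ := by
      refine ⟨Subcomplex.lift (endι e _ ≫ stdSimplexHomotopy μ) ?_, rfl⟩
      rintro m _ ⟨x, rfl⟩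
      rw [mem_horn_iff]
      intro h
      have : l ∈ Set.univ := trivial
      rw [← h] at this
      obtain ⟨i, hi⟩ | hi := this
      · exact (hμ _).2.1 hi
      · exact hl hi
    have h₃ : ∃ (h' : Λ[n + 1, k].toSSet ⊗ Δ[1] ⟶ (Λ[n + 1, k] : SSet.{u})),
        h' ≫ Λ[n + 1, k].ι = Λ[n + 1, k].ι ▷ Δ[1] ≫ stdSimplexHomotopy μ := by
      refine ⟨Subcomplex.lift (Λ[n + 1, k].ι ▷ Δ[1] ≫ stdSimplexHomotopy μ) ?_, rfl⟩
      rintro m _ ⟨⟨⟨x, hx⟩, t⟩, rfl⟩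
      rw [mem_horn_iff] at hx ⊢
      refine fun h => hx (Set.eq_univ_of_univ_subset (h.symm.trans_le ?_))
      rintro _ (⟨i, rfl⟩ | hi)
      · have : stdSimplex.asOrderHom t i = e ∨ stdSimplex.asOrderHom t i = e.rev := by
          generalize stdSimplex.asOrderHom t i = a
          clear * -
          revert a e; decide
        change μ (stdSimplex.asOrderHom x i, stdSimplex.asOrderHom t i) ∈ _
        obtain h | h := this
        · rw [h]
          obtain h' | h' := (hμ (stdSimplex.asOrderHom x i)).2.2
          · rw [h']; exact Or.inl ⟨i, rfl⟩
          · rw [h']; exact Or.inr rfl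
        · rw [h, (hμ _).1]
          exact Or.inl ⟨i, rfl⟩
      · exact Or.inr hi
    obtain ⟨r, hr⟩ := h₂
    obtain ⟨h', hh'⟩ := h₃
    exact ⟨e, stdSimplexHomotopy μ, h', r, h₁, hr.symm, hh'.symm⟩
  by_cases hk : k = 0
  · refine ⟨0, ⟨fun x => if x.2 = 0 then k else x.1, ?_⟩, Fin.last _, ?_, ?_⟩
    · rintro ⟨x, t⟩ ⟨y, s⟩ ⟨h₁, h₂⟩
      dsimp only at h₁ h₂ ⊢
      split_ifs with h₃ h₄ h₄
      · exact le_rfl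
      · exact hk ▸ Fin.zero_le _
      · exact (h₃ (Fin.le_zero_iff.1 (h₄ ▸ h₂))).elim
      · exact h₁
    · exact hk ▸ Fin.last_pos.ne'
    · intro x
      refine ⟨rfl, ?_, Or.inr rfl⟩
      exact hk ▸ Fin.last_pos.ne
  · refine ⟨1, ⟨fun x => if x.2 = 1 then max x.1 k else x.1, ?_⟩, 0, Ne.symm hk, ?_⟩
    · rintro ⟨x, t⟩ ⟨y, s⟩ ⟨h₁, h₂⟩
      dsimp only at h₁ h₂ ⊢
      split_ifs with h₃ h₄ h₄
      · exact max_le_max h₁ le_rfl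
      · subst h₃
        exact (h₄ (Fin.last_le_iff.1 h₂)).elim
      · exact h₁.trans (le_max_left _ _)
      · exact h₁
    · intro x
      refine ⟨rfl, ?_, max_choice _ _⟩
      exact ((Fin.pos_of_ne_zero hk).trans_le (le_max_right x k)).ne'

/-- The pullback along a Kan fibration of a subobject which is invariant under a homotopy
contracting the whole space into it is anodyne. -/
lemma kanFibrations.anodyneExtensions_of_contraction {K L K' E : SSet.{u}} {j : K ⟶ L} [Mono j]
    {q : E ⟶ L} (hq : kanFibrations q) {j' : K' ⟶ E} {q' : K' ⟶ K} (sq : IsPullback j' q' q j)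
    (e : Fin 2) (h : L ⊗ Δ[1] ⟶ L) (h' : K ⊗ Δ[1] ⟶ K) (r : L ⟶ K)
    (h₁ : endι e.rev _ ≫ h = 𝟙 L) (h₂ : endι e _ ≫ h = r ≫ j) (h₃ : j ▷ Δ[1] ≫ h = h' ≫ j) :
    anodyneExtensions j' := by
  intro Z W p hp
  have : Mono j' := ⟨fun a b hab => sq.hom_ext hab (by
    rw [← cancel_mono j, Category.assoc, Category.assoc, ← sq.w, reassoc_of% hab])⟩
  -- Lift the homotopy to `E`; the lift preserves `K'` and contracts `E` into `K'`.
  obtain ⟨G, hG, hG'⟩ := (anodyneExtensions_endι e.rev E).exists_lift hq (𝟙 E) (q ▷ Δ[1] ≫ h)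
    (by rw [endι_naturality_assoc, h₁, Category.id_comp, Category.comp_id])
  have w : (j' ▷ Δ[1] ≫ G) ≫ q = (q' ▷ Δ[1] ≫ h') ≫ j := by
    rw [Category.assoc, hG', Category.assoc, ← h₃, ← comp_whiskerRight_assoc, sq.w,
      comp_whiskerRight_assoc]
  have w' : (endι e E ≫ G) ≫ q = (q ≫ r) ≫ j := by
    rw [Category.assoc, hG', endι_naturality_assoc, h₂, Category.assoc]
  let G' : K' ⊗ Δ[1] ⟶ K' := sq.lift _ _ w
  have hG₁ : G' ≫ j' = j' ▷ Δ[1] ≫ G := sq.lift_fst _ _ _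
  let ρ : E ⟶ K' := sq.lift _ _ w'
  have hρ : ρ ≫ j' = endι e E ≫ G := sq.lift_fst _ _ _
  have e₁ : endι e.rev K' ≫ G' = 𝟙 K' := by
    rw [← cancel_mono j', Category.assoc, hG₁, endι_naturality_assoc, hG, Category.id_comp,
      Category.comp_id]
  have e₂ : endι e K' ≫ G' = j' ≫ ρ := by
    rw [← cancel_mono j', Category.assoc, hG₁, endι_naturality_assoc, Category.assoc, hρ]
  refine ⟨fun {a b} comm => ?_⟩
  obtain ⟨M, m₁, m₂, m₃⟩ := kanFibrations.exists_homotopy_lift_end e hp j' (ρ ≫ a) (G' ≫ a) (G ≫ b)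
    (by rw [reassoc_of% e₂]) (by rw [Category.assoc, comm.w, reassoc_of% hG₁])
    (by rw [Category.assoc, comm.w, reassoc_of% hρ])
  refine ⟨⟨{ l := endι e.rev E ≫ M, fac_left := ?_, fac_right := ?_ }⟩⟩
  · rw [← endι_naturality_assoc, m₂, reassoc_of% e₁]
  · rw [Category.assoc, m₃, reassoc_of% hG]

lemma kanFibrations.of_isPullback {X' X Y' Y : SSet.{u}} {f' : X' ⟶ X} {p' : X' ⟶ Y'} {p : X ⟶ Y}
    {f : Y' ⟶ Y} (hp : kanFibrations p) (sq : IsPullback f' p' p f) : kanFibrations p' :=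
  modelCategoryQuillen.J.rlp.of_isPullback sq hp

lemma trivialKanFibrations.of_isPullback {X' X Y' Y : SSet.{u}} {f' : X' ⟶ X} {p' : X' ⟶ Y'}
    {p : X ⟶ Y} {f : Y' ⟶ Y} (hp : trivialKanFibrations p) (sq : IsPullback f' p' p f) :
    trivialKanFibrations p' :=
  (MorphismProperty.monomorphisms SSet.{u}).rlp.of_isPullback sq hp

lemma kanFibrations_iff {X Y : SSet.{u}} (p : X ⟶ Y) :
    kanFibrations p ↔ ∀ (n : ℕ) (k : Fin (n + 2)), HasLiftingProperty Λ[n + 1, k].ι p := by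
  constructor
  · intro hp n k
    exact hp _ (modelCategoryQuillen.horn_ι_mem_J _ _)
  · intro hp A B i hi
    simp only [modelCategoryQuillen.J, MorphismProperty.iSup_iff] at hi
    obtain ⟨n, ⟨k⟩⟩ := hi
    exact hp n k

/-- The dependent product of a Kan fibration along a Kan fibration is a Kan fibration. -/
lemma kanFibrations.dependentProduct_π {Z A B : SSet.{u}} {p : Z ⟶ A} {q : A ⟶ B}
    (hp : kanFibrations p) (hq : kanFibrations q) : kanFibrations (dependentProduct.π p q) := by
  rw [kanFibrations_iff]
  intro n k
  refine dependentProduct.hasLiftingProperty _ fun l => ?_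
  obtain ⟨e, h, h', r, h₁, h₂, h₃⟩ := horn_exists_contraction n k
  exact (hq.of_isPullback (fiberProduct.isPullback l q).flip).anodyneExtensions_of_contraction
    (fiberProduct.isPullback_map l q _) e h h' r h₁ h₂ h₃ _ hp

/-- Anodyne extensions are stable under pullback along Kan fibrations. -/
lemma anodyneExtensions.of_isPullback {K L K' E : SSet.{u}} {j : K ⟶ L} (hj : anodyneExtensions j)
    {q : E ⟶ L} (hq : kanFibrations q) {j' : K' ⟶ E} {q' : K' ⟶ K} (sq : IsPullback j' q' q j) :
    anodyneExtensions j' := by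
  -- A lift against a Kan fibration is a section of its base change, hence of a dependent product.
  have key {Z : SSet.{u}} {p : Z ⟶ E} (hp : kanFibrations p) (a : K' ⟶ Z) (ha : a ≫ p = j') :
      ∃ s : E ⟶ Z, j' ≫ s = a ∧ s ≫ p = 𝟙 E := by
    let t : (fiberProduct (j ≫ 𝟙 _) q : SSet) ⟶ K' :=
      sq.lift (fiberProduct.snd _ _) (fiberProduct.fst _ _) (by
        rw [← fiberProduct.condition, Category.comp_id])
    have ht : t ≫ j' = fiberProduct.snd _ _ := sq.lift_fst _ _ _
    have ht' : t ≫ q' = fiberProduct.fst _ _ := sq.lift_snd _ _ _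
    let φ := dependentProduct.curry (p := p) (t ≫ a) (by rw [Category.assoc, ha, ht])
    obtain ⟨s, hs, hs'⟩ := hj.exists_lift (hp.dependentProduct_π hq) φ (𝟙 L)
      (dependentProduct.curry_π _ _)
    refine ⟨fiberProduct.lift q (𝟙 E) (by simp) ≫ dependentProduct.uncurry _ s hs', ?_, ?_⟩
    · have e : j' ≫ fiberProduct.lift q (𝟙 E) (by simp) =
          fiberProduct.lift (l := j ≫ 𝟙 L) q' j' (by rw [Category.comp_id, sq.w]) ≫
            fiberProduct.map (𝟙 L) q j :=
        fiberProduct.hom_ext sq.w (by simp [fiberProduct.map])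
      have e' : fiberProduct.lift (l := j ≫ 𝟙 L) q' j' (by rw [Category.comp_id, sq.w]) ≫ t =
          𝟙 K' :=
        sq.hom_ext (by rw [Category.assoc, ht]; simp) (by rw [Category.assoc, ht']; simp)
      rw [reassoc_of% e, dependentProduct.uncurry_natural _ _ _ _ hs,
        dependentProduct.uncurry_curry, reassoc_of% e']
    · rw [Category.assoc, dependentProduct.uncurry_comp]
      rfl
  intro Z W p hp
  refine ⟨fun {a b} comm => ?_⟩
  obtain ⟨s, hs, hs'⟩ := key (p := fiberProduct.fst b p)
    (kanFibrations.of_isPullback hp (fiberProduct.isPullback b p).flip)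
    (fiberProduct.lift j' a comm.w.symm) rfl
  refine ⟨⟨{ l := s ≫ fiberProduct.snd b p, fac_left := ?_, fac_right := ?_ }⟩⟩
  · rw [reassoc_of% hs, fiberProduct.lift_snd]
  · rw [Category.assoc, ← fiberProduct.condition, reassoc_of% hs']

/-! ### Extending Kan fibrations over horns -/

/-- A trivial fibration extends along a monomorphism of its base. -/
lemma trivialKanFibrations.exists_extension {E A D : SSet.{u}} {p : E ⟶ A}
    (hp : trivialKanFibrations p) (i : A ⟶ D) [Mono i] :
    ∃ (E' : SSet.{u}) (p' : E' ⟶ D) (t : E ⟶ E'), trivialKanFibrations p' ∧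
      IsPullback t p p' i := by
  obtain ⟨t, ht⟩ := dependentProduct.exists_isPullback (p := p) (q := i)
  refine ⟨_, dependentProduct.π p i, t, ?_, ht⟩
  intro K L j (_ : Mono j)
  refine dependentProduct.hasLiftingProperty j fun l => ?_
  exact hp _ ((MorphismProperty.monomorphisms SSet.{u}).of_isPullback
    (fiberProduct.isPullback_map l i j).flip (inferInstanceAs (Mono j)))

lemma injective_app {X Y : SSet.{u}} (f : X ⟶ Y) [Mono f] (n : SimplexCategoryᵒᵖ) :
    Function.Injective (f.app n) :=
  (mono_iff_injective _).1 ((NatTrans.mono_iff_mono_app f).1 inferInstance n)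

/-- A fibrewise deformation retract of the restriction of a Kan fibration to a subcomplex of the
base extends to the whole base. -/
lemma kanFibrations.exists_extension_of_deformation {A B D DA E : SSet.{u}} {i : A ⟶ B} [Mono i]
    {q : D ⟶ B} (hq : kanFibrations q) {t : DA ⟶ D} {qA : DA ⟶ A} (sq : IsPullback t qA q i)
    (ρ : DA ⟶ E) (s : E ⟶ DA) (p : E ⟶ A) (hp : ρ ≫ p = qA) (hs : s ≫ ρ = 𝟙 E)
    (H : DA ⊗ Δ[1] ⟶ DA) (h₀ : ι₀ ≫ H = 𝟙 DA) (h₁ : ι₁ ≫ H = ρ ≫ s) (hH : H ≫ qA = fst _ _ ≫ qA)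
    (hsH : s ▷ Δ[1] ≫ H = fst _ _ ≫ s) :
    ∃ (E' : SSet.{u}) (p' : E' ⟶ B) (t' : E ⟶ E'), kanFibrations p' ∧ IsPullback t' p p' i := by
  have : Mono t := (MorphismProperty.monomorphisms SSet.{u}).of_isPullback sq.flip
    (inferInstanceAs (Mono i))
  have ht {n} {x y : DA.obj n} (h : t.app n x = t.app n y) : x = y := injective_app t n h
  -- The simplices of `D` all of whose restrictions over `A` lie in `E`.
  let E' : D.Subcomplex :=
    { obj n := {d | ∀ (m : SimplexCategoryᵒᵖ) (θ : n ⟶ m) (x : DA.obj m),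
        t.app m x = D.map θ d → s.app m (ρ.app m x) = x}
      map {n m} f d hd k θ x hx := hd k (f ≫ θ) x (by rw [hx, map_map_apply]) }
  let U : D.Subcomplex := Subcomplex.range t ⊔ E'
  have hU {n} {x : D.obj n} (hx : x ∈ U.obj n) (hx' : ¬ ∃ y, t.app n y = x) : x ∈ E'.obj n :=
    hx.resolve_left hx'
  have hsH' {n} (x : DA.obj n) (hx : s.app n (ρ.app n x) = x) (τ) : H.app n (x, τ) = x := by
    have : H.app n (s.app n (ρ.app n x), τ) = s.app n (ρ.app n x) :=
      congr_app hsH (show (E ⊗ Δ[1]).obj n from (ρ.app n x, τ))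
    rwa [hx] at this
  -- The homotopy on `A` is stationary on `E`, so that it extends by the stationary homotopy.
  classical
  let G : (U : SSet.{u}) ⊗ Δ[1] ⟶ D :=
    { app n := TypeCat.ofHom fun x =>
        if h : ∃ y, t.app n y = x.1.1 then t.app n (H.app n (h.choose, x.2)) else x.1.1
      naturality n m f := by
        ext ⟨⟨x, hx⟩, τ⟩
        change (if h : ∃ y, t.app m y = D.map f x then
          t.app m (H.app m (h.choose, Δ[1].map f τ)) else D.map f x) =
          D.map f (if h : ∃ y, t.app n y = x then t.app n (H.app n (h.choose, τ)) else x)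
        by_cases h : ∃ y, t.app n y = x
        · have h' : ∃ y, t.app m y = D.map f x := by
            obtain ⟨y, rfl⟩ := h
            exact ⟨DA.map f y, app_map _ _ _⟩
          rw [dif_pos h, dif_pos h']
          have e : h'.choose = DA.map f h.choose :=
            ht (h'.choose_spec.trans (by rw [app_map, h.choose_spec]))
          rw [e, ← app_map]
          exact congrArg _ (app_map H f (show (DA ⊗ Δ[1]).obj n from (h.choose, τ)))
        · rw [dif_neg h]
          by_cases h' : ∃ y, t.app m y = D.map f x
          · rw [dif_pos h', hsH' _ (hU hx h m f _ h'.choose_spec), h'.choose_spec]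
          · rw [dif_neg h'] }
  have hG {n} (x : D.obj n) (hx : x ∈ U.obj n) (y : DA.obj n) (hy : t.app n y = x) (τ) :
      G.app n (⟨x, hx⟩, τ) = t.app n (H.app n (y, τ)) := by
    have h : ∃ y, t.app n y = x := ⟨y, hy⟩
    have e : h.choose = y := ht (h.choose_spec.trans hy.symm)
    exact (dif_pos h).trans (by rw [e])
  have hG' {n} (x : D.obj n) (hx : x ∈ U.obj n) (hx' : x ∈ E'.obj n) (τ) :
      G.app n (⟨x, hx⟩, τ) = x := by
    by_cases h : ∃ y, t.app n y = x
    · obtain ⟨y, hy⟩ := h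
      rw [hG x hx y hy, hsH' y (hx' n (𝟙 n) y (by rw [hy, map_id_apply])), hy]
    · exact dif_neg h
  obtain ⟨M, m₀, m₁, m₂⟩ := hq.exists_homotopy_lift U.ι (𝟙 D) G (fst _ _ ≫ q) (by
      ext n ⟨x, hx⟩
      change G.app n (⟨x, hx⟩, _) = x
      by_cases h : ∃ y, t.app n y = x
      · obtain ⟨y, hy⟩ := h
        refine (hG x hx y hy _).trans ?_
        exact (congrArg (t.app n) (congr_app h₀ y)).trans hy
      · exact hG' x hx (hU hx h) _) (by
      ext n ⟨⟨x, hx⟩, τ⟩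
      change q.app n (G.app n (⟨x, hx⟩, τ)) = q.app n x
      by_cases h : ∃ y, t.app n y = x
      · obtain ⟨y, hy⟩ := h
        have e₁ : q.app n (t.app n (H.app n (y, τ))) = i.app n (qA.app n (H.app n (y, τ))) :=
          congr_app sq.w _
        have e₂ : q.app n (t.app n y) = i.app n (qA.app n y) := congr_app sq.w _
        have e₃ : qA.app n (H.app n (y, τ)) = qA.app n y :=
          congr_app hH (show (DA ⊗ Δ[1]).obj n from (y, τ))
        rw [hG x hx y hy, e₁, e₃, ← e₂, hy]
      · rw [hG' x hx (hU hx h)]) (by simp)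
  -- The end of the lifted homotopy is an idempotent with image `E'`, so that `E'` is a retract
  -- of `D` over `B`.
  let r : D ⟶ D := ι₁ ≫ M
  have hr : r ≫ q = q := by simp [r, m₂]
  have hrU {n} (x : D.obj n) (hx : x ∈ U.obj n) :
      r.app n x = G.app n (⟨x, hx⟩,
        (const (stdSimplex.obj₀Equiv.{u}.symm 1) : D ⟶ Δ[1]).app n x) :=
    congr_app m₁ (show ((U : SSet.{u}) ⊗ Δ[1]).obj n from (⟨x, hx⟩,
        (const (stdSimplex.obj₀Equiv.{u}.symm 1) : D ⟶ Δ[1]).app n x))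
  have hrt {n} (y : DA.obj n) : r.app n (t.app n y) = t.app n (s.app n (ρ.app n y)) :=
    (hrU _ (Or.inl ⟨y, rfl⟩)).trans ((hG _ _ y rfl _).trans
      (congrArg (t.app n) (congr_app h₁ y)))
  have hrE {n} (x : D.obj n) (hx : x ∈ E'.obj n) : r.app n x = x :=
    (hrU _ (Or.inr hx)).trans (hG' _ _ hx _)
  have hrE' {n} (x : D.obj n) : r.app n x ∈ E'.obj n := by
    intro m θ x' hx'
    obtain ⟨y, hy, -⟩ := Types.exists_of_isPullback (sq.map ((evaluation _ _).obj m)) (D.map θ x)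
      (qA.app m x') (by
        have e₁ : q.app m (t.app m x') = i.app m (qA.app m x') := congr_app sq.w _
        have e₂ : q.app m (r.app m (D.map θ x)) = q.app m (D.map θ x) := congr_app hr _
        refine Eq.trans ?_ e₁
        rw [hx', ← app_map, e₂]
        rfl)
    have hy' : D.map θ x = t.app m y := hy.symm
    rw [← app_map, hy', hrt] at hx'
    rw [ht hx']
    exact congrArg (s.app m) (congr_app hs _)
  have hsE {n} (x : E.obj n) : t.app n (s.app n x) ∈ E'.obj n := by
    intro m θ y hy
    rw [← app_map, ← app_map] at hy
    rw [ht hy]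
    exact congrArg (s.app m) (congr_app hs _)
  let r' : D ⟶ E' := Subcomplex.lift r (by rintro n _ ⟨x, rfl⟩; exact hrE' x)
  let t' : E ⟶ E' := Subcomplex.lift (s ≫ t) (by rintro n _ ⟨x, rfl⟩; exact hsE x)
  have ht' : t' ≫ E'.ι = s ≫ t := rfl
  have hr' : E'.ι ≫ r' = 𝟙 _ := by
    ext n ⟨x, hx⟩
    exact Subtype.ext (hrE x hx)
  refine ⟨E', E'.ι ≫ q, t', ?_, ⟨⟨?_⟩, ⟨PullbackCone.IsLimit.mk _
    (fun c => sq.lift (c.fst ≫ E'.ι) c.snd ((Category.assoc _ _ _).trans c.condition) ≫ ρ)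
    (fun c => ?_) (fun c => ?_) (fun c m h₁ h₂ => ?_)⟩⟩⟩
  · exact modelCategoryQuillen.J.rlp.of_retract
      { i := Arrow.homMk E'.ι (𝟙 _) (by simp), r := Arrow.homMk r' (𝟙 _) (by
          change r' ≫ E'.ι ≫ q = q ≫ 𝟙 _
          rw [Category.comp_id]
          exact hr)
        retract := by ext : 1 <;> simp [hr'] } hq
  · rw [reassoc_of% ht', sq.w, ← hp, Category.assoc, reassoc_of% hs]
  · have e := sq.lift_fst (c.fst ≫ E'.ι) c.snd ((Category.assoc _ _ _).trans c.condition)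
    generalize sq.lift (c.fst ≫ E'.ι) c.snd _ = z at e
    ext n x
    have e' : t.app n (z.app n x) = (c.fst.app n x).1 := congr_app e x
    refine Subtype.ext (Eq.trans ?_ e')
    exact congrArg (t.app n) ((c.fst.app n x).2 n (𝟙 n) _ (by
      rw [map_id_apply]
      exact e'))
  · have e := sq.lift_snd (c.fst ≫ E'.ι) c.snd ((Category.assoc _ _ _).trans c.condition)
    rw [Category.assoc, hp, e]
  · have e := sq.lift_fst (c.fst ≫ E'.ι) c.snd ((Category.assoc _ _ _).trans c.condition)
    have e' : c.fst ≫ E'.ι = (m ≫ s) ≫ t := by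
      rw [← h₁, Category.assoc, ht', Category.assoc]
    have := (cancel_mono t).1 (e.trans e')
    rw [this, Category.assoc, hs, Category.comp_id]

/-- The space of lifts of the paths `{a} × Δ[1]` to a Kan fibration over `A × Δ[1]` is trivially
fibred over the fibres of both ends. -/
lemma kanFibrations.exists_path_space {A P : SSet.{u}} {π : P ⟶ A ⊗ Δ[1]} (hπ : kanFibrations π) :
    ∃ (T : SSet.{u}) (c : T ⟶ A), ∀ (e : Fin 2) {Q : SSet.{u}} {f : Q ⟶ P} {p : Q ⟶ A}
      (_ : IsPullback f p π (endι e A)), ∃ a : T ⟶ Q, a ≫ p = c ∧ trivialKanFibrations a := by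
  let T := dependentProduct π (fst A Δ[1])
  let c : T ⟶ A := dependentProduct.π π (fst A Δ[1])
  -- Maps to `T` correspond to homotopies in `P`.
  let u {L : SSet.{u}} (l : L ⟶ A) : L ⊗ Δ[1] ⟶ (fiberProduct l (fst A Δ[1]) : SSet.{u}) :=
    fiberProduct.lift (fst _ _) (l ▷ Δ[1]) (by simp)
  let v {L : SSet.{u}} (l : L ⟶ A) : (fiberProduct l (fst A Δ[1]) : SSet.{u}) ⟶ L ⊗ Δ[1] :=
    lift (fiberProduct.fst _ _) (fiberProduct.snd _ _ ≫ snd _ _)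
  have hv {L : SSet.{u}} (l : L ⟶ A) : v l ≫ l ▷ Δ[1] = fiberProduct.snd _ _ := by
    apply CartesianMonoidalCategory.hom_ext
    · simpa [v] using fiberProduct.condition l (fst A Δ[1])
    · simp [v]
  have hvu {L : SSet.{u}} (l : L ⟶ A) : v l ≫ u l = 𝟙 _ :=
    fiberProduct.hom_ext (by simp [u, v]) (by simp [u, hv])
  have huv {L : SSet.{u}} (l : L ⟶ A) : u l ≫ v l = 𝟙 _ :=
    CartesianMonoidalCategory.hom_ext _ _ (by simp [u, v]) (by simp [u, v])
  have huc {K L : SSet.{u}} (j : K ⟶ L) (l : L ⟶ A) :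
      j ▷ Δ[1] ≫ u l = u (j ≫ l) ≫ fiberProduct.map l _ j :=
    fiberProduct.hom_ext (by simp [u, fiberProduct.map]) (by simp [u, fiberProduct.map])
  let ev {L : SSet.{u}} (k : L ⟶ T) : L ⊗ Δ[1] ⟶ P :=
    u (k ≫ c) ≫ dependentProduct.uncurry (k ≫ c) k rfl
  have ev_π {L : SSet.{u}} (k : L ⟶ T) : ev k ≫ π = (k ≫ c) ▷ Δ[1] := by
    rw [Category.assoc, dependentProduct.uncurry_comp]
    simp [u]
  have ev_comp {K L : SSet.{u}} (j : K ⟶ L) (k : L ⟶ T) : ev (j ≫ k) = j ▷ Δ[1] ≫ ev k := by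
    rw [reassoc_of% (huc j (k ≫ c)), dependentProduct.uncurry_natural j k rfl _ rfl]
    rfl
  have exists_of {L : SSet.{u}} (l : L ⟶ A) (φ : L ⊗ Δ[1] ⟶ P) (hφ : φ ≫ π = l ▷ Δ[1]) :
      ∃ k : L ⟶ T, k ≫ c = l ∧ ev k = φ := by
    refine ⟨dependentProduct.curry (l := l) (v l ≫ φ) (by rw [Category.assoc, hφ, hv]), rfl, ?_⟩
    refine (congrArg (fun z => u l ≫ z) (dependentProduct.uncurry_curry _ _)).trans ?_
    rw [reassoc_of% huv]
  have ev_ext {L : SSet.{u}} (k k' : L ⟶ T) (h : k ≫ c = k' ≫ c) (h' : ev k = ev k') :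
      k = k' := by
    have key (l : L ⟶ A) (k : L ⟶ T) (hk : k ≫ c = l) :
        ∃ hφ, dependentProduct.curry (p := π) (l := l) (v l ≫ ev k) hφ = k := by
      subst hk
      have : v (k ≫ c) ≫ ev k = dependentProduct.uncurry (k ≫ c) k rfl := by
        rw [reassoc_of% hvu]
      refine ⟨by rw [this]; exact dependentProduct.uncurry_comp _ _ _, ?_⟩
      simp only [this]
      exact dependentProduct.curry_uncurry _ _ _
    obtain ⟨_, e⟩ := key _ k rfl
    obtain ⟨_, e'⟩ := key _ k' h.symm
    rw [← e, ← e']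
    simp only [h']
  -- Evaluation of a path at its end `e`; lifting against it is homotopy lifting along `π`.
  refine ⟨T, c, fun e Q f p sq => ?_⟩
  let a : T ⟶ Q := sq.lift (endι e T ≫ ev (𝟙 T)) c (by
    rw [Category.assoc, ev_π, Category.id_comp, endι_naturality])
  have ha : a ≫ f = endι e T ≫ ev (𝟙 T) := sq.lift_fst _ _ _
  have ha' : a ≫ p = c := sq.lift_snd _ _ _
  refine ⟨a, ha', fun K L j (_ : Mono j) => ⟨fun {k y} comm => ?_⟩⟩
  have ev_eq {L : SSet.{u}} (k : L ⟶ T) : ev k = k ▷ Δ[1] ≫ ev (𝟙 T) := by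
    rw [← ev_comp, Category.comp_id]
  have w := comm.w
  obtain ⟨M, m₀, m₁, m₂⟩ := kanFibrations.exists_homotopy_lift_end e hπ j (y ≫ f) (ev k)
    ((y ≫ p) ▷ Δ[1])
    (by rw [ev_eq, endι_naturality_assoc, ← ha, reassoc_of% w])
    (by rw [ev_π, ← comp_whiskerRight, ← reassoc_of% w, ha'])
    (by rw [endι_naturality, Category.assoc, sq.w, Category.assoc])
  obtain ⟨z, hz, hz'⟩ := exists_of _ M m₂
  refine ⟨⟨{ l := z, fac_left := ?_, fac_right := ?_ }⟩⟩
  · apply ev_ext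
    · rw [Category.assoc, hz, ← reassoc_of% w, ha']
    · rw [ev_comp, hz', m₁]
  · apply sq.hom_ext
    · rw [Category.assoc, ha, ← endι_naturality_assoc, ← ev_eq, hz', m₀]
    · rw [Category.assoc, ha', hz]

lemma Mono.of_isPullback {X' X Y' Y : SSet.{u}} {f' : X' ⟶ X} {p' : X' ⟶ Y'}
    {p : X ⟶ Y} {f : Y' ⟶ Y} [Mono f] (sq : IsPullback f' p' p f) : Mono f' :=
  (MorphismProperty.monomorphisms SSet.{u}).of_isPullback sq.flip (inferInstanceAs (Mono f))

/-- A Kan fibration over a horn extends to the simplex. -/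
lemma kanFibrations.exists_extension_horn {n : ℕ} {k : Fin (n + 2)} {E : SSet.{u}}
    {p : E ⟶ Λ[n + 1, k]} (hp : kanFibrations p) :
    ∃ (E' : SSet.{u}) (p' : E' ⟶ Δ[n + 1]) (t : E ⟶ E'), kanFibrations p' ∧
      IsPullback t p p' Λ[n + 1, k].ι := by
  obtain ⟨e, h, h', r, h₁, h₂, h₃⟩ := horn_exists_contraction.{u} n k
  have h₁' : endι e.rev _ ≫ h' = 𝟙 _ := by
    rw [← cancel_mono Λ[n + 1, k].ι, Category.assoc, ← h₃, endι_naturality_assoc, h₁]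
    simp
  have h₂' : endι e _ ≫ h' = Λ[n + 1, k].ι ≫ r := by
    rw [← cancel_mono Λ[n + 1, k].ι, Category.assoc, ← h₃, endι_naturality_assoc, h₂]
    simp
  -- The restriction to the horn of the pullback of `E` along the contraction `r`, which is defined
  -- on the whole simplex, is connected to `E` by the pullback of `E` along the homotopy `h'`.
  let D := fiberProduct r p
  let d := fiberProduct.fst r p
  have hd : kanFibrations d := hp.of_isPullback (fiberProduct.isPullback r p).flip
  have sqP := (fiberProduct.isPullback h' p).flip
  have sqQ := (fiberProduct.isPullback Λ[n + 1, k].ι d).flip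
  have sq₀ := sqQ.paste_horiz (fiberProduct.isPullback r p).flip
  rw [← h₂'] at sq₀
  have sq₁ : IsPullback (𝟙 E) p p (endι e.rev _ ≫ h') := by
    rw [h₁']
    exact IsPullback.of_horiz_isIso ⟨by simp⟩
  -- The path space `T` is trivially fibred over both, so that it extends over the simplex together
  -- with its map to the restriction of `D`, and `E` is a deformation retract of it.
  obtain ⟨T, c, hT⟩ := (hp.of_isPullback sqP).exists_path_space
  obtain ⟨a, ha, ha'⟩ := hT e (sq₀.of_right' sqP)
  obtain ⟨b, hb, hb'⟩ := hT e.rev (sq₁.of_right' sqP)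
  have : Mono (fiberProduct.snd Λ[n + 1, k].ι d) := Mono.of_isPullback sqQ
  obtain ⟨T', a', t, ha₁, ha₂⟩ := ha'.exists_extension (fiberProduct.snd Λ[n + 1, k].ι d)
  have sqT := ha₂.paste_vert sqQ
  rw [ha] at sqT
  obtain ⟨s, H, hs, hH₀, hH₁, hH, hsH⟩ := hb'.exists_section
  refine kanFibrations.exists_extension_of_deformation (q := a' ≫ d)
    (modelCategoryQuillen.J.rlp.comp_mem _ _ (trivialKanFibrations_le_kanFibrations _ ha₁) hd)
    sqT b s p hb hs H hH₀ hH₁ ?_ hsH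
  rw [← hb, reassoc_of% hH]

/-! ### Small subfibrations -/

instance : Countable SimplexCategoryᵒᵖ := by
  let g : ℕ → SimplexCategoryᵒᵖ := fun n => op ⦋n⦌
  have : Function.Surjective g := fun n => ⟨n.unop.len, rfl⟩
  exact this.countable

instance (n m : SimplexCategory) : Countable (n ⟶ m) := by
  let g : (n ⟶ m) → (Fin (n.len + 1) → Fin (m.len + 1)) := fun f => f.toOrderHom
  have : Function.Injective g := by
    intro f f' h
    apply SimplexCategory.Hom.ext
    exact OrderHom.ext _ _ h
  exact this.countable

instance (n m : SimplexCategoryᵒᵖ) : Countable (n ⟶ m) :=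
  Quiver.Hom.unop_inj.countable

instance (n : ℕ) (m : SimplexCategoryᵒᵖ) : Countable ((Δ[n] : SSet.{u}).obj m) :=
  stdSimplex.objEquiv.injective.countable

/-- Function symbols for the simplicial operators and for the choice of horn fillers over `B`. -/
inductive FillerSymbol (B : SSet.{u}) : ℕ → Type u
  /-- the action of a simplicial operator -/
  | face {n m : SimplexCategoryᵒᵖ} (f : n ⟶ m) : FillerSymbol B 1
  /-- a filler, over a given simplex of `B`, of the horn with the given faces -/
  | fill (n : ℕ) (k : Fin (n + 2)) (b : B _⦋n + 1⦌) : FillerSymbol B (n + 2)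

instance (B : SSet.{u}) [∀ n, Countable (B.obj n)] : Countable (Σ a, FillerSymbol B a) := by
  let f : (Σ a, FillerSymbol B a) → (Σ n m : SimplexCategoryᵒᵖ, n ⟶ m) ⊕
      (Σ n : ℕ, Fin (n + 2) × B _⦋n + 1⦌) := fun x => match x with
    | ⟨_, .face f⟩ => Sum.inl ⟨_, _, f⟩
    | ⟨_, .fill n k b⟩ => Sum.inr ⟨n, k, b⟩
  have hf : Function.Injective f := by
    rintro ⟨_, _ | _⟩ ⟨_, _ | _⟩ h
    · cases h; rfl
    · cases h
    · cases h
    · cases h; rfl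
  exact hf.countable

/-- The first-order language with the operation symbols of `FillerSymbol`. -/
def fillerLanguage (B : SSet.{u}) : FirstOrder.Language.{u, 0} where
  Functions := FillerSymbol B
  Relations _ := Empty

open Classical in
/-- The simplices of a simplicial set over `B` as a structure for the language of horn fillers;
where the symbols make no sense, their value is the first argument. -/
noncomputable abbrev fillerStructure {E B : SSet.{u}} (p : E ⟶ B) :
    (fillerLanguage B).Structure (Σ n, E.obj n) where
  funMap {a} φ := match a, φ with
    | _, .face (n := n) (m := m) f => fun v =>
        if h : ∃ x : E.obj n, v 0 = ⟨n, x⟩ then ⟨m, E.map f h.choose⟩ else v 0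
    | _, .fill n k b => fun v =>
        if h : ∃ x : E _⦋n + 1⦌, p.app _ x = b ∧ ∀ j ≠ k, v j = ⟨op ⦋n⦌, E.δ j x⟩ then
          ⟨_, h.choose⟩ else v 0
  RelMap r := r.elim

/-- A subcomplex of a Kan fibration over a countable base is contained in one of the same
cardinality on which the fibration is still Kan. -/
lemma kanFibrations.exists_small {E B : SSet.{u}} [∀ n, Countable (B.obj n)] {p : E ⟶ B}
    (hp : kanFibrations p) (C : E.Subcomplex) (κ : Cardinal.{u}) (hκ : Cardinal.aleph0 ≤ κ)
    (hC : Cardinal.mk (Σ n, C.obj n) ≤ κ) :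
    ∃ D : E.Subcomplex, C ≤ D ∧ kanFibrations (D.ι ≫ p) ∧ Cardinal.mk (Σ n, D.obj n) ≤ κ := by
  let := fillerStructure p
  let s : Set (Σ n, E.obj n) := Set.range fun x : (Σ n, C.obj n) => ⟨x.1, x.2.1⟩
  let cl := FirstOrder.Language.Substructure.closure (fillerLanguage B) s
  -- The substructure generated by `C` is stable under faces, degeneracies and chosen fillers.
  let D : E.Subcomplex :=
    { obj n := {x | ⟨n, x⟩ ∈ cl}
      map {n m} f x hx := by
        have := FirstOrder.Language.Substructure.fun_mem cl
          (show (fillerLanguage B).Functions 1 from FillerSymbol.face f) (fun _ => ⟨n, x⟩)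
          (fun _ => hx)
        have h : ∃ y : E.obj n, (⟨n, x⟩ : Σ n, E.obj n) = ⟨n, y⟩ := ⟨x, rfl⟩
        have e : h.choose = x := (eq_of_heq (Sigma.mk.inj h.choose_spec).2).symm
        have e' : FirstOrder.Language.Structure.funMap
            (show (fillerLanguage B).Functions 1 from FillerSymbol.face f)
            (fun _ : Fin 1 => (⟨n, x⟩ : Σ n, E.obj n)) = ⟨m, E.map f x⟩ :=
          (dif_pos h).trans (by rw [e])
        rw [e'] at this
        exact this }
  refine ⟨D, fun n x hx => ?_, ?_, ?_⟩
  · exact FirstOrder.Language.Substructure.subset_closure ⟨⟨n, ⟨x, hx⟩⟩, rfl⟩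
  · rw [kanFibrations_iff]
    intro n k
    refine ⟨fun {a b} sq => ?_⟩
    obtain ⟨l, hl, hl'⟩ := (anodyneExtensions.horn_ι k).exists_lift hp (a ≫ D.ι) b (by
      rw [Category.assoc, sq.w])
    have hface (x : E _⦋n + 1⦌) (j) (hj : j ≠ k) :
        (Λ[n + 1, k].ι ≫ yonedaEquiv.symm x).app _ (horn.face k j hj) = E.δ j x := rfl
    -- The `k`-th argument of a filling symbol is irrelevant to its value.
    obtain ⟨j₀, hj₀⟩ := exists_ne k
    let v : Fin (n + 2) → Σ n, E.obj n := fun j =>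
      if hj : j ≠ k then ⟨op ⦋n⦌, (a.app _ (horn.face k j hj)).1⟩ else
        ⟨op ⦋n⦌, (a.app _ (horn.face k j₀ hj₀)).1⟩
    have hv (j) : v j ∈ cl := by
      by_cases hj : j ≠ k
      · rw [show v j = _ from dif_pos hj]
        exact (a.app _ (horn.face k j hj)).2
      · rw [show v j = _ from dif_neg hj]
        exact (a.app _ (horn.face k j₀ hj₀)).2
    have h : ∃ x : E _⦋n + 1⦌, p.app _ x = yonedaEquiv b ∧
        ∀ j ≠ k, v j = ⟨op ⦋n⦌, E.δ j x⟩ := by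
      refine ⟨yonedaEquiv l, ?_, fun j hj => ?_⟩
      · rw [← hl']
        rfl
      · refine (dif_pos hj : v j = _).trans (congrArg _ ?_)
        rw [← hface _ j hj, Equiv.symm_apply_apply]
        exact congr_app hl.symm (horn.face k j hj)
    have hx := FirstOrder.Language.Substructure.fun_mem cl
      (show (fillerLanguage B).Functions (n + 2) from FillerSymbol.fill n k (yonedaEquiv b)) v hv
    have e' : FirstOrder.Language.Structure.funMap
        (show (fillerLanguage B).Functions (n + 2) from FillerSymbol.fill n k (yonedaEquiv b)) v =
        ⟨op ⦋n + 1⦌, h.choose⟩ := dif_pos h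
    rw [e'] at hx
    obtain ⟨h₁, h₂⟩ := h.choose_spec
    generalize h.choose = x at hx h₁ h₂
    refine ⟨⟨{ l := yonedaEquiv.symm (show (D : SSet.{u}).obj _ from ⟨x, hx⟩), fac_left := ?_,
               fac_right := ?_ }⟩⟩
    · refine horn.hom_ext _ _ fun j hj => Subtype.ext ?_
      have := (dif_pos hj : v j = _).symm.trans (h₂ j hj)
      exact (eq_of_heq (Sigma.mk.inj this).2).symm
    · rw [← Equiv.symm_apply_apply yonedaEquiv b, ← h₁, ← yonedaEquiv_symm_comp]
      rfl
  · refine (Cardinal.mk_le_of_injective (f := fun x : (Σ n, D.obj n) =>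
      (⟨⟨x.1, x.2.1⟩, x.2.2⟩ : cl)) ?_).trans ?_
    · rintro ⟨n, x, hx⟩ ⟨m, y, hy⟩ h
      simp only [Subtype.mk.injEq, Sigma.mk.injEq] at h
      obtain ⟨rfl, h⟩ := h
      obtain rfl := eq_of_heq h
      rfl
    · have h₁ := FirstOrder.Language.Substructure.lift_card_closure_le (L := fillerLanguage B)
        (s := s)
      rw [Cardinal.lift_id, Cardinal.lift_id, Cardinal.lift_id] at h₁
      refine h₁.trans (max_le hκ ((add_le_add (Cardinal.mk_range_le.trans hC)
        ((Cardinal.mk_le_aleph0_iff.2 ?_).trans hκ)).trans (Cardinal.add_eq_self hκ).le))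
      exact inferInstanceAs (Countable (Σ a, FillerSymbol B a))

/-! ### A universe of small Kan fibrations -/

/-- A simplicial set over `Y` whose fibres are subsets of a fixed type `S`. The action of the
simplicial operators is a total function on `S`, of which only the restriction to the fibres
matters; in this form, such families can be pulled back strictly functorially. -/
@[ext]
structure Family (S : Type u) (Y : SSet.{u}) : Type u where
  /-- The fibre over a simplex. -/
  fib {n : SimplexCategoryᵒᵖ} (y : Y.obj n) : Set S
  /-- The action of a simplicial operator on the fibre over a simplex. -/
  act {n m : SimplexCategoryᵒᵖ} (f : n ⟶ m) (y : Y.obj n) (s : S) : S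
  act_mem {n m : SimplexCategoryᵒᵖ} (f : n ⟶ m) (y : Y.obj n) (s : S) (h : s ∈ fib y) :
    act f y s ∈ fib (Y.map f y)
  act_id {n : SimplexCategoryᵒᵖ} (y : Y.obj n) (s : S) (h : s ∈ fib y) : act (𝟙 n) y s = s
  act_comp {n m k : SimplexCategoryᵒᵖ} (f : n ⟶ m) (g : m ⟶ k) (y : Y.obj n) (s : S)
    (h : s ∈ fib y) : act (f ≫ g) y s = act g (Y.map f y) (act f y s)

namespace Family

variable {S : Type u} {X Y : SSet.{u}}

/-- The pullback of a family along a map. -/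
def pullback (F : Family S Y) (φ : X ⟶ Y) : Family S X where
  fib {n} x := F.fib (φ.app n x)
  act {n m} f x s := F.act f (φ.app n x) s
  act_mem f x s h := by
    rw [app_map]
    exact F.act_mem f _ s h
  act_id x s h := F.act_id _ s h
  act_comp f g x s h := by
    rw [app_map]
    exact F.act_comp f g _ s h

lemma pullback_comp {Z : SSet.{u}} (F : Family S Y) (φ : X ⟶ Y) (ψ : Z ⟶ X) :
    F.pullback (ψ ≫ φ) = (F.pullback φ).pullback ψ := rfl

/-- The total space of a family. -/
def total (F : Family S Y) : SSet.{u} where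
  obj n := {x : Y.obj n × S // x.2 ∈ F.fib x.1}
  map f := TypeCat.ofHom fun x => ⟨(Y.map f x.1.1, F.act f x.1.1 x.1.2), F.act_mem f _ _ x.2⟩
  map_id n := by
    ext ⟨⟨y, s⟩, h⟩
    · exact map_id_apply Y y
    · exact F.act_id y s h
  map_comp f g := by
    ext ⟨⟨y, s⟩, h⟩
    · exact (map_map_apply Y f g y).symm
    · exact F.act_comp f g y s h

/-- The projection from the total space of a family to its base. -/
def proj (F : Family S Y) : F.total ⟶ Y where
  app _ := TypeCat.ofHom fun x => x.1.1
  naturality _ _ _ := rfl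

/-- The map between total spaces over a map between the bases. -/
def totalMap (F : Family S Y) (φ : X ⟶ Y) : (F.pullback φ).total ⟶ F.total where
  app n := TypeCat.ofHom fun x => ⟨(φ.app n x.1.1, x.1.2), x.2⟩
  naturality n m f := by
    ext ⟨⟨y, s⟩, h⟩
    exact Subtype.ext (Prod.ext (app_map _ _ _) rfl)

lemma isPullback (F : Family S Y) (φ : X ⟶ Y) :
    IsPullback (F.totalMap φ) (F.pullback φ).proj F.proj φ where
  w := rfl
  isLimit' := ⟨PullbackCone.IsLimit.mk _ (fun c =>
      { app n := TypeCat.ofHom fun x => ⟨(c.snd.app n x, (c.fst.app n x).1.2), by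
          have := (c.fst.app n x).2
          rwa [show (c.fst.app n x).1.1 = φ.app n (c.snd.app n x) from congr_app c.condition x]
            at this⟩
        naturality n m f := by
          ext x
          refine Subtype.ext (Prod.ext (app_map _ _ _) ?_)
          refine (congrArg (fun z => z.1.2) (app_map c.fst f x)).trans ?_
          exact congrArg (fun z => F.act f z _) (congr_app c.condition x) })
      (fun c => by
        ext n x
        exact Subtype.ext (Prod.ext (congr_app c.condition x).symm rfl))
      (fun c => rfl)
      (fun c m h₁ h₂ => by
        ext n x
        exact Subtype.ext (Prod.ext (congr_app h₂ x)
          (congrArg (fun z => z.1.2) (congr_app h₁ x))))⟩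

end Family

lemma yonedaEquiv_symm_map {X : SSet.{u}} {n m : SimplexCategoryᵒᵖ} (f : n ⟶ m) (x : X.obj n) :
    yonedaEquiv.symm (X.map f x) = SSet.stdSimplex.{u}.map f.unop ≫ yonedaEquiv.symm x := by
  apply yonedaEquiv.injective
  rw [Equiv.apply_symm_apply]
  exact congrArg (fun f => X.map f x) (Quiver.Hom.unop_inj (Category.id_comp f.unop).symm)

/-- A simplicial set classifying the Kan fibrations whose fibres are subsets of `S`. -/
def fibrationUniverse (S : Type u) : SSet.{u} where
  obj n := {F : Family S (SSet.stdSimplex.obj n.unop) // kanFibrations F.proj}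
  map f := TypeCat.ofHom fun F => ⟨F.1.pullback (SSet.stdSimplex.{u}.map f.unop),
    F.2.of_isPullback (F.1.isPullback _)⟩
  map_id n := by
    apply ConcreteCategory.hom_ext
    intro F
    exact Subtype.ext (congrArg F.1.pullback (SSet.stdSimplex.{u}.map_id n.unop))
  map_comp f g := by
    apply ConcreteCategory.hom_ext
    intro F
    exact Subtype.ext (congrArg F.1.pullback (SSet.stdSimplex.{u}.map_comp g.unop f.unop))

/-- The family over a standard simplex which is a given simplex of the universe. -/
def fibrationUniverse.family {S : Type u} {n : SimplexCategoryᵒᵖ}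
    (x : (fibrationUniverse S).obj n) : Family S (SSet.stdSimplex.obj n.unop) := Subtype.val x

/-- A map is a Kan fibration if its base changes to all standard simplices are. -/
lemma kanFibrations_of_forall_stdSimplex {X Y : SSet.{u}} {p : X ⟶ Y}
    (h : ∀ (n : ℕ) (y : Δ[n] ⟶ Y), ∃ (Q : SSet.{u}) (f : Q ⟶ X) (q : Q ⟶ Δ[n]),
      IsPullback f q p y ∧ kanFibrations q) : kanFibrations p := by
  rw [kanFibrations_iff]
  intro n k
  refine ⟨fun {a b} comm => ?_⟩
  obtain ⟨Q, f, q, sq, hq⟩ := h _ b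
  obtain ⟨l, hl, hl'⟩ := (anodyneExtensions.horn_ι k).exists_lift hq
    (sq.lift a Λ[n + 1, k].ι comm.w) (𝟙 _) (by rw [sq.lift_snd, Category.comp_id])
  exact ⟨⟨{ l := l ≫ f
            fac_left := by rw [reassoc_of% hl, sq.lift_fst]
            fac_right := by rw [Category.assoc, sq.w, reassoc_of% hl'] }⟩⟩

namespace fibrationUniverse

variable {S : Type u} {X Y : SSet.{u}}

/-- The classifying map of a family which is a Kan fibration. -/
def ofFamily (F : Family S Y) (hF : kanFibrations F.proj) : Y ⟶ fibrationUniverse S where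
  app n := TypeCat.ofHom fun y =>
    (⟨F.pullback (yonedaEquiv.symm y), hF.of_isPullback (F.isPullback _)⟩ :
      {F : Family S (SSet.stdSimplex.obj n.unop) // kanFibrations F.proj})
  naturality n m f := by
    ext y
    refine Subtype.ext ?_
    change F.pullback (yonedaEquiv.symm (Y.map f y)) =
      (F.pullback (yonedaEquiv.symm y)).pullback (SSet.stdSimplex.{u}.map f.unop)
    rw [← Family.pullback_comp]
    exact congrArg F.pullback (yonedaEquiv_symm_map f y)

/-- The top-dimensional simplex of `Δ[n]`, given by the identity. -/
abbrev idSimplex (n : SimplexCategoryᵒᵖ) : (SSet.stdSimplex.{u}.obj n.unop).obj n :=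
  stdSimplex.objEquiv.symm (𝟙 _)

lemma pullback_app (g : Y ⟶ fibrationUniverse S) {n m : SimplexCategoryᵒᵖ} (f : n ⟶ m)
    (y : Y.obj n) :
    (family (g.app m (Y.map f y))) = (family (g.app n y)).pullback
      (SSet.stdSimplex.{u}.map f.unop) :=
  congrArg Subtype.val (app_map g f y)

lemma map_idSimplex {n m : SimplexCategoryᵒᵖ} (f : n ⟶ m) :
    (SSet.stdSimplex.{u}.map f.unop).app m (idSimplex m) =
      (SSet.stdSimplex.obj n.unop).map f (idSimplex n) := by
  apply stdSimplex.objEquiv.injective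
  exact (Category.id_comp f.unop).trans (Category.comp_id f.unop).symm

lemma fib_app_map (g : Y ⟶ fibrationUniverse S) {n m : SimplexCategoryᵒᵖ} (f : n ⟶ m)
    (y : Y.obj n) : (family (g.app m (Y.map f y))).fib (idSimplex m) =
      (family (g.app n y)).fib ((SSet.stdSimplex.obj n.unop).map f (idSimplex n)) := by
  rw [pullback_app, ← map_idSimplex]
  rfl

lemma act_app_map (g : Y ⟶ fibrationUniverse S) {n m k : SimplexCategoryᵒᵖ} (f : n ⟶ m)
    (h : m ⟶ k) (y : Y.obj n) (s : S) : (family (g.app m (Y.map f y))).act h (idSimplex m) s =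
      (family (g.app n y)).act h ((SSet.stdSimplex.obj n.unop).map f (idSimplex n)) s := by
  rw [pullback_app, ← map_idSimplex]
  rfl

/-- The family classified by a map. -/
def toFamily (g : Y ⟶ fibrationUniverse S) : Family S Y where
  fib {n} y := (family (g.app n y)).fib (idSimplex n)
  act {n m} f y s := (family (g.app n y)).act f (idSimplex n) s
  act_mem f y s h := by
    rw [fib_app_map]
    exact Family.act_mem _ _ _ _ h
  act_id y s h := Family.act_id _ _ _ h
  act_comp f f' y s h := by
    rw [act_app_map]
    exact Family.act_comp _ _ _ _ _ h

lemma toFamily_comp (φ : X ⟶ Y) (g : Y ⟶ fibrationUniverse S) :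
    toFamily (φ ≫ g) = (toFamily g).pullback φ := rfl

lemma comp_ofFamily (φ : X ⟶ Y) (F : Family S Y) (hF : kanFibrations F.proj) :
    φ ≫ ofFamily F hF = ofFamily (F.pullback φ) (hF.of_isPullback (F.isPullback φ)) := by
  ext n x
  refine Subtype.ext ?_
  change F.pullback (yonedaEquiv.symm (φ.app n x)) =
    (F.pullback φ).pullback (yonedaEquiv.symm x)
  rw [← Family.pullback_comp, yonedaEquiv_symm_comp]

lemma toFamily_ofFamily (F : Family S Y) (hF : kanFibrations F.proj) :
    toFamily (ofFamily F hF) = F := by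
  have e {n : SimplexCategoryᵒᵖ} (y : Y.obj n) :
    (yonedaEquiv.symm y).app n (idSimplex n) = y := map_id_apply Y y
  apply Family.ext
  · funext n y
    exact congrArg F.fib (e y)
  · funext n m f y s
    exact congrArg (fun y => F.act f y s) (e y)

lemma pullback_toFamily (g : Y ⟶ fibrationUniverse S) {n : SimplexCategoryᵒᵖ} (y : Y.obj n) :
    (toFamily g).pullback (yonedaEquiv.symm y) = (family (g.app n y)) := by
  have e {m} (θ : (SSet.stdSimplex.obj n.unop).obj m) :
      (SSet.stdSimplex.obj n.unop).map (stdSimplex.objEquiv θ).op (idSimplex n) = θ := by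
    apply stdSimplex.objEquiv.injective
    exact Category.comp_id (obj := SimplexCategory) (stdSimplex.objEquiv θ)
  have e' {m} (θ : (SSet.stdSimplex.obj n.unop).obj m) :
      (yonedaEquiv.symm y).app m θ = Y.map (stdSimplex.objEquiv θ).op y := rfl
  apply Family.ext
  · funext m θ
    change (family (g.app m ((yonedaEquiv.symm y).app m θ))).fib (idSimplex m) = _
    rw [e', fib_app_map, e]
  · funext m k f θ s
    change (family (g.app m ((yonedaEquiv.symm y).app m θ))).act f (idSimplex m) s = _
    rw [e', act_app_map, e]

lemma ofFamily_toFamily (g : Y ⟶ fibrationUniverse S) (hg : kanFibrations (toFamily g).proj) :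
    ofFamily (toFamily g) hg = g := by
  ext n y
  exact Subtype.ext (pullback_toFamily g y)

lemma kanFibrations_toFamily (g : Y ⟶ fibrationUniverse S) :
    kanFibrations (toFamily g).proj := by
  refine kanFibrations_of_forall_stdSimplex fun n y =>
    ⟨_, _, _, (toFamily g).isPullback y, ?_⟩
  rw [← Equiv.symm_apply_apply yonedaEquiv y, pullback_toFamily]
  exact (g.app _ _ : {F : Family S (SSet.stdSimplex.obj _) // kanFibrations F.proj}).2

end fibrationUniverse

/-! ### Extending Kan fibrations along anodyne extensions -/

/-- The simplex of the total space given by a point of a fibre. -/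
def Family.elem {S : Type u} {Y : SSet.{u}} (F : Family S Y) {n : SimplexCategoryᵒᵖ} (y : Y.obj n)
    (s : S) (hs : s ∈ F.fib y) : F.total.obj n :=
  (⟨(y, s), hs⟩ : {x : Y.obj n × S // x.2 ∈ F.fib x.1})

/-- A simplicial set over `Y`, with simplices in each degree embedded in `S`, is isomorphic to a
family with fibres in `S`, which may be prescribed over a subcomplex. -/
lemma Family.exists_of_isPullback {S : Type u} {A X Y : SSet.{u}} {i : A ⟶ Y} [Mono i]
    (F₀ : Family S A) {p : X ⟶ Y} {t : F₀.total ⟶ X} (sq : IsPullback t F₀.proj p i)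
    (inj : ∀ n, X.obj n ↪ S) :
    ∃ F : Family S Y, F.pullback i = F₀ ∧ ∃ e : X ≅ F.total, e.hom ≫ F.proj = p := by
  classical
  have : Mono t := Mono.of_isPullback sq
  have ht {n} {x y : F₀.total.obj n} (h : t.app n x = t.app n y) : x = y := injective_app t n h
  have hi {n} {x y : A.obj n} (h : i.app n x = i.app n y) : x = y := injective_app i n h
  let coord {n} (z : F₀.total.obj n) : S := (Subtype.val z).2
  -- An encoding of the simplices of `X`, injective on each fibre.
  let enc {n} (x : X.obj n) : S :=
    if h : ∃ z : F₀.total.obj n, t.app n z = x then coord h.choose else inj n x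
  have enc_t {n} (z : F₀.total.obj n) : enc (t.app n z) = coord z := by
    have h : ∃ z' : F₀.total.obj n, t.app n z' = t.app n z := ⟨z, rfl⟩
    have e : h.choose = z := ht h.choose_spec
    exact (dif_pos h).trans (by rw [e])
  have proj_t {n} (z : F₀.total.obj n) : p.app n (t.app n z) = i.app n (F₀.proj.app n z) :=
    congr_app sq.w z
  have exists_t {n} (x : X.obj n) (a : A.obj n) (h : p.app n x = i.app n a) :
      ∃ (s : S) (hs : s ∈ F₀.fib a), t.app n (F₀.elem a s hs) = x := by
    obtain ⟨z, hz, hz'⟩ := Types.exists_of_isPullback (sq.map ((evaluation _ _).obj n)) x a h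
    obtain ⟨⟨a', s⟩, hs⟩ := z
    obtain rfl : a' = a := hz'
    exact ⟨s, hs, hz⟩
  have enc_inj {n} (x y : X.obj n) (h : p.app n x = p.app n y) (h' : enc x = enc y) : x = y := by
    by_cases hx : ∃ a, i.app n a = p.app n x
    · obtain ⟨a, ha⟩ := hx
      obtain ⟨s, hs, rfl⟩ := exists_t x a ha.symm
      obtain ⟨s', hs', rfl⟩ := exists_t y a (ha.trans h).symm
      rw [enc_t, enc_t] at h'
      obtain rfl : s = s' := h'
      rfl
    · have hx' {z} : t.app n z ≠ x := fun e => hx ⟨F₀.proj.app n z, by rw [← e, proj_t]⟩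
      have hy' {z} : t.app n z ≠ y := fun e => hx ⟨F₀.proj.app n z, by rw [h, ← e, proj_t]⟩
      have e₁ : enc x = inj n x := dif_neg fun ⟨z, hz⟩ => hx' hz
      have e₂ : enc y = inj n y := dif_neg fun ⟨z, hz⟩ => hy' hz
      rw [e₁, e₂] at h'
      exact (inj n).injective h'
  let act {n m : SimplexCategoryᵒᵖ} (f : n ⟶ m) (y : Y.obj n) (s : S) : S :=
    if h : ∃ a, i.app n a = y then F₀.act f h.choose s else
      if h : ∃ x, p.app n x = y ∧ enc x = s then enc (X.map f h.choose) else s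
  have act_i {n m} (f : n ⟶ m) (a : A.obj n) (s : S) : act f (i.app n a) s = F₀.act f a s := by
    have h : ∃ a', i.app n a' = i.app n a := ⟨a, rfl⟩
    have e : h.choose = a := hi h.choose_spec
    exact (dif_pos h).trans (by rw [e])
  have act_enc {n m} (f : n ⟶ m) (x : X.obj n) : act f (p.app n x) (enc x) = enc (X.map f x) := by
    by_cases hx : ∃ a, i.app n a = p.app n x
    · obtain ⟨a, ha⟩ := hx
      obtain ⟨s, hs, rfl⟩ := exists_t x a ha.symm
      rw [← ha, act_i, enc_t, ← app_map, enc_t]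
      rfl
    · have h : ∃ x', p.app n x' = p.app n x ∧ enc x' = enc x := ⟨x, rfl, rfl⟩
      have e : h.choose = x := enc_inj _ _ h.choose_spec.1 h.choose_spec.2
      exact (dif_neg hx).trans ((dif_pos h).trans (by rw [e]))
  let F : Family S Y :=
    { fib {n} y := {s | ∃ x, p.app n x = y ∧ enc x = s}
      act f y s := act f y s
      act_mem f y s := by
        rintro ⟨x, rfl, rfl⟩
        exact ⟨X.map f x, app_map _ _ _, (act_enc f x).symm⟩
      act_id y s := by
        rintro ⟨x, rfl, rfl⟩
        rw [act_enc, map_id_apply]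
      act_comp f g y s := by
        rintro ⟨x, rfl, rfl⟩
        rw [act_enc, act_enc, ← app_map, act_enc, map_map_apply] }
  refine ⟨F, ?_, ?_⟩
  · apply Family.ext
    · funext n a
      ext s
      constructor
      · rintro ⟨x, hx, rfl⟩
        obtain ⟨s, hs, rfl⟩ := exists_t x a hx
        rw [enc_t]
        exact hs
      · intro hs
        exact ⟨t.app n (F₀.elem a s hs), proj_t _, enc_t _⟩
    · funext n m f a s
      exact act_i f a s
  · let e : X ⟶ F.total :=
      { app n := TypeCat.ofHom fun x => ⟨(p.app n x, enc x), x, rfl, rfl⟩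
        naturality n m f := by
          apply ConcreteCategory.hom_ext
          intro x
          exact Subtype.ext (Prod.ext (app_map p f x) (act_enc f x).symm) }
    have : IsIso e := by
      rw [NatTrans.isIso_iff_isIso_app]
      intro n
      rw [isIso_iff_bijective]
      constructor
      · intro x y hxy
        exact enc_inj x y (congrArg (fun z => (Subtype.val z).1) hxy)
          (congrArg (fun z => (Subtype.val z).2) hxy)
      · rintro ⟨⟨y, s⟩, x, hx, hx'⟩
        exact ⟨x, Subtype.ext (Prod.ext hx hx')⟩
    exact ⟨asIso e, rfl⟩

lemma kanFibrations_proj_of_iso {S : Type u} {X Y : SSet.{u}} {F : Family S Y} {p : X ⟶ Y}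
    (hp : kanFibrations p) (e : X ≅ F.total) (he : e.hom ≫ F.proj = p) : kanFibrations F.proj :=
  (modelCategoryQuillen.J.rlp.arrow_mk_iso_iff (Arrow.isoMk e (Iso.refl _) (by
    rw [Iso.refl_hom, Category.comp_id]
    exact he))).1 hp

/-- The universe is a Kan complex, because Kan fibrations extend over horns without an increase of
the cardinality of the fibres. -/
instance kanComplex_fibrationUniverse (S : Type u) [Infinite S] :
    KanComplex (fibrationUniverse S) := by
  rw [kanComplex_iff, kanFibrations_iff]
  intro n k
  refine ⟨fun {g _} _ => ?_⟩
  obtain ⟨E', p', t, hp', sq⟩ :=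
    (fibrationUniverse.kanFibrations_toFamily g).exists_extension_horn
  have : Mono t := Mono.of_isPullback sq
  -- Replace the extension by a subfibration of cardinality at most that of `S`.
  have hS : Cardinal.aleph0 ≤ Cardinal.mk S := Cardinal.aleph0_le_mk S
  obtain ⟨D, hD, hD', hD''⟩ := hp'.exists_small (Subcomplex.range t) (Cardinal.mk S) hS (by
    let F := fibrationUniverse.toFamily g
    let f₁ : (Σ m, F.total.obj m) → Σ m, (Subcomplex.range t).obj m :=
      fun x => ⟨x.1, t.app _ x.2, x.2, rfl⟩
    have h₁ : Function.Surjective f₁ := by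
      rintro ⟨m, _, x, rfl⟩
      exact ⟨⟨m, x⟩, rfl⟩
    let f₂ : (Σ m, F.total.obj m) → (Σ m, Λ[n + 1, k].obj m) × S :=
      fun x => (⟨x.1, F.proj.app _ x.2⟩, (Subtype.val x.2).2)
    have h₂ : Function.Injective f₂ := by
      rintro ⟨m, ⟨x, s⟩, h⟩ ⟨m', ⟨x', s'⟩, h'⟩ e
      cases e
      rfl
    refine (Cardinal.mk_le_of_surjective h₁).trans ((Cardinal.mk_le_of_injective h₂).trans ?_)
    rw [Cardinal.mk_prod, Cardinal.lift_id, Cardinal.lift_id]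
    refine (mul_le_mul' (Cardinal.mk_le_aleph0.trans hS) le_rfl).trans ?_
    rw [Cardinal.mul_eq_self hS])
  have inj (m) : Nonempty (D.toSSet.obj m ↪ S) := by
    rw [← Cardinal.le_def]
    exact (Cardinal.mk_le_of_injective (f := fun x : D.obj m => (⟨m, x⟩ : Σ m, D.obj m))
      (sigma_mk_injective (β := fun m => D.obj m))).trans hD''
  let t' : _ ⟶ (D : SSet.{u}) := Subcomplex.lift t hD
  have sq' : IsPullback t' (fibrationUniverse.toFamily g).proj (D.ι ≫ p') Λ[n + 1, k].ι := by
    refine ⟨⟨sq.w⟩, ⟨PullbackCone.IsLimit.mk _ (fun c => sq.lift (c.fst ≫ D.ι) c.snd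
      ((Category.assoc _ _ _).trans c.condition)) (fun c => ?_) (fun c => sq.lift_snd _ _ _)
      (fun c m h₁ h₂ => ?_)⟩⟩
    · rw [← cancel_mono D.ι, Category.assoc]
      exact sq.lift_fst _ _ _
    · apply sq.hom_ext
      · rw [sq.lift_fst, ← h₁]
        rfl
      · rw [sq.lift_snd, h₂]
  obtain ⟨F, hF, e, he⟩ := Family.exists_of_isPullback _ sq' fun m => (inj m).some
  have hF' := kanFibrations_proj_of_iso hD' e he
  refine ⟨⟨⟨fibrationUniverse.ofFamily F hF', ?_, Subsingleton.elim _ _⟩⟩⟩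
  rw [fibrationUniverse.comp_ofFamily]
  simp only [hF]
  exact fibrationUniverse.ofFamily_toFamily _ _

/-- A Kan fibration extends along an anodyne extension of its base. -/
lemma kanFibrations.exists_extension {X Y Y' : SSet.{u}} {p : X ⟶ Y} (hp : kanFibrations p)
    {j : Y ⟶ Y'} (hj : anodyneExtensions j) :
    ∃ (X' : SSet.{u}) (p' : X' ⟶ Y') (t : X ⟶ X'), kanFibrations p' ∧ IsPullback t p p' j := by
  -- All simplices of `X` embed in `S`, which is made infinite for the universe to be Kan.
  let S := (Σ n, X.obj n) ⊕ ULift.{u} ℕ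
  -- Extending the family over the empty subcomplex turns `X` into a family over `Y`.
  let F₀ : Family S ((⊥ : Y.Subcomplex) : SSet.{u}) :=
    { fib _ := ∅
      act _ _ s := s
      act_mem _ _ _ h := h
      act_id _ _ _ := rfl
      act_comp _ _ _ _ _ := rfl }
  have hF₀ (n) : IsEmpty (F₀.total.obj n) := ⟨fun x => Subtype.property x⟩
  let t : F₀.total ⟶ X :=
    { app n := TypeCat.ofHom fun x => ((hF₀ n).false x).elim
      naturality n m f := by
        apply ConcreteCategory.hom_ext
        intro x
        exact ((hF₀ n).false x).elim }
  have sq : IsPullback t F₀.proj p (⊥ : Y.Subcomplex).ι :=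
    { w := by
        ext n x
        exact ((hF₀ n).false x).elim
      isLimit' := ⟨PullbackCone.IsLimit.mk _ (fun c =>
        { app n := TypeCat.ofHom fun x => (Subtype.property (c.snd.app n x) : False).elim
          naturality n m f := by
            apply ConcreteCategory.hom_ext
            intro x
            exact (Subtype.property (c.snd.app n x) : False).elim })
        (fun c => by ext n x; exact (Subtype.property (c.snd.app n x) : False).elim)
        (fun c => by ext n x; exact (Subtype.property (c.snd.app n x) : False).elim)
        (fun c m _ _ => by ext n x; exact (Subtype.property (c.snd.app n x) : False).elim)⟩ }
  obtain ⟨F, -, e, he⟩ := F₀.exists_of_isPullback sq fun n =>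
    ⟨fun x => Sum.inl ⟨n, x⟩, Sum.inl_injective.comp (sigma_mk_injective (β := fun n => X.obj n))⟩
  have hF := kanFibrations_proj_of_iso hp e he
  obtain ⟨g, hg⟩ := hj.exists_extension _ (fibrationUniverse.ofFamily F hF)
  have hF' : (fibrationUniverse.toFamily g).pullback j = F := by
    rw [← fibrationUniverse.toFamily_comp, hg, fibrationUniverse.toFamily_ofFamily]
  have key {G : Family S Y} (hG : G = F) {Z : SSet.{u}} {r : Z ⟶ Y'} {m : G.total ⟶ Z}
      (sq : IsPullback m G.proj r j) : ∃ t, IsPullback t p r j := by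
    subst hG
    have : IsPullback e.hom p G.proj (𝟙 _) := IsPullback.of_horiz_isIso ⟨by simp [he]⟩
    have := this.paste_horiz sq
    rw [Category.id_comp] at this
    exact ⟨_, this⟩
  obtain ⟨t, ht⟩ := key hF' ((fibrationUniverse.toFamily g).isPullback j)
  exact ⟨_, _, t, fibrationUniverse.kanFibrations_toFamily g, ht⟩

/-- A Kan fibration which is a weak homotopy equivalence is a trivial fibration. -/
lemma trivialKanFibrations_iff {X Y : SSet.{u}} (p : X ⟶ Y) :
    trivialKanFibrations p ↔ kanFibrations p ∧ weakHomotopyEquivalences p := by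
  refine ⟨fun hp => ⟨trivialKanFibrations_le_kanFibrations _ hp,
    trivialKanFibrations_le_weakHomotopyEquivalences _ hp⟩, fun ⟨hp, hw⟩ => ?_⟩
  -- Extend `p` over a fibrant replacement of its base.
  obtain ⟨Y', j, hj, hY'⟩ : ∃ (Y' : SSet.{u}) (j : Y ⟶ Y'), anodyneExtensions j ∧
      KanComplex Y' := by
    let h := MorphismProperty.factorizationData modelCategoryQuillen.J.rlp.llp
      modelCategoryQuillen.J.rlp (terminal.from Y)
    refine ⟨h.Z, h.i, h.hi, (kanComplex_iff _).2 ?_⟩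
    rw [Subsingleton.elim (terminal.from h.Z) h.p]
    exact h.hp
  obtain ⟨X', p', t, hp', sq⟩ := hp.exists_extension hj
  have ht := hj.of_isPullback hp' sq
  refine trivialKanFibrations.of_isPullback (hp'.trivialKanFibrations_of_kanComplex ?_) sq
  refine weakHomotopyEquivalences.of_precomp t p'
    (anodyneExtensions_le_weakHomotopyEquivalences _ ht) ?_
  rw [sq.w]
  exact weakHomotopyEquivalences.comp_mem _ _ hw
    (anodyneExtensions_le_weakHomotopyEquivalences _ hj)

/-! ### Bimodules over a simplicial monoid as functors to sets -/

/-- In each degree, a monoid object in simplicial sets is a monoid. -/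
noncomputable instance monoidObj (R : Mon SSet.{u}) (n : SimplexCategoryᵒᵖ) :
    Monoid (R.X.obj n) where
  one := (MonObj.one (X := R.X)).app n PUnit.unit
  mul a b := (MonObj.mul (X := R.X)).app n (a, b)
  one_mul a := congr_app (MonObj.one_mul R.X) (n := n) (PUnit.unit, a)
  mul_one a := congr_app (MonObj.mul_one R.X) (n := n) (a, PUnit.unit)
  mul_assoc a b c := congr_app (MonObj.mul_assoc R.X) (n := n) ((a, b), c)

section

variable {R : Mon SSet.{u}} {n m : SimplexCategoryᵒᵖ}

lemma map_one_obj (θ : n ⟶ m) : R.X.map θ (1 : R.X.obj n) = 1 :=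
  (app_map (MonObj.one (X := R.X)) θ PUnit.unit).symm

lemma map_mul_obj (θ : n ⟶ m) (a b : R.X.obj n) :
    R.X.map θ (a * b) = R.X.map θ a * R.X.map θ b :=
  (app_map (MonObj.mul (X := R.X)) θ (a, b)).symm

variable (M : Bimod R R)

/-- The left action of a simplex of the monoid on a simplex of a bimodule. -/
def lact (a : R.X.obj n) (x : M.X.obj n) : M.X.obj n := M.actLeft.app n (a, x)

/-- The right action of a simplex of the monoid on a simplex of a bimodule. -/
def ract (x : M.X.obj n) (b : R.X.obj n) : M.X.obj n := M.actRight.app n (x, b)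

lemma one_lact (x : M.X.obj n) : lact M 1 x = x :=
  congr_app M.one_actLeft (n := n) (PUnit.unit, x)

lemma ract_one (x : M.X.obj n) : ract M x 1 = x :=
  congr_app M.actRight_one (n := n) (x, PUnit.unit)

lemma mul_lact (a b : R.X.obj n) (x : M.X.obj n) : lact M (a * b) x = lact M a (lact M b x) :=
  congr_app M.left_assoc (n := n) ((a, b), x)

lemma ract_mul (x : M.X.obj n) (a b : R.X.obj n) : ract M x (a * b) = ract M (ract M x a) b :=
  congr_app M.right_assoc (n := n) (x, (a, b))

lemma ract_lact (a : R.X.obj n) (x : M.X.obj n) (b : R.X.obj n) :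
    ract M (lact M a x) b = lact M a (ract M x b) :=
  congr_app M.middle_assoc (n := n) ((a, x), b)

lemma map_lact (θ : n ⟶ m) (a : R.X.obj n) (x : M.X.obj n) :
    M.X.map θ (lact M a x) = lact M (R.X.map θ a) (M.X.map θ x) :=
  (app_map M.actLeft θ (a, x)).symm

lemma map_ract (θ : n ⟶ m) (x : M.X.obj n) (a : R.X.obj n) :
    M.X.map θ (ract M x a) = ract M (M.X.map θ x) (R.X.map θ a) :=
  (app_map M.actRight θ (x, a)).symm

variable {M} {N : Bimod R R}

lemma hom_lact (f : M ⟶ N) (a : R.X.obj n) (x : M.X.obj n) :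
    f.hom.app n (lact M a x) = lact N a (f.hom.app n x) :=
  congr_app (Bimod.Hom.left_act_hom f) (n := n) (a, x)

lemma hom_ract (f : M ⟶ N) (x : M.X.obj n) (a : R.X.obj n) :
    f.hom.app n (ract M x a) = ract N (f.hom.app n x) a :=
  congr_app (Bimod.Hom.right_act_hom f) (n := n) (x, a)

end

/-- The category of operators on bimodules over a simplicial monoid `R`: its objects are the
degrees of simplices, and a map `n ⟶ m` is a simplicial operator followed by the left action and
the right action of two simplices of `R` of degree `m`. -/
structure Operators (R : Mon SSet.{u}) where
  /-- The degree. -/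
  deg : SimplexCategoryᵒᵖ

namespace Operators

variable {R : Mon SSet.{u}}

/-- The maps in the category of operators. -/
@[ext]
structure Hom (n m : Operators R) where
  /-- The simplicial operator. -/
  degMap : n.deg ⟶ m.deg
  /-- The simplex which acts from the left. -/
  left : R.X.obj m.deg
  /-- The simplex which acts from the right. -/
  right : R.X.obj m.deg

noncomputable instance : Category.{u} (Operators R) where
  Hom := Hom
  id n := ⟨𝟙 n.deg, 1, 1⟩
  comp f g := ⟨f.degMap ≫ g.degMap, g.left * R.X.map g.degMap f.left,
    R.X.map g.degMap f.right * g.right⟩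
  id_comp f := Hom.ext (Category.id_comp _)
    ((congrArg (f.left * ·) (map_one_obj f.degMap)).trans (mul_one _))
    ((congrArg (· * f.right) (map_one_obj f.degMap)).trans (one_mul _))
  comp_id _ := Hom.ext (Category.comp_id _)
    ((one_mul _).trans (map_id_apply _ _)) ((mul_one _).trans (map_id_apply _ _))
  assoc _ _ h := Hom.ext (Category.assoc _ _ _)
    ((congrArg (h.left * ·) ((map_mul_obj h.degMap _ _).trans
      (congrArg (_ * ·) (map_map_apply _ _ _ _)))).trans (mul_assoc _ _ _).symm)
    ((congrArg (· * h.right) ((map_mul_obj h.degMap _ _).trans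
      (congrArg (· * _) (map_map_apply _ _ _ _)))).trans (mul_assoc _ _ _))

/-- The inclusion of the simplicial operators. -/
noncomputable def ofSimplicial (R : Mon SSet.{u}) : SimplexCategoryᵒᵖ ⥤ Operators R where
  obj n := ⟨n⟩
  map θ := ⟨θ, 1, 1⟩
  map_id _ := rfl
  map_comp _ g := Hom.ext rfl
    ((congrArg (_ * ·) (map_one_obj g)).trans (mul_one _)).symm
    ((congrArg (· * _) (map_one_obj g)).trans (mul_one _)).symm

/-- The functor on operators given by a bimodule. -/
noncomputable def functorOfBimod (M : Bimod R R) : Operators R ⥤ Type u where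
  obj n := M.X.obj n.deg
  map f := TypeCat.ofHom fun x => ract M (lact M f.left (M.X.map f.degMap x)) f.right
  map_id n := by
    ext x
    exact (ract_one M _).trans ((one_lact M _).trans (map_id_apply M.X x))
  map_comp f g := by
    ext x
    change ract M (lact M (g.left * R.X.map g.degMap f.left) (M.X.map (f.degMap ≫ g.degMap) x))
        (R.X.map g.degMap f.right * g.right) =
      ract M (lact M g.left (M.X.map g.degMap
          (ract M (lact M f.left (M.X.map f.degMap x)) f.right)))
        g.right
    rw [map_ract, map_lact, map_map_apply, ract_mul, mul_lact]
    simp only [ract_lact]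

/-- Bimodules as functors on operators. -/
noncomputable def bimodFunctor (R : Mon SSet.{u}) : Bimod R R ⥤ Operators R ⥤ Type u where
  obj M := functorOfBimod M
  map {M N} f :=
    { app n := f.hom.app n.deg
      naturality n m g := by
        ext x
        change f.hom.app _ (ract M (lact M g.left (M.X.map g.degMap x)) g.right) =
          ract N (lact N g.left (N.X.map g.degMap (f.hom.app _ x))) g.right
        exact ((hom_ract f _ _).trans (congrArg (ract N · g.right) ((hom_lact f _ _).trans
          (congrArg (lact N g.left) (app_map f.hom g.degMap x))))) }

instance : (bimodFunctor R).Faithful where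
  map_injective {M N f g} h := by
    apply Bimod.hom_ext
    ext n x
    exact ConcreteCategory.congr_hom (NatTrans.congr_app h (⟨n⟩ : Operators R)) x

instance : (bimodFunctor R).Full where
  map_surjective {M N} φ := by
    have key {n m : Operators R} (f : n ⟶ m) (x : M.X.obj n.deg) :
        φ.app m (ract M (lact M f.left (M.X.map f.degMap x)) f.right) =
          ract N (lact N f.left (N.X.map f.degMap (φ.app n x))) f.right :=
      NatTrans.naturality_apply φ f x
    refine ⟨{
      hom := { app n := φ.app ⟨n⟩, naturality n m θ := ?_ }
      left_act_hom := ?_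
      right_act_hom := ?_ }, rfl⟩
    · ext x
      have h := key (n := ⟨n⟩) (m := ⟨m⟩) ⟨θ, 1, 1⟩ x
      simp only [ract_one, one_lact] at h
      exact h
    · ext n ⟨a, x⟩
      have h := key (n := ⟨n⟩) (m := ⟨n⟩) ⟨𝟙 n, a, 1⟩ x
      simp only [ract_one, map_id_apply] at h
      exact h.trans (congrArg (lact N a) (map_id_apply N.X _))
    · ext n ⟨x, a⟩
      have h := key (n := ⟨n⟩) (m := ⟨n⟩) ⟨𝟙 n, 1, a⟩ x
      simp only [one_lact, map_id_apply] at h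
      exact h.trans (congrArg (ract N · a) (map_id_apply N.X _))

/-- The left action of a simplex of the monoid, as an operator. -/
noncomputable def leftOp {n : SimplexCategoryᵒᵖ} (a : R.X.obj n) :
    (⟨n⟩ : Operators R) ⟶ ⟨n⟩ := ⟨𝟙 n, a, 1⟩

/-- The right action of a simplex of the monoid, as an operator. -/
noncomputable def rightOp {n : SimplexCategoryᵒᵖ} (a : R.X.obj n) :
    (⟨n⟩ : Operators R) ⟶ ⟨n⟩ := ⟨𝟙 n, 1, a⟩

section

variable {n m : SimplexCategoryᵒᵖ}

lemma leftOp_mul (a b : R.X.obj n) : leftOp (a * b) = leftOp b ≫ leftOp a :=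
  Hom.ext (Category.comp_id _).symm (congrArg (a * ·) (map_id_apply R.X b)).symm
    ((congrArg (· * 1) (map_id_apply R.X 1)).trans (mul_one _)).symm

lemma rightOp_mul (a b : R.X.obj n) : rightOp (a * b) = rightOp a ≫ rightOp b :=
  Hom.ext (Category.comp_id _).symm ((congrArg (1 * ·) (map_id_apply R.X 1)).trans (mul_one _)).symm
    (congrArg (· * b) (map_id_apply R.X a)).symm

lemma leftOp_rightOp (a b : R.X.obj n) : leftOp a ≫ rightOp b = ⟨𝟙 n, a, b⟩ :=
  Hom.ext (Category.comp_id _) ((one_mul _).trans (map_id_apply R.X a))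
    ((congrArg (· * b) (map_id_apply R.X 1)).trans (one_mul b))

lemma rightOp_leftOp (a b : R.X.obj n) : rightOp b ≫ leftOp a = ⟨𝟙 n, a, b⟩ :=
  Hom.ext (Category.comp_id _) ((congrArg (a * ·) (map_id_apply R.X 1)).trans (mul_one a))
    ((mul_one _).trans (map_id_apply R.X b))

lemma ofSimplicial_map_comp (θ : n ⟶ m) (a b : R.X.obj m) :
    (ofSimplicial R).map θ ≫ (⟨𝟙 m, a, b⟩ : (⟨m⟩ : Operators R) ⟶ ⟨m⟩) = ⟨θ, a, b⟩ :=
  Hom.ext (Category.comp_id _) ((congrArg (a * ·) (map_id_apply R.X 1)).trans (mul_one a))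
    ((congrArg (· * b) (map_id_apply R.X 1)).trans (one_mul b))

lemma leftOp_comp_ofSimplicial_map (θ : n ⟶ m) (a : R.X.obj n) :
    leftOp a ≫ (ofSimplicial R).map θ = (ofSimplicial R).map θ ≫ leftOp (R.X.map θ a) :=
  (Hom.ext (Category.id_comp _) (one_mul _)
    ((mul_one _).trans (map_one_obj θ)) :
      _ = (⟨θ, R.X.map θ a, 1⟩ : (⟨n⟩ : Operators R) ⟶ ⟨m⟩)).trans
    (ofSimplicial_map_comp θ _ _).symm

lemma rightOp_comp_ofSimplicial_map (θ : n ⟶ m) (a : R.X.obj n) :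
    rightOp a ≫ (ofSimplicial R).map θ = (ofSimplicial R).map θ ≫ rightOp (R.X.map θ a) :=
  (Hom.ext (Category.id_comp _) ((one_mul _).trans (map_one_obj θ))
    (mul_one _) : _ = (⟨θ, 1, R.X.map θ a⟩ : (⟨n⟩ : Operators R) ⟶ ⟨m⟩)).trans
    (ofSimplicial_map_comp θ _ _).symm

end

section

variable (F : Operators R ⥤ Type u) {n m k l : Operators R}

lemma map_comp_apply {f : n ⟶ m} {g : m ⟶ k} {h : n ⟶ k} (e : h = f ≫ g) (x : F.obj n) :
    F.map h x = F.map g (F.map f x) := by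
  rw [e, F.map_comp]
  rfl

lemma map_comm_apply {f : n ⟶ m} {g : m ⟶ k} {f' : n ⟶ l} {g' : l ⟶ k} (e : f ≫ g = f' ≫ g')
    (x : F.obj n) : F.map g (F.map f x) = F.map g' (F.map f' x) :=
  (map_comp_apply F rfl x).symm.trans (map_comp_apply F e x)

end

/-- The bimodule given by a functor on operators. -/
noncomputable def bimodOfFunctor (F : Operators R ⥤ Type u) : Bimod R R where
  X := ofSimplicial R ⋙ F
  actLeft :=
    { app n := TypeCat.ofHom fun x : R.X.obj n × F.obj ⟨n⟩ => F.map (leftOp x.1) x.2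
      naturality n m θ := by
        ext ⟨a, x⟩
        exact (map_comm_apply F (leftOp_comp_ofSimplicial_map θ a) x).symm }
  actRight :=
    { app n := TypeCat.ofHom fun x : F.obj ⟨n⟩ × R.X.obj n => F.map (rightOp x.2) x.1
      naturality n m θ := by
        ext ⟨x, a⟩
        exact (map_comm_apply F (rightOp_comp_ofSimplicial_map θ a) x).symm }
  one_actLeft := by
    ext n ⟨_, x⟩
    exact ConcreteCategory.congr_hom (F.map_id _) x
  left_assoc := by
    ext n ⟨⟨a, b⟩, x⟩
    exact map_comp_apply F (leftOp_mul a b) x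
  actRight_one := by
    ext n ⟨x, _⟩
    exact ConcreteCategory.congr_hom (F.map_id _) x
  right_assoc := by
    ext n ⟨x, ⟨a, b⟩⟩
    exact map_comp_apply F (rightOp_mul a b) x
  middle_assoc := by
    ext n ⟨⟨a, x⟩, b⟩
    exact map_comm_apply F ((leftOp_rightOp a b).trans (rightOp_leftOp a b).symm) x

instance : (bimodFunctor R).EssSurj where
  mem_essImage F := ⟨bimodOfFunctor F, ⟨NatIso.ofComponents (fun n => Iso.refl _) (by
    intro n m f
    ext x
    exact ((map_comp_apply F (ofSimplicial_map_comp f.degMap f.left f.right).symm x).trans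
      (map_comp_apply F (leftOp_rightOp f.left f.right).symm _)).symm)⟩⟩

instance : (bimodFunctor R).IsEquivalence where

/-- Restriction to the simplicial operators corresponds to forgetting the actions. -/
noncomputable def bimodFunctorCompRestriction (R : Mon SSet.{u}) :
    bimodFunctor R ⋙ (Functor.whiskeringLeft _ _ (Type u)).obj (ofSimplicial R) ≅
      Bimod.forget R :=
  NatIso.ofComponents (fun M => NatIso.ofComponents (fun n => Iso.refl _) (by
    intro n m θ
    ext x
    exact (ract_one M _).trans (one_lact M _))) (by intros; rfl)

end Operators

section

variable (R : Mon SSet.{u})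

instance : HasLimits (Bimod R R) :=
  Adjunction.has_limits_of_equivalence (Operators.bimodFunctor R)

instance : HasColimits (Bimod R R) :=
  Adjunction.has_colimits_of_equivalence (Operators.bimodFunctor R)

instance : (Bimod.forget R : Bimod R R ⥤ _).IsLeftAdjoint :=
  have : ((Functor.whiskeringLeft _ _ (Type u)).obj (Operators.ofSimplicial R)).IsLeftAdjoint :=
    ((Operators.ofSimplicial R).ranAdjunction (Type u)).isLeftAdjoint
  Functor.isLeftAdjoint_of_iso (Operators.bimodFunctorCompRestriction R)

instance : (Bimod.forget R : Bimod R R ⥤ _).ReflectsIsomorphisms where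
  reflects {M N} f hf := by
    let e := Bimod.isoOfIso (@asIso _ _ _ _ _ hf) f.left_act_hom f.right_act_hom
    exact inferInstanceAs (IsIso e.hom)

/-- Every functor out of the category of bimodules which preserves colimits is a left adjoint. -/
lemma isLeftAdjoint_of_preservesColimits {R : Mon SSet.{u}} {D : Type w} [Category.{u} D]
    [HasColimits D] (L : Bimod R R ⥤ D) [PreservesColimits L] : L.IsLeftAdjoint := by
  let L' := (Operators.bimodFunctor R).inv ⋙ L
  have : PreservesColimits L' := inferInstance
  have : L'.IsLeftAdjoint := Presheaf.isLeftAdjoint_of_preservesColimits.{0} L'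
  have : (Operators.bimodFunctor R ⋙ L').IsLeftAdjoint := inferInstance
  exact Functor.isLeftAdjoint_of_iso (F := Operators.bimodFunctor R ⋙ L')
    (Functor.isoWhiskerRight (Operators.bimodFunctor R).asEquivalence.unitIso.symm L)

end

/-! ### Free bimodules -/

lemma ext_apply {X Y : SSet.{u}} {f g : X ⟶ Y} (h : ∀ n x, f.app n x = g.app n x) : f = g := by
  ext n x
  exact h n x

section

variable (R : Mon SSet.{u})

/-- The free bimodule `R ⊗ (K ⊗ R)` on a simplicial set `K`. -/
noncomputable def freeBimod : SSet.{u} ⥤ Bimod R R where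
  obj K :=
    { X := R.X ⊗ (K ⊗ R.X)
      actLeft := (α_ R.X R.X (K ⊗ R.X)).inv ≫ MonObj.mul (X := R.X) ▷ _
      actRight := (α_ _ _ _).hom ≫ R.X ◁ ((α_ _ _ _).hom ≫ K ◁ MonObj.mul (X := R.X))
      one_actLeft := ext_apply fun n ⟨_, a, k, b⟩ =>
        congrArg (fun z : R.X.obj n => (z, k, b)) (one_mul a)
      left_assoc := ext_apply fun n ⟨⟨c, d⟩, a, k, b⟩ =>
        congrArg (fun z : R.X.obj n => (z, k, b)) (mul_assoc c d a)
      actRight_one := ext_apply fun n ⟨⟨a, k, b⟩, _⟩ =>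
        congrArg (fun z : R.X.obj n => (a, k, z)) (mul_one b)
      right_assoc := ext_apply fun n ⟨⟨a, k, b⟩, ⟨c, d⟩⟩ =>
        congrArg (fun z : R.X.obj n => (a, k, z)) (mul_assoc b c d).symm
      middle_assoc := rfl }
  map f :=
    { hom := R.X ◁ (f ▷ R.X) }

variable {R}

lemma freeBimod_ext {K : SSet.{u}} {M : Bimod R R} {f g : (freeBimod R).obj K ⟶ M}
    (h : ∀ (n : SimplexCategoryᵒᵖ) (k : K.obj n),
      f.hom.app n ((1 : R.X.obj n), k, (1 : R.X.obj n)) =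
        g.hom.app n ((1 : R.X.obj n), k, (1 : R.X.obj n))) : f = g := by
  apply Bimod.hom_ext
  ext n ⟨a, k, b⟩
  have e : lact ((freeBimod R).obj K) a (ract ((freeBimod R).obj K)
      ((1 : R.X.obj n), k, (1 : R.X.obj n)) b) = (a, k, b) :=
    Prod.ext (mul_one a) (Prod.ext rfl (one_mul b))
  have key (f : (freeBimod R).obj K ⟶ M) : f.hom.app n (a, k, b) =
      lact M a (ract M (f.hom.app n ((1 : R.X.obj n), k, (1 : R.X.obj n))) b) :=
    (congrArg (f.hom.app n) e.symm).trans
      ((hom_lact f _ _).trans (congrArg (lact M a) (hom_ract f _ _)))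
  exact (key f).trans ((congrArg (fun z => lact M a (ract M z b)) (h n k)).trans (key g).symm)

/-- The map out of a free bimodule which extends a map of simplicial sets. -/
noncomputable def freeBimodDesc {K : SSet.{u}} {M : Bimod R R} (g : K ⟶ M.X) :
    (freeBimod R).obj K ⟶ M where
  hom := R.X ◁ (g ▷ R.X ≫ M.actRight) ≫ M.actLeft
  left_act_hom := by
    ext n ⟨c, a, k, b⟩
    exact mul_lact M c a _
  right_act_hom := by
    ext n ⟨⟨a, k, b⟩, c⟩
    exact (congrArg (lact M a) (ract_mul M (g.app n k) b c)).trans (ract_lact M _ _ _).symm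

/-- The inclusion of a simplicial set in the free bimodule. -/
noncomputable def freeBimodUnit (K : SSet.{u}) : K ⟶ ((freeBimod R).obj K).X where
  app n := TypeCat.ofHom fun k => ((1 : R.X.obj n), k, (1 : R.X.obj n))
  naturality n m θ := by
    ext k
    exact congrArg₂ (fun z w : R.X.obj m => (z, K.map θ k, w)) (map_one_obj θ).symm
      (map_one_obj θ).symm

variable (R) in
/-- The free bimodule functor is left adjoint to the forgetful functor. -/
noncomputable def freeBimodAdjunction : freeBimod R ⊣ Bimod.forget R :=
  Adjunction.mkOfHomEquiv
    { homEquiv K M :=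
        { toFun f := freeBimodUnit K ≫ f.hom
          invFun g := freeBimodDesc g
          left_inv f := freeBimod_ext fun n k => (one_lact M _).trans (ract_one M _)
          right_inv g := by
            ext n k
            exact (one_lact M _).trans (ract_one M _) }
      homEquiv_naturality_left_symm f g := freeBimod_ext fun n k => rfl
      homEquiv_naturality_right f g := rfl }

end

/-! ### The two weak factorization systems -/

section

open MorphismProperty

attribute [local instance] Cardinal.fact_isRegular_aleph0 Cardinal.orderBotAleph0OrdToType

instance : IsCardinalForSmallObjectArgument modelCategoryQuillen.I.{u} Cardinal.aleph0.{u} where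
  isSmall := isSmall_ofHoms ..
  preservesColimit {A B X Y} i hi f hf := by
    have : IsFinitelyPresentable.{u} A := by
      obtain ⟨n⟩ := hi
      infer_instance
    infer_instance

instance : HasSmallObjectArgument.{u} modelCategoryQuillen.I.{u} :=
  ⟨.aleph0, inferInstance, inferInstance, inferInstance⟩

/-- By the small object argument, a map with the left lifting property against trivial fibrations is
a retract of a transfinite composition of monomorphisms, hence a monomorphism. -/
lemma trivialKanFibrations_llp : trivialKanFibrations.{u}.llp = monomorphisms _ := by
  refine le_antisymm ?_ (le_llp_rlp _)
  rw [trivialKanFibrations_eq_rlp_I, llp_rlp_of_hasSmallObjectArgument]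
  trans (transfiniteCompositions.{u} (coproducts.{u} (monomorphisms SSet.{u})).pushouts).retracts
  · apply retracts_monotone
    apply transfiniteCompositions_monotone
    apply pushouts_monotone
    apply coproducts_monotone
    exact modelCategoryQuillen.I_le_monomorphisms
  · rw [coproducts_eq_self.{u} (monomorphisms SSet.{u})]
    simp

lemma rlp_ofHoms_map {C D : Type*} [Category* C] [Category* D] {F : C ⥤ D} {G : D ⥤ C}
    (adj : F ⊣ G) {ι : Type*} {A B : ι → C} (f : ∀ i, A i ⟶ B i) :
    (ofHoms fun i => F.map (f i)).rlp = (ofHoms f).rlp.inverseImage G := by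
  ext X Y p
  refine ⟨fun hp _ _ _ h => ?_, fun hp _ _ _ h => ?_⟩
  all_goals obtain ⟨i⟩ := h
  · exact (adj.hasLiftingProperty_iff _ _).1 (hp _ ⟨i⟩)
  · exact (adj.hasLiftingProperty_iff _ _).2 (hp _ ⟨i⟩)

variable (R : Mon SSet.{u})

/-- The generating cofibrations of bimodules: the free maps on the boundary inclusions. -/
noncomputable def bimodI : MorphismProperty (Bimod R R) :=
  ofHoms fun n : ℕ => (freeBimod R).map (∂Δ[n] : SSet.Subcomplex.{u} _).ι

/-- The generating trivial cofibrations of bimodules: the free maps on the horn inclusions. -/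
noncomputable def bimodJ : MorphismProperty (Bimod R R) :=
  ofHoms fun p : Σ n : ℕ, Fin (n + 2) =>
    (freeBimod R).map (Λ[p.1 + 1, p.2] : SSet.Subcomplex.{u} _).ι

lemma bimodI_rlp : (bimodI R).rlp = trivialKanFibrations.inverseImage (Bimod.forget R) := by
  rw [trivialKanFibrations_eq_rlp_I]
  exact rlp_ofHoms_map (freeBimodAdjunction R) _

lemma bimodJ_rlp : (bimodJ R).rlp = kanFibrations.inverseImage (Bimod.forget R) := by
  have : modelCategoryQuillen.J.{u} =
      ofHoms fun p : Σ n : ℕ, Fin (n + 2) => (Λ[p.1 + 1, p.2] : SSet.Subcomplex.{u} _).ι := by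
    ext X Y f
    simp only [modelCategoryQuillen.J, iSup_iff]
    constructor
    · rintro ⟨n, ⟨i⟩⟩
      exact ⟨(⟨n, i⟩ : Σ n : ℕ, Fin (n + 2))⟩
    · rintro ⟨n, i⟩
      exact ⟨n, ⟨i⟩⟩
  rw [kanFibrations, this]
  exact rlp_ofHoms_map (freeBimodAdjunction R) _

lemma isFinitelyPresentable_freeBimod_obj (K : SSet.{u}) [IsFinitelyPresentable.{u} K] :
    IsFinitelyPresentable.{u} ((freeBimod R).obj K) :=
  (freeBimodAdjunction R).isCardinalPresentable_leftAdjoint_obj Cardinal.aleph0.{u} K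

instance : IsCardinalForSmallObjectArgument (bimodI R) Cardinal.aleph0.{u} where
  isSmall := isSmall_ofHoms ..
  preservesColimit {A B X Y} i hi f hf := by
    have : IsFinitelyPresentable.{u} A := by
      obtain ⟨n⟩ := hi
      exact isFinitelyPresentable_freeBimod_obj R _
    infer_instance

instance : IsCardinalForSmallObjectArgument (bimodJ R) Cardinal.aleph0.{u} where
  isSmall := isSmall_ofHoms ..
  preservesColimit {A B X Y} i hi f hf := by
    have : IsFinitelyPresentable.{u} A := by
      obtain ⟨⟨n, i⟩⟩ := hi
      exact isFinitelyPresentable_freeBimod_obj R _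
    infer_instance

instance : HasSmallObjectArgument.{u} (bimodI R) :=
  ⟨.aleph0, inferInstance, inferInstance, inferInstance⟩

instance : HasSmallObjectArgument.{u} (bimodJ R) :=
  ⟨.aleph0, inferInstance, inferInstance, inferInstance⟩

end

section

variable {R : Mon SSet.{u}}

/-- For a left adjoint functor `F`, the maps `f` such that `F.map f` lifts against `p` are closed
under the passage from a class to the left lifting closure it generates. -/
lemma hasLiftingProperty_map_of_llp {C D : Type*} [Category* C] [Category* D] (F : C ⥤ D)
    [F.IsLeftAdjoint] {I : MorphismProperty C} {X Y : D} {p : X ⟶ Y}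
    (h : ∀ ⦃A B : C⦄ (i : A ⟶ B), I i → HasLiftingProperty (F.map i) p)
    {A B : C} {f : A ⟶ B} (hf : I.rlp.llp f) : HasLiftingProperty (F.map f) p := by
  rw [(Adjunction.ofIsLeftAdjoint F).hasLiftingProperty_iff]
  refine hf _ fun A B i hi => ?_
  rw [← (Adjunction.ofIsLeftAdjoint F).hasLiftingProperty_iff]
  exact h i hi

lemma mono_whiskerLeft {C : Type*} [Category* C] [CartesianMonoidalCategory C] (K : C)
    {X Y : C} (f : X ⟶ Y) [Mono f] : Mono (K ◁ f) where
  right_cancellation a b h := by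
    ext
    · simpa using h =≫ fst _ _
    · rw [← cancel_mono f]
      simpa using h =≫ snd _ _

lemma mono_whiskerRight {C : Type*} [Category* C] [CartesianMonoidalCategory C] (K : C)
    {X Y : C} (f : X ⟶ Y) [Mono f] : Mono (f ▷ K) where
  right_cancellation a b h := by
    ext
    · rw [← cancel_mono f]
      simpa using h =≫ fst _ _
    · simpa using h =≫ snd _ _

/-- Cofibrations of bimodules have underlying monomorphisms: the forgetful functor is a left
adjoint, and the map underlying a free map on `i` is `R ⊗ (i ⊗ R)`. -/
lemma mono_hom_of_bimodI_rlp_llp {M N : Bimod R R} {f : M ⟶ N} (hf : (bimodI R).rlp.llp f) :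
    Mono f.hom := by
  have : trivialKanFibrations.llp f.hom := fun X Y p hp =>
    hasLiftingProperty_map_of_llp (Bimod.forget R) (by
      rintro _ _ _ ⟨n⟩
      have := mono_whiskerRight R.X (∂Δ[n] : SSet.Subcomplex.{u} _).ι
      exact hp _ (mono_whiskerLeft R.X ((∂Δ[n] : SSet.Subcomplex.{u} _).ι ▷ R.X))) hf
  rwa [trivialKanFibrations_llp] at this

/-- The acyclicity condition for the transfer of the model structure; it holds for the same reason
as `mono_hom_of_bimodI_rlp_llp`. -/
lemma anodyneExtensions_hom_of_bimodJ_rlp_llp {M N : Bimod R R} {f : M ⟶ N}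
    (hf : (bimodJ R).rlp.llp f) : anodyneExtensions f.hom := fun X Y p hp =>
  hasLiftingProperty_map_of_llp (Bimod.forget R) (by
    rintro _ _ _ ⟨⟨n, i⟩⟩
    have : anodyneExtensions (R.X ◁ ((Λ[n + 1, i] : SSet.Subcomplex.{u} _).ι ▷ R.X)) :=
      ((anodyneExtensions.horn_ι i).whiskerRight _).whiskerLeft _
    exact this _ hp) hf

variable (R) in
/-- The cofibrations of bimodules, as the left lifting closure of the generating ones. -/
def bimodCofibrations : MorphismProperty (Bimod R R) := (bimodI R).rlp.llp

/-- The trivial cofibrations are generated by the free maps on horn inclusions. -/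
lemma bimodCofibrations_and_weakHomotopyEquivalences_iff {M N : Bimod R R} (f : M ⟶ N) :
    (bimodCofibrations R f ∧ weakHomotopyEquivalences f.hom) ↔ (bimodJ R).rlp.llp f := by
  refine ⟨fun ⟨hf, hw⟩ => ?_, fun hf => ⟨?_, ?_⟩⟩
  · -- A retract argument: the fibration in a factorization of `f` is trivial.
    let h := MorphismProperty.factorizationData (bimodJ R).rlp.llp (bimodJ R).rlp f
    have hi : weakHomotopyEquivalences h.i.hom :=
      anodyneExtensions_le_weakHomotopyEquivalences _ (anodyneExtensions_hom_of_bimodJ_rlp_llp h.hi)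
    have hfac : h.i.hom ≫ h.p.hom = f.hom := congrArg Bimod.Hom.hom h.fac
    have hp : (bimodI R).rlp h.p := by
      have hp : kanFibrations h.p.hom := (bimodJ_rlp R).le _ h.hp
      rw [bimodI_rlp]
      exact (trivialKanFibrations_iff _).2 ⟨hp,
        weakHomotopyEquivalences.of_precomp _ _ hi (hfac ▸ hw)⟩
    have : HasLiftingProperty f h.p := hf _ hp
    exact MorphismProperty.of_retract (RetractArrow.ofLeftLiftingProperty h.fac) h.hi
  · refine MorphismProperty.antitone_llp ?_ _ hf
    rw [bimodI_rlp, bimodJ_rlp]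
    exact fun _ _ p hp => trivialKanFibrations_le_kanFibrations _ hp
  · exact anodyneExtensions_le_weakHomotopyEquivalences _
      (anodyneExtensions_hom_of_bimodJ_rlp_llp hf)

variable (R)

scoped instance : CategoryWithFibrations (Bimod R R) where
  fibrations := kanFibrations.inverseImage (Bimod.forget R)

scoped instance : CategoryWithWeakEquivalences (Bimod R R) where
  weakEquivalences := weakHomotopyEquivalences.inverseImage (Bimod.forget R)

scoped instance : CategoryWithCofibrations (Bimod R R) where
  cofibrations := bimodCofibrations R

lemma bimod_fibrations_eq : fibrations (Bimod R R) = (bimodJ R).rlp :=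
  (bimodJ_rlp R).symm

lemma bimod_trivialFibrations_eq : trivialFibrations (Bimod R R) = (bimodI R).rlp := by
  rw [bimodI_rlp]
  ext X Y f
  exact (trivialKanFibrations_iff _).symm

lemma bimod_trivialCofibrations_eq : trivialCofibrations (Bimod R R) = (bimodJ R).rlp.llp := by
  ext X Y f
  exact bimodCofibrations_and_weakHomotopyEquivalences_iff f

instance : (weakEquivalences (Bimod R R)).HasTwoOutOfThreeProperty :=
  inferInstanceAs
    (weakHomotopyEquivalences.inverseImage (Bimod.forget R)).HasTwoOutOfThreeProperty

instance bimod_hasFunctorialFactorization_fibrations :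
    MorphismProperty.HasFunctorialFactorization
    (trivialCofibrations (Bimod R R)) (fibrations (Bimod R R)) := by
  rw [bimod_trivialCofibrations_eq, bimod_fibrations_eq]
  infer_instance

instance bimod_hasFunctorialFactorization_trivialFibrations :
    MorphismProperty.HasFunctorialFactorization
    (cofibrations (Bimod R R)) (trivialFibrations (Bimod R R)) := by
  rw [bimod_trivialFibrations_eq]
  exact inferInstanceAs
    (MorphismProperty.HasFunctorialFactorization (bimodI R).rlp.llp (bimodI R).rlp)

instance : MorphismProperty.IsWeakFactorizationSystem
    (trivialCofibrations (Bimod R R)) (fibrations (Bimod R R)) where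
  rlp := by
    rw [bimod_trivialCofibrations_eq, bimod_fibrations_eq, MorphismProperty.rlp_llp_rlp]
  llp := by
    rw [bimod_trivialCofibrations_eq, bimod_fibrations_eq]

instance : MorphismProperty.IsWeakFactorizationSystem
    (cofibrations (Bimod R R)) (trivialFibrations (Bimod R R)) where
  rlp := by
    rw [bimod_trivialFibrations_eq]
    exact MorphismProperty.rlp_llp_rlp _
  llp := by
    rw [bimod_trivialFibrations_eq]
    rfl

/-- The model structure on bimodules, transferred from simplicial sets along the forgetful
functor. -/
@[reducible]
noncomputable def bimodModelCategory : ModelCategory (Bimod R R) := ModelCategory.mk' _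

end

/-! ### The tensor product of bimodules preserves colimits -/

section

variable {R : Mon SSet.{u}}

/-- The diagram whose colimit is the tensor product with a bimodule from the left. -/
noncomputable def tensorLeftDiagram (M : Bimod R R) :
    Bimod R R ⥤ WalkingParallelPair ⥤ SSet.{u} where
  obj N := parallelPair (M.actRight ▷ N.X) ((α_ M.X R.X N.X).hom ≫ M.X ◁ N.actLeft)
  map {N N'} f := parallelPairHom _ _ _ _ ((M.X ⊗ R.X) ◁ f.hom) (M.X ◁ f.hom)
    (ext_apply fun _ _ => rfl) (ext_apply fun n ⟨⟨m, a⟩, x⟩ =>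
      congrArg (fun z : N'.X.obj n => (m, z)) (hom_lact f a x))
  map_id N := NatTrans.ext (funext (by rintro (_ | _) <;> rfl))
  map_comp f g := NatTrans.ext (funext (by rintro (_ | _) <;> rfl))

/-- The diagram whose colimit is the tensor product with a bimodule from the right. -/
noncomputable def tensorRightDiagram (N : Bimod R R) :
    Bimod R R ⥤ WalkingParallelPair ⥤ SSet.{u} where
  obj M := parallelPair (M.actRight ▷ N.X) ((α_ M.X R.X N.X).hom ≫ M.X ◁ N.actLeft)
  map {M M'} f := parallelPairHom _ _ _ _ (f.hom ▷ R.X ▷ N.X) (f.hom ▷ N.X)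
    (ext_apply fun n ⟨⟨m, a⟩, x⟩ =>
      congrArg (fun z : M'.X.obj n => (z, x)) (hom_ract f m a)) (ext_apply fun _ _ => rfl)
  map_id N := NatTrans.ext (funext (by rintro (_ | _) <;> rfl))
  map_comp f g := NatTrans.ext (funext (by rintro (_ | _) <;> rfl))

instance preservesColimits_tensorLeftDiagram (M : Bimod R R) :
    PreservesColimits (tensorLeftDiagram M) where
  preservesColimitsOfShape := preservesColimitsOfShape_of_evaluation _ _ (by
    rintro (_ | _)
    · exact inferInstanceAs
        (PreservesColimitsOfShape _ (Bimod.forget R ⋙ tensorLeft (M.X ⊗ R.X)))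
    · exact inferInstanceAs (PreservesColimitsOfShape _ (Bimod.forget R ⋙ tensorLeft M.X)))

instance preservesColimits_tensorRightDiagram (N : Bimod R R) :
    PreservesColimits (tensorRightDiagram N) where
  preservesColimitsOfShape := preservesColimitsOfShape_of_evaluation _ _ (by
    rintro (_ | _)
    · exact inferInstanceAs
        (PreservesColimitsOfShape _ (Bimod.forget R ⋙ tensorRight R.X ⋙ tensorRight N.X))
    · exact inferInstanceAs (PreservesColimitsOfShape _ (Bimod.forget R ⋙ tensorRight N.X)))

/-- The tensor product of bimodules as the colimit of a diagram. -/
noncomputable def tensorLeftDiagramIso (M : Bimod R R) :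
    tensorLeftDiagram M ⋙ colim ≅ tensorLeft M ⋙ Bimod.forget R :=
  NatIso.ofComponents fun N => Iso.refl _

/-- The tensor product of bimodules as the colimit of a diagram. -/
noncomputable def tensorRightDiagramIso (N : Bimod R R) :
    tensorRightDiagram N ⋙ colim ≅ tensorRight N ⋙ Bimod.forget R :=
  NatIso.ofComponents fun M => Iso.refl _

instance : ReflectsColimits (Bimod.forget R : Bimod R R ⥤ _) :=
  reflectsColimits_of_reflectsIsomorphisms

/-- Colimits of bimodules are computed on underlying simplicial sets, where the products and the
coequalizer which define the tensor product preserve them. -/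
instance (M : Bimod R R) : (tensorLeft M).IsLeftAdjoint := by
  have : PreservesColimits (tensorLeft M ⋙ Bimod.forget R) :=
    preservesColimits_of_natIso (tensorLeftDiagramIso M)
  have : PreservesColimits (tensorLeft M) :=
    preservesColimits_of_reflects_of_preserves _ (Bimod.forget R)
  exact isLeftAdjoint_of_preservesColimits _

instance (N : Bimod R R) : (tensorRight N).IsLeftAdjoint := by
  have : PreservesColimits (tensorRight N ⋙ Bimod.forget R) :=
    preservesColimits_of_natIso (tensorRightDiagramIso N)
  have : PreservesColimits (tensorRight N) :=
    preservesColimits_of_reflects_of_preserves _ (Bimod.forget R)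
  exact isLeftAdjoint_of_preservesColimits _

end

/-! ### Lifting properties of Leibniz pushouts -/

section

variable {C₁ C₂ C₃ : Type*} [Category* C₁] [Category* C₂] [Category* C₃]

/-- The right adjoints of the partial functors of a bifunctor, as a bifunctor. -/
noncomputable def rightAdjointBifunctor (F : C₁ ⥤ C₂ ⥤ C₃) [∀ X, (F.obj X).IsLeftAdjoint] :
    C₁ᵒᵖ ⥤ C₃ ⥤ C₂ where
  obj X := (F.obj X.unop).rightAdjoint
  map {X Y} f := conjugateEquiv (Adjunction.ofIsLeftAdjoint (F.obj X.unop))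
    (Adjunction.ofIsLeftAdjoint (F.obj Y.unop)) (F.map f.unop)
  map_id X := by simp
  map_comp f g := by simp

/-- The adjunction between a bifunctor and its partial right adjoints. -/
noncomputable def rightAdjointBifunctorAdjunction (F : C₁ ⥤ C₂ ⥤ C₃)
    [∀ X, (F.obj X).IsLeftAdjoint] : F ⊣₂ rightAdjointBifunctor F where
  adj X := Adjunction.ofIsLeftAdjoint (F.obj X)
  unit_whiskerRight_map {X Y} f := by
    ext Z
    exact (unit_conjugateEquiv (Adjunction.ofIsLeftAdjoint (F.obj Y))
      (Adjunction.ofIsLeftAdjoint (F.obj X)) (F.map f) Z).symm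

/-- A lifting problem for a Leibniz pushout is, by adjunction, one for its second argument against
a Leibniz pullback which does not depend on that argument. -/
lemma exists_hasLiftingProperty_pushoutObjObj_iff (F : C₁ ⥤ C₂ ⥤ C₃)
    [∀ X, (F.obj X).IsLeftAdjoint] [HasPullbacks C₂] {X₁ Y₁ : C₁} (f : X₁ ⟶ Y₁) {X₃ Y₃ : C₃}
    (p : X₃ ⟶ Y₃) :
    ∃ (X₂ Y₂ : C₂) (q : X₂ ⟶ Y₂), ∀ ⦃A B : C₂⦄ (g : A ⟶ B) (sq : F.PushoutObjObj f g),
      HasLiftingProperty sq.ι p ↔ HasLiftingProperty g q :=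
  ⟨_, _, _, fun _ _ _ sq => (rightAdjointBifunctorAdjunction F).hasLiftingProperty_iff sq
    (Functor.PullbackObjObj.ofHasPullback _ f p)⟩

/-- For a fixed first argument, the lifting properties of Leibniz pushouts can be checked on
generators in the second one; here only the functors `F.obj X` have to be left adjoints. -/
lemma hasLiftingProperty_pushoutObjObj_of_right (F : C₁ ⥤ C₂ ⥤ C₃)
    [∀ X, (F.obj X).IsLeftAdjoint] [HasPullbacks C₂] [HasPushouts C₃] {X₁ Y₁ : C₁} {f : X₁ ⟶ Y₁}
    {X₃ Y₃ : C₃} {p : X₃ ⟶ Y₃} {I : MorphismProperty C₂}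
    (h : ∀ ⦃A B : C₂⦄ (i : A ⟶ B), I i → ∃ sq : F.PushoutObjObj f i, HasLiftingProperty sq.ι p)
    {A B : C₂} {g : A ⟶ B} (hg : I.rlp.llp g) (sq : F.PushoutObjObj f g) :
    HasLiftingProperty sq.ι p := by
  obtain ⟨X₂, Y₂, q, hq⟩ := exists_hasLiftingProperty_pushoutObjObj_iff F f p
  rw [hq]
  refine hg _ fun A B i hi => ?_
  obtain ⟨sq, hsq⟩ := h i hi
  exact (hq i sq).1 hsq

/-- The lifting properties of Leibniz pushouts can be checked on generators in both arguments. -/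
lemma hasLiftingProperty_pushoutObjObj (F : C₁ ⥤ C₂ ⥤ C₃)
    [∀ X, (F.obj X).IsLeftAdjoint] [∀ X, (F.flip.obj X).IsLeftAdjoint] [HasPullbacks C₁]
    [HasPullbacks C₂] [HasPushouts C₃] {X₃ Y₃ : C₃} {p : X₃ ⟶ Y₃}
    {I : MorphismProperty C₁} {J : MorphismProperty C₂}
    (h : ∀ ⦃A₁ B₁ : C₁⦄ (i : A₁ ⟶ B₁), I i → ∀ ⦃A₂ B₂ : C₂⦄ (j : A₂ ⟶ B₂), J j →
      ∃ sq : F.PushoutObjObj i j, HasLiftingProperty sq.ι p)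
    {X₁ Y₁ : C₁} {f : X₁ ⟶ Y₁} (hf : I.rlp.llp f) {X₂ Y₂ : C₂} {g : X₂ ⟶ Y₂} (hg : J.rlp.llp g)
    (sq : F.PushoutObjObj f g) :
    HasLiftingProperty sq.ι p :=
  hasLiftingProperty_pushoutObjObj_of_right F.flip (fun _ _ i hi =>
    ⟨(Functor.PushoutObjObj.ofHasPushout F i g).flip,
      hasLiftingProperty_pushoutObjObj_of_right F (h i hi) hg _⟩) hf sq.flip

end

/-! ### Tensor products with free bimodules -/

section

variable {R : Mon SSet.{u}} {n : SimplexCategoryᵒᵖ}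

/-- The projection to the tensor product of two bimodules. -/
noncomputable def tensorProj (M N : Bimod R R) : M.X ⊗ N.X ⟶ (M ⊗ N).X :=
  coequalizer.π (M.actRight ▷ N.X) ((α_ _ _ _).hom ≫ (M.X ◁ N.actLeft))

/-- The class of a pair of simplices in the tensor product of two bimodules. -/
noncomputable def tmk (M N : Bimod R R) (m : M.X.obj n) (x : N.X.obj n) : (M ⊗ N).X.obj n :=
  (tensorProj M N).app n (m, x)

lemma tmk_ract (M N : Bimod R R) (m : M.X.obj n) (a : R.X.obj n) (x : N.X.obj n) :
    tmk M N (ract M m a) x = tmk M N m (lact N a x) :=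
  congr_app (coequalizer.condition (M.actRight ▷ N.X) ((α_ _ _ _).hom ≫ (M.X ◁ N.actLeft)))
    (n := n) ((m, a), x)

lemma lact_tmk (M N : Bimod R R) (a : R.X.obj n) (m : M.X.obj n) (x : N.X.obj n) :
    lact (M ⊗ N) a (tmk M N m x) = tmk M N (lact M a m) x :=
  congr_app (Bimod.TensorBimod.whiskerLeft_π_actLeft M N) (n := n) (a, (m, x))

lemma ract_tmk (M N : Bimod R R) (m : M.X.obj n) (x : N.X.obj n) (a : R.X.obj n) :
    ract (M ⊗ N) (tmk M N m x) a = tmk M N m (ract N x a) :=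
  congr_app (Bimod.TensorBimod.π_tensor_id_actRight M N) (n := n) ((m, x), a)

lemma whiskerRight_tmk {M M' : Bimod R R} (f : M ⟶ M') (N : Bimod R R) (m : M.X.obj n)
    (x : N.X.obj n) : (f ▷ N).hom.app n (tmk M N m x) = tmk M' N (f.hom.app n m) x :=
  congr_app (ι_colimMap (parallelPairHom (M.actRight ▷ N.X) ((α_ _ _ _).hom ≫ (M.X ◁ N.actLeft))
    (M'.actRight ▷ N.X) ((α_ _ _ _).hom ≫ (M'.X ◁ N.actLeft)) (f.hom ▷ R.X ▷ N.X) (f.hom ▷ N.X)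
    _ _) WalkingParallelPair.one) (n := n) (m, x)

lemma whiskerLeft_tmk (M : Bimod R R) {N N' : Bimod R R} (f : N ⟶ N') (m : M.X.obj n)
    (x : N.X.obj n) : (M ◁ f).hom.app n (tmk M N m x) = tmk M N' m (f.hom.app n x) :=
  congr_app (ι_colimMap (parallelPairHom (M.actRight ▷ N.X) ((α_ _ _ _).hom ≫ (M.X ◁ N.actLeft))
    (M.actRight ▷ N'.X) ((α_ _ _ _).hom ≫ (M.X ◁ N'.actLeft)) ((M.X ⊗ R.X) ◁ f.hom) (M.X ◁ f.hom)
    _ _) WalkingParallelPair.one) (n := n) (m, x)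

lemma map_tmk {m : SimplexCategoryᵒᵖ} (θ : n ⟶ m) (M N : Bimod R R) (y : M.X.obj n)
    (x : N.X.obj n) : (M ⊗ N).X.map θ (tmk M N y x) = tmk M N (M.X.map θ y) (N.X.map θ x) :=
  (app_map (tensorProj M N) θ (y, x)).symm

/-- To define a map from the tensor product of two bimodules. -/
noncomputable def tensorDesc {M N : Bimod R R} {Y : SSet.{u}} (t : M.X ⊗ N.X ⟶ Y)
    (h : ∀ (n : SimplexCategoryᵒᵖ) (m : M.X.obj n) (a : R.X.obj n) (x : N.X.obj n),
      t.app n (ract M m a, x) = t.app n (m, lact N a x)) : (M ⊗ N).X ⟶ Y :=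
  coequalizer.desc (f := M.actRight ▷ N.X) (g := (α_ _ _ _).hom ≫ (M.X ◁ N.actLeft)) t
    (ext_apply fun n ⟨⟨m, a⟩, x⟩ => h n m a x)

lemma tensorDesc_tmk {M N : Bimod R R} {Y : SSet.{u}} (t : M.X ⊗ N.X ⟶ Y)
    (h : ∀ (n : SimplexCategoryᵒᵖ) (m : M.X.obj n) (a : R.X.obj n) (x : N.X.obj n),
      t.app n (ract M m a, x) = t.app n (m, lact N a x)) (m : M.X.obj n) (x : N.X.obj n) :
    (tensorDesc t h).app n (tmk M N m x) = t.app n (m, x) :=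
  congr_app (coequalizer.π_desc (f := M.actRight ▷ N.X) (g := (α_ _ _ _).hom ≫ (M.X ◁ N.actLeft))
    t _) (n := n) (m, x)

lemma tensorDesc_comp_tmk {M N : Bimod R R} {Y Z : SSet.{u}} (t : M.X ⊗ N.X ⟶ Y)
    (h : ∀ (n : SimplexCategoryᵒᵖ) (m : M.X.obj n) (a : R.X.obj n) (x : N.X.obj n),
      t.app n (ract M m a, x) = t.app n (m, lact N a x)) (g : Y ⟶ Z) (m : M.X.obj n)
    (x : N.X.obj n) : (tensorDesc t h ≫ g).app n (tmk M N m x) = g.app n (t.app n (m, x)) :=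
  congrArg (g.app n) (tensorDesc_tmk t h m x)

lemma tensor_ext {M N : Bimod R R} {Y : SSet.{u}} {f g : (M ⊗ N).X ⟶ Y}
    (h : ∀ (n : SimplexCategoryᵒᵖ) (m : M.X.obj n) (x : N.X.obj n),
      f.app n (tmk M N m x) = g.app n (tmk M N m x)) : f = g :=
  coequalizer.hom_ext (f := M.actRight ▷ N.X) (g := (α_ _ _ _).hom ≫ (M.X ◁ N.actLeft))
    (ext_apply fun n ⟨m, x⟩ => h n m x)

end

section

variable {R : Mon SSet.{u}}

/-- The tensor product with a free bimodule on the right. -/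
noncomputable def tensorFreeIso (M : Bimod R R) (K : SSet.{u}) :
    (M ⊗ (freeBimod R).obj K).X ≅ M.X ⊗ (K ⊗ R.X) where
  hom := tensorDesc ((α_ _ _ _).inv ≫ M.actRight ▷ (K ⊗ R.X)) fun n m a ⟨b, k, c⟩ =>
    congrArg (fun z : M.X.obj n => (z, k, c)) (ract_mul M m a b).symm
  inv :=
    { app n := TypeCat.ofHom fun x : M.X.obj n × (K.obj n × R.X.obj n) =>
        tmk M ((freeBimod R).obj K) x.1 ((1 : R.X.obj n), x.2)
      naturality n m θ := by
        ext ⟨x, k, a⟩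
        refine ((map_tmk θ M _ _ _).trans (congrArg (fun z : R.X.obj m =>
          tmk M ((freeBimod R).obj K) (M.X.map θ x) (z, K.map θ k, R.X.map θ a))
          (map_one_obj θ))).symm }
  hom_inv_id := tensor_ext fun n m ⟨a, k, b⟩ => by
    refine (tensorDesc_comp_tmk _ _ _ _ _).trans ?_
    refine (tmk_ract M ((freeBimod R).obj K) m a ((1 : R.X.obj n), k, b)).trans ?_
    exact congrArg (fun z : R.X.obj n => tmk M ((freeBimod R).obj K) m (z, k, b)) (mul_one a)
  inv_hom_id := ext_apply fun n ⟨m, k, a⟩ => by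
    refine (tensorDesc_tmk _ _ _ _).trans ?_
    exact congrArg (fun z : M.X.obj n => (z, k, a)) (ract_one M m)

lemma tensorFreeIso_hom_tmk (M : Bimod R R) (K : SSet.{u}) {n : SimplexCategoryᵒᵖ}
    (m : M.X.obj n) (a : R.X.obj n) (k : K.obj n) (b : R.X.obj n) :
    (tensorFreeIso M K).hom.app n (tmk M ((freeBimod R).obj K) m (a, k, b)) =
      (ract M m a, k, b) := by
  dsimp only [tensorFreeIso]
  exact tensorDesc_tmk _ _ _ _

/-- The tensor product with a free bimodule on the left. -/
noncomputable def freeTensorIso (K : SSet.{u}) (N : Bimod R R) :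
    ((freeBimod R).obj K ⊗ N).X ≅ R.X ⊗ (K ⊗ N.X) where
  hom := tensorDesc ((α_ _ _ _).hom ≫ R.X ◁ ((α_ _ _ _).hom ≫ K ◁ N.actLeft))
    fun n ⟨b, k, c⟩ a x => congrArg (fun z : N.X.obj n => (b, k, z)) (mul_lact N c a x)
  inv :=
    { app n := TypeCat.ofHom fun x : R.X.obj n × (K.obj n × N.X.obj n) =>
        tmk ((freeBimod R).obj K) N (x.1, x.2.1, (1 : R.X.obj n)) x.2.2
      naturality n m θ := by
        ext ⟨a, k, x⟩
        refine ((map_tmk θ ((freeBimod R).obj K) N _ _).trans (congrArg (fun z : R.X.obj m =>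
          tmk ((freeBimod R).obj K) N (R.X.map θ a, K.map θ k, z) (N.X.map θ x))
          (map_one_obj θ))).symm }
  hom_inv_id := tensor_ext fun n ⟨a, k, b⟩ x => by
    refine (tensorDesc_comp_tmk _ _ _ _ _).trans ?_
    refine (tmk_ract ((freeBimod R).obj K) N (a, k, (1 : R.X.obj n)) b x).symm.trans ?_
    exact congrArg (fun z : R.X.obj n => tmk ((freeBimod R).obj K) N (a, k, z) x) (one_mul b)
  inv_hom_id := ext_apply fun n ⟨a, k, x⟩ => by
    refine (tensorDesc_tmk _ _ _ _).trans ?_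
    exact congrArg (fun z : N.X.obj n => (a, k, z)) (one_lact N x)

lemma freeTensorIso_hom_tmk (K : SSet.{u}) (N : Bimod R R) {n : SimplexCategoryᵒᵖ}
    (a : R.X.obj n) (k : K.obj n) (b : R.X.obj n) (x : N.X.obj n) :
    (freeTensorIso K N).hom.app n (tmk ((freeBimod R).obj K) N (a, k, b) x) =
      (a, k, lact N b x) := by
  dsimp only [freeTensorIso]
  exact tensorDesc_tmk _ _ _ _

/-- The comparison map for the tensor product of two free bimodules: the product of the free
bimodules on `K` and `L` is free on `K ⊗ (R ⊗ L)`. -/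
noncomputable def freeTensorFreeHom (K L : SSet.{u}) :
    (freeBimod R).obj (K ⊗ (R.X ⊗ L)) ⟶ (freeBimod R).obj K ⊗ (freeBimod R).obj L :=
  freeBimodDesc (M := (freeBimod R).obj K ⊗ (freeBimod R).obj L)
    { app n := TypeCat.ofHom fun x : K.obj n × (R.X.obj n × L.obj n) =>
        tmk ((freeBimod R).obj K) ((freeBimod R).obj L)
          ((1 : R.X.obj n), x.1, (1 : R.X.obj n)) (x.2.1, x.2.2, (1 : R.X.obj n))
      naturality n m θ := by
        ext ⟨k, a, l⟩
        refine ((map_tmk θ ((freeBimod R).obj K) ((freeBimod R).obj L) _ _).trans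
          (congrArg (fun z : R.X.obj m =>
            tmk ((freeBimod R).obj K) ((freeBimod R).obj L) (z, K.map θ k, z)
              (R.X.map θ a, L.map θ l, z)) (map_one_obj θ))).symm }

lemma freeTensorFreeHom_hom_apply (K L : SSet.{u}) {n : SimplexCategoryᵒᵖ} (a b c : R.X.obj n)
    (k : K.obj n) (l : L.obj n) :
    (freeTensorFreeHom (R := R) K L).hom.app n (a, (k, b, l), c) =
      tmk ((freeBimod R).obj K) ((freeBimod R).obj L) (a, k, (1 : R.X.obj n)) (b, l, c) := by
  refine (congrArg (lact ((freeBimod R).obj K ⊗ (freeBimod R).obj L) a) (ract_tmk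
    ((freeBimod R).obj K) ((freeBimod R).obj L) _ _ c)).trans ?_
  refine (lact_tmk ((freeBimod R).obj K) ((freeBimod R).obj L) _ _ _).trans ?_
  exact congrArg₂ (fun z w : R.X.obj n => tmk ((freeBimod R).obj K) ((freeBimod R).obj L)
    (z, k, (1 : R.X.obj n)) (b, l, w)) (mul_one a) (one_mul c)

instance (K L : SSet.{u}) : IsIso (freeTensorFreeHom (R := R) K L) := by
  have h : (freeTensorFreeHom (R := R) K L).hom =
      (whiskerLeftIso R.X ((α_ _ _ _) ≪≫ whiskerLeftIso K (α_ _ _ _)) ≪≫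
        (freeTensorIso K ((freeBimod R).obj L)).symm).hom :=
    ext_apply fun n ⟨a, ⟨k, b, l⟩, c⟩ => freeTensorFreeHom_hom_apply K L a b c k l
  have : IsIso ((Bimod.forget R).map (freeTensorFreeHom (R := R) K L)) := by
    change IsIso (freeTensorFreeHom (R := R) K L).hom
    rw [h]
    exact Iso.isIso_hom _
  exact isIso_of_reflects_iso _ (Bimod.forget R)

end

/-! ### The pushout product axiom -/

/-- The image of a Leibniz pushout square by a functor, seen as a Leibniz pushout square of another
bifunctor. -/
noncomputable def transportPushoutObjObj {C₁ C₂ C₃ D₁ D₂ D₃ E₁ E₂ : Type*}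
    [Category* C₁] [Category* C₂] [Category* C₃] [Category* D₁] [Category* D₂] [Category* D₃]
    [Category* E₁] [Category* E₂]
    {F : C₁ ⥤ C₂ ⥤ C₃} {F' : D₁ ⥤ D₂ ⥤ D₃} {A : E₁ ⥤ C₁} {B : E₂ ⥤ C₂} {A' : E₁ ⥤ D₁}
    {B' : E₂ ⥤ D₂} (G : C₃ ⥤ D₃) [PreservesColimitsOfShape WalkingSpan G]
    (e : ∀ X Y, (F'.obj (A'.obj X)).obj (B'.obj Y) ≅ G.obj ((F.obj (A.obj X)).obj (B.obj Y)))
    (he₁ : ∀ ⦃X₁ Y₁ : E₁⦄ (f : X₁ ⟶ Y₁) (Y : E₂),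
      (F'.map (A'.map f)).app _ ≫ (e Y₁ Y).hom =
        (e X₁ Y).hom ≫ G.map ((F.map (A.map f)).app _))
    (he₂ : ∀ (X : E₁) ⦃X₂ Y₂ : E₂⦄ (g : X₂ ⟶ Y₂),
      (F'.obj _).map (B'.map g) ≫ (e X Y₂).hom =
        (e X X₂).hom ≫ G.map ((F.obj _).map (B.map g)))
    {X₁ Y₁ : E₁} {f : X₁ ⟶ Y₁} {X₂ Y₂ : E₂} {g : X₂ ⟶ Y₂}
    (sq : F.PushoutObjObj (A.map f) (B.map g)) : F'.PushoutObjObj (A'.map f) (B'.map g) where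
  pt := G.obj sq.pt
  inl := (e _ _).hom ≫ G.map sq.inl
  inr := (e _ _).hom ≫ G.map sq.inr
  isPushout := (sq.isPushout.map G).of_iso (e _ _).symm (e _ _).symm (e _ _).symm (Iso.refl _)
    (by
      change G.map _ ≫ (e _ _).inv = (e _ _).inv ≫ _
      rw [Iso.eq_inv_comp, ← Category.assoc, ← he₁, Category.assoc, Iso.hom_inv_id,
        Category.comp_id])
    (by
      change G.map _ ≫ (e _ _).inv = (e _ _).inv ≫ _
      rw [Iso.eq_inv_comp, ← Category.assoc, ← he₂, Category.assoc, Iso.hom_inv_id,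
        Category.comp_id])
    (by simp) (by simp)
  ι := G.map sq.ι ≫ (e _ _).inv
  inl_ι := by
    rw [Category.assoc, ← G.map_comp_assoc, sq.inl_ι, ← Category.assoc, ← he₂, Category.assoc,
      Iso.hom_inv_id, Category.comp_id]
  inr_ι := by
    rw [Category.assoc, ← G.map_comp_assoc, sq.inr_ι, ← Category.assoc, ← he₁, Category.assoc,
      Iso.hom_inv_id, Category.comp_id]

section

variable {R : Mon SSet.{u}}

instance : (freeBimod R).IsLeftAdjoint := (freeBimodAdjunction R).isLeftAdjoint

lemma freeTensorFreeHom_naturality_left {K K' : SSet.{u}} (f : K ⟶ K') (L : SSet.{u}) :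
    (freeBimod R).map (f ▷ (R.X ⊗ L)) ≫ freeTensorFreeHom K' L =
      freeTensorFreeHom K L ≫ (freeBimod R).map f ▷ (freeBimod R).obj L :=
  freeBimod_ext fun n ⟨_, _, _⟩ => (freeTensorFreeHom_hom_apply _ _ _ _ _ _ _).trans
    ((congrArg (((freeBimod R).map f ▷ (freeBimod R).obj L).hom.app n)
      (freeTensorFreeHom_hom_apply _ _ _ _ _ _ _)).trans (whiskerRight_tmk _ _ _ _)).symm

lemma freeTensorFreeHom_naturality_right (K : SSet.{u}) {L L' : SSet.{u}} (g : L ⟶ L') :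
    (freeBimod R).map (K ◁ (R.X ◁ g)) ≫ freeTensorFreeHom K L' =
      freeTensorFreeHom K L ≫ (freeBimod R).obj K ◁ (freeBimod R).map g :=
  freeBimod_ext fun n ⟨_, _, _⟩ => (freeTensorFreeHom_hom_apply _ _ _ _ _ _ _).trans
    ((congrArg (((freeBimod R).obj K ◁ (freeBimod R).map g).hom.app n)
      (freeTensorFreeHom_hom_apply _ _ _ _ _ _ _)).trans (whiskerLeft_tmk _ _ _ _)).symm

/-- The Leibniz pushout of two free maps is a free map, namely on the Leibniz pushout of `i` and
`R ⊗ j`. -/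
noncomputable def freeBimodPushoutObjObj {K K' L L' : SSet.{u}} {i : K ⟶ K'} {j : L ⟶ L'}
    (sq : (curriedTensor SSet.{u}).PushoutObjObj i (R.X ◁ j)) :
    (curriedTensor (Bimod R R)).PushoutObjObj ((freeBimod R).map i) ((freeBimod R).map j) :=
  transportPushoutObjObj (F := curriedTensor SSet.{u}) (A := 𝟭 _) (B := tensorLeft R.X)
    (F' := curriedTensor (Bimod R R)) (A' := freeBimod R) (B' := freeBimod R)
    (freeBimod R) (fun K L => (asIso (freeTensorFreeHom K L)).symm)
    (fun K K' f L => by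
      rw [Iso.symm_hom, Iso.symm_hom, Iso.eq_inv_comp, ← Category.assoc, Iso.comp_inv_eq]
      exact (freeTensorFreeHom_naturality_left f L).symm)
    (fun K L L' g => by
      rw [Iso.symm_hom, Iso.symm_hom, Iso.eq_inv_comp, ← Category.assoc, Iso.comp_inv_eq]
      exact (freeTensorFreeHom_naturality_right K g).symm) sq

lemma hasLiftingProperty_freeBimodPushoutObjObj_ι {K K' L L' : SSet.{u}} {i : K ⟶ K'} {j : L ⟶ L'}
    (sq : (curriedTensor SSet.{u}).PushoutObjObj i (R.X ◁ j)) {M N : Bimod R R} (p : M ⟶ N)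
    [HasLiftingProperty sq.ι p.hom] :
    HasLiftingProperty (freeBimodPushoutObjObj sq).ι p := by
  have : HasLiftingProperty ((freeBimod R).map sq.ι) p :=
    ((freeBimodAdjunction R).hasLiftingProperty_iff _ _).2 (by assumption)
  exact inferInstanceAs
    (HasLiftingProperty ((freeBimod R).map sq.ι ≫ (asIso (freeTensorFreeHom K' L')).hom) p)

lemma leibnizTensor_lift {I J : MorphismProperty (Bimod R R)} {M N : Bimod R R} {p : M ⟶ N}
    (h : ∀ ⦃A₁ B₁⦄ (i : A₁ ⟶ B₁), I i → ∀ ⦃A₂ B₂⦄ (j : A₂ ⟶ B₂), J j →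
      ∃ sq : (curriedTensor (Bimod R R)).PushoutObjObj i j, HasLiftingProperty sq.ι p)
    {X₁ Y₁ X₂ Y₂ : Bimod R R} {f : X₁ ⟶ Y₁} {g : X₂ ⟶ Y₂} (hf : I.rlp.llp f) (hg : J.rlp.llp g)
    (sq : (curriedTensor (Bimod R R)).PushoutObjObj f g) : HasLiftingProperty sq.ι p := by
  have (X : Bimod R R) : ((curriedTensor (Bimod R R)).obj X).IsLeftAdjoint :=
    inferInstanceAs (tensorLeft X).IsLeftAdjoint
  have (X : Bimod R R) : ((curriedTensor (Bimod R R)).flip.obj X).IsLeftAdjoint :=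
    inferInstanceAs (tensorRight X).IsLeftAdjoint
  exact hasLiftingProperty_pushoutObjObj _ h hf hg sq

lemma bimodCofibrations_pushoutObjObj_ι {X₁ Y₁ X₂ Y₂ : Bimod R R} {f : X₁ ⟶ Y₁} {g : X₂ ⟶ Y₂}
    (hf : bimodCofibrations R f) (hg : bimodCofibrations R g)
    (sq : (curriedTensor (Bimod R R)).PushoutObjObj f g) : bimodCofibrations R sq.ι := by
  intro M N p hp
  rw [bimodI_rlp] at hp
  refine leibnizTensor_lift ?_ hf hg sq
  rintro _ _ _ ⟨n⟩ _ _ _ ⟨m⟩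
  let sq := Functor.PushoutObjObj.ofHasPushout (curriedTensor SSet.{u})
    (∂Δ[n] : SSet.Subcomplex.{u} _).ι (R.X ◁ (∂Δ[m] : SSet.Subcomplex.{u} _).ι)
  have := mono_whiskerLeft R.X (∂Δ[m] : SSet.Subcomplex.{u} _).ι
  have : HasLiftingProperty sq.ι p.hom := hp _ (mono_pushoutObjObj_ι _ _ sq)
  exact ⟨freeBimodPushoutObjObj sq, hasLiftingProperty_freeBimodPushoutObjObj_ι sq p⟩

lemma bimodJ_rlp_llp_pushoutObjObj_ι_left {X₁ Y₁ X₂ Y₂ : Bimod R R} {f : X₁ ⟶ Y₁} {g : X₂ ⟶ Y₂}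
    (hf : (bimodJ R).rlp.llp f) (hg : bimodCofibrations R g)
    (sq : (curriedTensor (Bimod R R)).PushoutObjObj f g) : (bimodJ R).rlp.llp sq.ι := by
  intro M N p hp
  rw [bimodJ_rlp] at hp
  refine leibnizTensor_lift ?_ hf hg sq
  rintro _ _ _ ⟨⟨n, i⟩⟩ _ _ _ ⟨m⟩
  let sq := Functor.PushoutObjObj.ofHasPushout (curriedTensor SSet.{u})
    (Λ[n + 1, i] : SSet.Subcomplex.{u} _).ι (R.X ◁ (∂Δ[m] : SSet.Subcomplex.{u} _).ι)
  have := mono_whiskerLeft R.X (∂Δ[m] : SSet.Subcomplex.{u} _).ι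
  have : HasLiftingProperty sq.ι p.hom :=
    anodyneExtensions_pushoutObjObjι' sq (anodyneExtensions.horn_ι i) _ hp
  exact ⟨freeBimodPushoutObjObj sq, hasLiftingProperty_freeBimodPushoutObjObj_ι sq p⟩

lemma bimodJ_rlp_llp_pushoutObjObj_ι_right {X₁ Y₁ X₂ Y₂ : Bimod R R} {f : X₁ ⟶ Y₁} {g : X₂ ⟶ Y₂}
    (hf : bimodCofibrations R f) (hg : (bimodJ R).rlp.llp g)
    (sq : (curriedTensor (Bimod R R)).PushoutObjObj f g) : (bimodJ R).rlp.llp sq.ι := by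
  intro M N p hp
  rw [bimodJ_rlp] at hp
  refine leibnizTensor_lift ?_ hf hg sq
  rintro _ _ _ ⟨m⟩ _ _ _ ⟨⟨n, i⟩⟩
  let sq := Functor.PushoutObjObj.ofHasPushout (curriedTensor SSet.{u})
    (∂Δ[m] : SSet.Subcomplex.{u} _).ι (R.X ◁ (Λ[n + 1, i] : SSet.Subcomplex.{u} _).ι)
  have : HasLiftingProperty sq.ι p.hom :=
    anodyneExtensions_pushoutObjObjι sq ((anodyneExtensions.horn_ι i).whiskerLeft _) _ hp
  exact ⟨freeBimodPushoutObjObj sq, hasLiftingProperty_freeBimodPushoutObjObj_ι sq p⟩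

end

/-! ### The unit axiom -/

lemma anodyneExtensions_of_mono_of_weakHomotopyEquivalences {X Y : SSet.{u}} (f : X ⟶ Y) [Mono f]
    (hf : weakHomotopyEquivalences f) : anodyneExtensions f := by
  let h := MorphismProperty.factorizationData modelCategoryQuillen.J.rlp.llp
    modelCategoryQuillen.J.rlp f
  have hi : weakHomotopyEquivalences h.i := anodyneExtensions_le_weakHomotopyEquivalences _ h.hi
  have hp : trivialKanFibrations h.p := (trivialKanFibrations_iff _).2
    ⟨h.hp, weakHomotopyEquivalences.of_precomp _ _ hi (h.fac.symm ▸ hf)⟩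
  have : HasLiftingProperty f h.p := hp _ ‹Mono f›
  exact MorphismProperty.of_retract (RetractArrow.ofLeftLiftingProperty h.fac) h.hi

lemma weakHomotopyEquivalences_id (X : SSet.{u}) : weakHomotopyEquivalences (𝟙 X) :=
  anodyneExtensions_le_weakHomotopyEquivalences _ (anodyneExtensions.of_isIso _)

section

variable {R : Mon SSet.{u}}

lemma mono_hom_coprod_inl (M N : Bimod R R) : Mono (coprod.inl : M ⟶ M ⨿ N).hom := by
  have h := isColimitOfHasBinaryCoproductOfPreservesColimit (Bimod.forget R) M N
  exact FinitaryExtensive.mono_inl_of_isColimit h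

lemma mono_hom_coprod_inr (M N : Bimod R R) : Mono (coprod.inr : N ⟶ M ⨿ N).hom := by
  have h := isColimitOfHasBinaryCoproductOfPreservesColimit (Bimod.forget R) M N
  exact FinitaryExtensive.mono_inr_of_isColimit h

/-- A functor on bimodules which sends anodyne extensions to weak equivalences preserves weak
equivalences: factor `(q, 𝟙) : Q ⨿ N ⟶ N` as a cofibration followed by a trivial fibration, and
compare `q` with the two resulting anodyne extensions, as in Ken Brown's lemma. -/
lemma weakHomotopyEquivalences_map_of_anodyneExtensions (T : Bimod R R ⥤ Bimod R R)
    (hT : ∀ ⦃M N : Bimod R R⦄ (q : M ⟶ N), anodyneExtensions q.hom →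
      weakHomotopyEquivalences (T.map q).hom) {Q N : Bimod R R} (q : Q ⟶ N)
    (hq : weakHomotopyEquivalences q.hom) : weakHomotopyEquivalences (T.map q).hom := by
  let h := MorphismProperty.factorizationData (bimodI R).rlp.llp (bimodI R).rlp
    (coprod.desc q (𝟙 N))
  have hp : weakHomotopyEquivalences h.p.hom :=
    trivialKanFibrations_le_weakHomotopyEquivalences _ ((bimodI_rlp R).le _ h.hp)
  have := mono_hom_of_bimodI_rlp_llp h.hi
  have key {M : Bimod R R} (a : M ⟶ h.Z) [Mono a.hom]
      (ha : weakHomotopyEquivalences (a ≫ h.p).hom) : weakHomotopyEquivalences (T.map a).hom :=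
    hT _ (anodyneExtensions_of_mono_of_weakHomotopyEquivalences _
      (weakHomotopyEquivalences.of_postcomp _ _ hp ha))
  have : Mono (coprod.inl ≫ h.i).hom :=
    have := mono_hom_coprod_inl Q N
    inferInstanceAs (Mono ((coprod.inl : Q ⟶ Q ⨿ N).hom ≫ h.i.hom))
  have : Mono (coprod.inr ≫ h.i).hom :=
    have := mono_hom_coprod_inr Q N
    inferInstanceAs (Mono ((coprod.inr : N ⟶ Q ⨿ N).hom ≫ h.i.hom))
  have fac₁ : (coprod.inl ≫ h.i) ≫ h.p = q := by rw [Category.assoc, h.fac, coprod.inl_desc]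
  have fac₂ : (coprod.inr ≫ h.i) ≫ h.p = 𝟙 N := by rw [Category.assoc, h.fac, coprod.inr_desc]
  have h₁ := key (coprod.inl ≫ h.i) (fac₁.symm ▸ hq)
  have h₂ := key (coprod.inr ≫ h.i) (fac₂.symm ▸ weakHomotopyEquivalences_id N.X)
  have h₃ : weakHomotopyEquivalences (T.map h.p).hom := by
    refine weakHomotopyEquivalences.of_precomp _ _ h₂ ?_
    have : (T.map (coprod.inr ≫ h.i)).hom ≫ (T.map h.p).hom = 𝟙 _ := by
      rw [← Bimod.comp_hom', ← T.map_comp, fac₂, T.map_id]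
      rfl
    rw [this]
    exact weakHomotopyEquivalences_id _
  have h₄ : (T.map (coprod.inl ≫ h.i)).hom ≫ (T.map h.p).hom = (T.map q).hom := by
    rw [← Bimod.comp_hom', ← T.map_comp, fac₁]
  exact h₄ ▸ weakHomotopyEquivalences.comp_mem _ _ h₁ h₃

/-- Tensoring with a cofibrant bimodule preserves bimodule maps that are anodyne on underlying
simplicial sets, whether or not they are cofibrations of bimodules: by attaching the cells of `X`
one reduces to Leibniz pushouts of `q` with free maps on boundary inclusions, whose underlying maps
are Leibniz pushouts of `q` with monomorphisms of simplicial sets. -/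
lemma anodyneExtensions_whiskerRight_hom {M N : Bimod R R} (q : M ⟶ N)
    (hq : anodyneExtensions q.hom) (X : Bimod R R) (hX : bimodCofibrations R (initial.to X)) :
    anodyneExtensions (q ▷ X).hom := by
  intro E B p hp
  let F := curriedTensor (Bimod R R) ⋙ (Functor.whiskeringRight _ _ _).obj (Bimod.forget R)
  have (Y : Bimod R R) : (F.obj Y).IsLeftAdjoint :=
    inferInstanceAs (tensorLeft Y ⋙ Bimod.forget R).IsLeftAdjoint
  refine hasLiftingProperty_pushoutObjObj_of_right F (f := q) (I := bimodI R) ?_ hX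
    (.ofIsInitialRight F q (initial.to X) initialIsInitial)
  rintro _ _ _ ⟨n⟩
  let i := (∂Δ[n] : SSet.Subcomplex.{u} _).ι
  let sq := Functor.PushoutObjObj.ofHasPushout (curriedTensor SSet.{u}) q.hom (i ▷ R.X)
  have := mono_whiskerRight R.X i
  have : HasLiftingProperty sq.ι p := anodyneExtensions_pushoutObjObjι' sq hq _ hp
  refine ⟨transportPushoutObjObj (F := curriedTensor SSet.{u}) (F' := F) (A := Bimod.forget R)
    (B := tensorRight R.X) (A' := 𝟭 _) (B' := freeBimod R) (𝟭 _) (fun M K => tensorFreeIso M K)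
    (fun M M' f K => ?_) (fun M K K' f => ?_) sq, ?_⟩
  · refine tensor_ext fun n m ⟨a, k, b⟩ => ?_
    refine (congrArg ((tensorFreeIso M' K).hom.app n) (whiskerRight_tmk f _ m _)).trans ?_
    refine (tensorFreeIso_hom_tmk M' K _ a k b).trans ?_
    refine (congrArg (fun z : M'.X.obj n => (z, k, b)) (hom_ract f m a).symm).trans ?_
    exact (congrArg ((f.hom ▷ (K ⊗ R.X)).app n) (tensorFreeIso_hom_tmk M K m a k b)).symm
  · refine tensor_ext fun n m ⟨a, k, b⟩ => ?_
    refine (congrArg ((tensorFreeIso M K').hom.app n)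
      (whiskerLeft_tmk M ((freeBimod R).map f) m _)).trans ?_
    refine (tensorFreeIso_hom_tmk M K' m a (f.app n k) b).trans ?_
    exact (congrArg ((M.X ◁ (f ▷ R.X)).app n) (tensorFreeIso_hom_tmk M K m a k b)).symm
  · exact inferInstanceAs (HasLiftingProperty (sq.ι ≫ (tensorFreeIso _ _).inv) p)

/-- The analogue of `anodyneExtensions_whiskerRight_hom` on the other side. -/
lemma anodyneExtensions_whiskerLeft_hom {M N : Bimod R R} (q : M ⟶ N)
    (hq : anodyneExtensions q.hom) (X : Bimod R R) (hX : bimodCofibrations R (initial.to X)) :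
    anodyneExtensions (X ◁ q).hom := by
  intro E B p hp
  let F := (curriedTensor (Bimod R R)).flip ⋙ (Functor.whiskeringRight _ _ _).obj (Bimod.forget R)
  have (Y : Bimod R R) : (F.obj Y).IsLeftAdjoint :=
    inferInstanceAs (tensorRight Y ⋙ Bimod.forget R).IsLeftAdjoint
  refine hasLiftingProperty_pushoutObjObj_of_right F (f := q) (I := bimodI R) ?_ hX
    (.ofIsInitialRight F q (initial.to X) initialIsInitial)
  rintro _ _ _ ⟨n⟩
  let i := (∂Δ[n] : SSet.Subcomplex.{u} _).ι
  let sq := Functor.PushoutObjObj.ofHasPushout (curriedTensor SSet.{u}) i q.hom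
  have : HasLiftingProperty (R.X ◁ sq.ι) p :=
    (anodyneExtensions_pushoutObjObjι sq hq).whiskerLeft _ _ hp
  refine ⟨transportPushoutObjObj (F := (curriedTensor SSet.{u}).flip) (F' := F)
    (A := Bimod.forget R) (B := 𝟭 _) (A' := 𝟭 _) (B' := freeBimod R) (tensorLeft R.X)
    (fun M K => freeTensorIso K M) (fun M M' f K => ?_) (fun M K K' f => ?_) sq.flip, ?_⟩
  · refine tensor_ext fun n ⟨a, k, b⟩ x => ?_
    refine (congrArg ((freeTensorIso K M').hom.app n) (whiskerLeft_tmk _ f _ x)).trans ?_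
    refine (freeTensorIso_hom_tmk K M' a k b _).trans ?_
    refine (congrArg (fun z : M'.X.obj n => (a, k, z)) (hom_lact f b x).symm).trans ?_
    exact (congrArg ((R.X ◁ (K ◁ f.hom)).app n) (freeTensorIso_hom_tmk K M a k b x)).symm
  · refine tensor_ext fun n ⟨a, k, b⟩ x => ?_
    refine (congrArg ((freeTensorIso K' M).hom.app n)
      (whiskerRight_tmk ((freeBimod R).map f) M _ x)).trans ?_
    refine (freeTensorIso_hom_tmk K' M a (f.app n k) b x).trans ?_
    exact (congrArg ((R.X ◁ (f ▷ M.X)).app n) (freeTensorIso_hom_tmk K M a k b x)).symm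
  · exact inferInstanceAs (HasLiftingProperty (R.X ◁ sq.ι ≫ (freeTensorIso _ _).inv) p)

lemma weakHomotopyEquivalences_whiskerRight_hom {M N : Bimod R R} (q : M ⟶ N)
    (hq : weakHomotopyEquivalences q.hom) (X : Bimod R R)
    (hX : bimodCofibrations R (initial.to X)) : weakHomotopyEquivalences (q ▷ X).hom :=
  weakHomotopyEquivalences_map_of_anodyneExtensions (tensorRight X) (fun _ _ q hq =>
    anodyneExtensions_le_weakHomotopyEquivalences _
      (anodyneExtensions_whiskerRight_hom q hq X hX)) q hq

lemma weakHomotopyEquivalences_whiskerLeft_hom {M N : Bimod R R} (q : M ⟶ N)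
    (hq : weakHomotopyEquivalences q.hom) (X : Bimod R R)
    (hX : bimodCofibrations R (initial.to X)) : weakHomotopyEquivalences (X ◁ q).hom :=
  weakHomotopyEquivalences_map_of_anodyneExtensions (tensorLeft X) (fun _ _ q hq =>
    anodyneExtensions_le_weakHomotopyEquivalences _
      (anodyneExtensions_whiskerLeft_hom q hq X hX)) q hq

lemma isMonoidalModelCategory_bimod (R : Mon SSet.{u}) :
    let := bimodModelCategory R
    IsMonoidalModelCategory (Bimod R R) := by
  let := bimodModelCategory R
  have cof {X Y : Bimod R R} (f : X ⟶ Y) [Cofibration f] : bimodCofibrations R f :=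
    mem_cofibrations f
  have triv {X Y : Bimod R R} (f : X ⟶ Y) [Cofibration f] [WeakEquivalence f] :
      (bimodJ R).rlp.llp f :=
    (bimod_trivialCofibrations_eq R).le _ (mem_trivialCofibrations f)
  have weq {X Y : Bimod R R} (f : X ⟶ Y) [WeakEquivalence f] : weakHomotopyEquivalences f.hom :=
    mem_weakEquivalences f
  have weq' {X Y : Bimod R R} (f : X ⟶ Y) (hf : (bimodJ R).rlp.llp f) : WeakEquivalence f :=
    ⟨((bimodCofibrations_and_weakHomotopyEquivalences_iff f).2 hf).2⟩
  exact
    { cofibration_pushoutProduct f g :=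
        ⟨bimodCofibrations_pushoutObjObj_ι (cof f) (cof g) (.ofHasPushout _ f g)⟩
      weakEquivalence_pushoutProduct_left f g :=
        weq' _ (bimodJ_rlp_llp_pushoutObjObj_ι_left (triv f) (cof g) (.ofHasPushout _ f g))
      weakEquivalence_pushoutProduct_right f g :=
        weq' _ (bimodJ_rlp_llp_pushoutObjObj_ι_right (cof f) (triv g) (.ofHasPushout _ f g))
      unit_left q _ _ X _ := by
        have : WeakEquivalence (q ▷ X) :=
          ⟨weakHomotopyEquivalences_whiskerRight_hom q (weq q) X (cof _)⟩
        infer_instance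
      unit_right q _ _ X _ := by
        have : WeakEquivalence (X ◁ q) :=
          ⟨weakHomotopyEquivalences_whiskerLeft_hom q (weq q) X (cof _)⟩
        infer_instance }

end

end SSet

theorem lemma3 (A : SimplicialObject MonCat.{u}) :
    HasLimits (SimplicialBimod A) ∧ HasColimits (SimplicialBimod A) ∧
    ∃ _ : ModelCategory (SimplicialBimod A),
      fibrations (SimplicialBimod A) =
        SSet.kanFibrations.inverseImage (SimplicialBimod.forget A) ∧
      weakEquivalences (SimplicialBimod A) =
        SSet.weakHomotopyEquivalences.inverseImage (SimplicialBimod.forget A) ∧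
      MorphismProperty.HasFunctorialFactorization
        (trivialCofibrations (SimplicialBimod A)) (fibrations (SimplicialBimod A)) ∧
      MorphismProperty.HasFunctorialFactorization
        (cofibrations (SimplicialBimod A)) (trivialFibrations (SimplicialBimod A)) ∧
      IsMonoidalModelCategory (SimplicialBimod A) := by
  let R := simplicialMonoidToMon A
  exact ⟨inferInstanceAs (HasLimits (Bimod R R)), inferInstanceAs (HasColimits (Bimod R R)),
    SSet.bimodModelCategory R, rfl, rfl, SSet.bimod_hasFunctorialFactorization_fibrations R,
    SSet.bimod_hasFunctorialFactorization_trivialFibrations R, SSet.isMonoidalModelCategory_bimod R⟩
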